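/- **Setting.** Let $\boldsymbol R^4_1$ be $\boldsymbol R^4$ with $\langle x,y\rangle=-x_0y_0+x_1y_1+x_2y_2+x_3y_3$, identified with the Hermitian $2\times2$ matrices by $x\leftrightarrow\begin{pmatrix}x_0+x_3&x_1+ix_2\\x_1-ix_2&x_0-x_3\end{pmatrix}$, let $S^3_1=\{x:\langle x,x\rangle=1\}$ be de Sitter space, and let $e_3=\mathrm{diag}(1,-1)$ and $\Delta^*=\{z\in\boldsymbol C: 0<|z|<1\}$. The future and past ideal boundaries are $\partial_\pm S^3_1=\{v:\langle v,v\rangle=0,\ \pm v_0>0\}/\boldsymbol R_+$; a map into $S^3_1$ converges to $[v]\in\partial_\pm S^3_1$ if its values converge to $[v]$ in the space of rays $(\boldsymbol R^4\setminus\{0\})/\boldsymbol R_+$. A $C^\infty$ map $f:\Delta^*\to S^3_1$ is a *CMC-1 face* if (1) there is an open dense $W\subset\Delta^*$ on which $f$ is a spacelike immersion of constant mean curvature $1$ (for a suitable unit normal); (2) every point where the induced metric $ds^2$ degenerates has a neighbourhood $U$ and a $C^1$ function $\lambda:U\cap W\to(0,\infty)$ such that $\lambda\,ds^2$ extends to a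 $C^1$ Riemannian metric on $U$; (3) $df\neq0$ everywhere. A *holomorphic null lift* of $f$ is a holomorphic immersion $F=(F_{jk}):\widetilde\Delta^*\to \mathrm{SL}_2\boldsymbol C$ on the universal cover such that $f=Fe_3F^*$ and $$F^{-1}dF=\begin{pmatrix}g&-g^2\\1&-g\end{pmatrix}\omega$$ for a meromorphic function $g$ (a *secondary Gauss map* of $f$) and a holomorphic $1$-form $\omega$ on $\widetilde\Delta^*$. The *hyperbolic Gauss map* $G=dF_{11}/dF_{21}=dF_{12}/dF_{22}$ is a map $\Delta^*\to\boldsymbol C\cup\{\infty\}$. The end of $f$ at $z=0$ is *regular* if $G$ has at most a pole at $0$ (that is, it extends holomorphically to $0$ as a map into $\boldsymbol C\cup\{\infty\}$). It is *complete* if there is a symmetric $2$-tensor field $T$ on $\Delta^*$, vanishing on a punctured neighbourhood of $0$, such that $ds^2+T$ is a Riemannian metric on $\Delta^*$ for which every path $\gamma:[0,1)\to\Delta^*$ with $\gamma(t)\to0$ as $t\to1$ has infinite length. **Proposition.** Let $f:\Delta^*\to S^3_1$ be a CMC-1 face whose end at $z=0$ is complete and regular, and let $g$ be a secondary Gauss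 map of $f$. Then 1. $f(z)$ converges, as $z\to0$, to a point of $\partial_+S^3_1$ if and only if $|g|<1$ near the end; 2. $f(z)$ converges, as $z\to0$, to a point of $\partial_-S^3_1$ if and only if $|g|>1$ near the end. Here "$|g|<1$ near the end" means that, for some $r>0$, $|g|<1$ at all points of $\widetilde\Delta^*$ lying over $\{0<|z|<r\}$, and similarly for $|g|>1$, with $|g|=\infty$ at the poles of $g$. -/

import Mathlib

open Filter Topology MeasureTheory Set
open scoped ContDiff Matrix ENNReal

noncomputable section

namespace CMCFace

/-! ### Lorentz-Minkowski space and de Sitter space -/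

/-- The underlying vector space of Lorentz-Minkowski 4-space, with coordinates `x 0, …, x 3`. -/
abbrev Mink : Type := Fin 4 → ℝ

/-- The Lorentz metric `-x₀y₀ + x₁y₁ + x₂y₂ + x₃y₃`. -/
def lorentz : LinearMap.BilinForm ℝ Mink :=
  Matrix.toBilin' (Matrix.diagonal ![-1, 1, 1, 1])

/-- De Sitter 3-space. -/
def deSitter : Set Mink := {x | lorentz x x = 1}

/-- The identification of Lorentz-Minkowski space with the Hermitian `2 × 2` matrices. -/
def toHerm (x : Mink) : Matrix (Fin 2) (Fin 2) ℂ :=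
  !![(x 0 : ℂ) + x 3, (x 1 : ℂ) + Complex.I * x 2;
     (x 1 : ℂ) - Complex.I * x 2, (x 0 : ℂ) - x 3]

/-- The matrix `e₃ = diag(1, -1)`. -/
def e3 : Matrix (Fin 2) (Fin 2) ℂ := !![1, 0; 0, -1]

/-! ### The ideal boundary

The ideal boundary consists of the rays (classes modulo positive scalars) of the light cone. De
Sitter space also embeds into the space of all rays, and convergence to ideal points is convergence
there. -/

/-- The future ideal boundary: the rays of the future light cone. -/
def futureBoundary : Set (Module.Ray ℝ Mink) :=
  {P | ∃ (v : Mink) (hv : v ≠ 0), lorentz v v = 0 ∧ 0 < v 0 ∧ P = rayOfNeZero ℝ v hv}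

/-- The past ideal boundary: the rays of the past light cone. -/
def pastBoundary : Set (Module.Ray ℝ Mink) :=
  {P | ∃ (v : Mink) (hv : v ≠ 0), lorentz v v = 0 ∧ v 0 < 0 ∧ P = rayOfNeZero ℝ v hv}

/-- `f` converges, along the filter `l`, to the ray `P` in the space of rays (which is
homeomorphic to the unit sphere through `x ↦ x / ‖x‖`). -/
def ConvergesToRay (f : ℂ → Mink) (l : Filter ℂ) (P : Module.Ray ℝ Mink) : Prop :=
  ∃ (v : Mink) (hv : v ≠ 0), P = rayOfNeZero ℝ v hv ∧
    Tendsto (fun z => ‖f z‖⁻¹ • f z) l (𝓝 (‖v‖⁻¹ • v))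

/-! ### First fundamental form and mean curvature -/

/-- The induced metric `ds²` of `f` at the point `z`. -/
def firstForm (f : ℂ → Mink) (z : ℂ) : LinearMap.BilinForm ℝ ℂ :=
  lorentz.compl₁₂ (fderiv ℝ f z : ℂ →ₗ[ℝ] Mink) (fderiv ℝ f z : ℂ →ₗ[ℝ] Mink)

/-- The second fundamental form of `f` at `z` with respect to the normal vector `n`. -/
def secondForm (f : ℂ → Mink) (z : ℂ) (n : Mink) (u v : ℂ) : ℝ :=
  lorentz (fderiv ℝ (fun x => fderiv ℝ f x) z u v) n

/-- Half the trace of the second fundamental form with respect to the first one, computed in the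
basis `1, i` of the tangent plane. -/
def meanCurvature (f : ℂ → Mink) (z : ℂ) (n : Mink) : ℝ :=
  (firstForm f z 1 1 * secondForm f z n Complex.I Complex.I
      - 2 * firstForm f z 1 Complex.I * secondForm f z n 1 Complex.I
      + firstForm f z Complex.I Complex.I * secondForm f z n 1 1) /
    (2 * (firstForm f z 1 1 * firstForm f z Complex.I Complex.I - firstForm f z 1 Complex.I ^ 2))

/-- `n` is a unit normal vector (necessarily time-like) in de Sitter space of `f` at `z`. -/
def IsUnitNormal (f : ℂ → Mink) (z : ℂ) (n : Mink) : Prop :=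
  lorentz n n = -1 ∧ lorentz n (f z) = 0 ∧ ∀ u : ℂ, lorentz n (fderiv ℝ f z u) = 0

/-- A Riemannian metric of class `C^k` on the open subset `V` of the plane. -/
structure IsRiemannianMetric (k : WithTop ℕ∞) (V : Set ℂ) (h : ℂ → LinearMap.BilinForm ℝ ℂ) :
    Prop where
  symm : ∀ z ∈ V, ∀ u v, h z u v = h z v u
  pos : ∀ z ∈ V, ∀ u, u ≠ 0 → 0 < h z u u
  contDiffOn : ∀ u v, ContDiffOn ℝ k (fun z => h z u v) V

/-- The points where the induced metric degenerates. -/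
def IsSingularPoint (f : ℂ → Mink) (z : ℂ) : Prop :=
  ∃ u : ℂ, u ≠ 0 ∧ ∀ v, firstForm f z u v = 0

/-- `f` is a CMC-1 face into de Sitter space, defined on the open subset `M` of the plane. (The
sign of the unit normal vector is not prescribed.) -/
structure IsCMCOneFace (M : Set ℂ) (f : ℂ → Mink) : Prop where
  mapsTo : MapsTo f M deSitter
  smooth : ContDiffOn ℝ ∞ f M
  exists_regular : ∃ W : Set ℂ, IsOpen W ∧ W ⊆ M ∧ M ⊆ closure W ∧
    (∀ z ∈ W, (∀ u : ℂ, u ≠ 0 → 0 < firstForm f z u u) ∧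
      ∃ n, IsUnitNormal f z n ∧ meanCurvature f z n = 1) ∧
    ∀ p ∈ M, IsSingularPoint f p →
      ∃ (V : Set ℂ) (lam : ℂ → ℝ) (h : ℂ → LinearMap.BilinForm ℝ ℂ),
        IsOpen V ∧ p ∈ V ∧ V ⊆ M ∧ ContDiffOn ℝ 1 lam (V ∩ W) ∧ (∀ z ∈ V ∩ W, 0 < lam z) ∧
        IsRiemannianMetric 1 V h ∧ ∀ z ∈ V ∩ W, h z = lam z • firstForm f z
  fderiv_ne_zero : ∀ p ∈ M, fderiv ℝ f p ≠ 0

/-! ### Ends -/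

/-- The punctured unit disk. -/
def puncturedDisk : Set ℂ := {z | 0 < ‖z‖ ∧ ‖z‖ < 1}

/-- The length, with respect to the metric `h`, of a path parametrized by `[0, 1)`. -/
def pathLength (h : ℂ → LinearMap.BilinForm ℝ ℂ) (γ : ℝ → ℂ) : ℝ≥0∞ :=
  ∫⁻ t in Ioo (0 : ℝ) 1, ENNReal.ofReal √(h (γ t) (deriv γ t) (deriv γ t))

/-- The end at the puncture `0` of `f` is complete: after adding to the induced metric a symmetric
2-tensor field `T` which vanishes near the puncture, one obtains a Riemannian metric for which all
paths running into the puncture have infinite length. -/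
def IsCompleteEnd (f : ℂ → Mink) : Prop :=
  ∃ T : ℂ → LinearMap.BilinForm ℝ ℂ,
    (∃ r : ℝ, 0 < r ∧ ∀ z, 0 < ‖z‖ → ‖z‖ < r → T z = 0) ∧
    IsRiemannianMetric ∞ puncturedDisk (fun z => T z + firstForm f z) ∧
    ∀ γ : ℝ → ℂ, ContDiffOn ℝ 1 γ (Ico 0 1) → MapsTo γ (Ico 0 1) puncturedDisk →
      Tendsto γ (𝓝[<] 1) (𝓝 0) → pathLength (fun z => T z + firstForm f z) γ = ⊤

/-! ### Holomorphic null lifts and Gauss maps -/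

/-- The left half-plane, which is the universal cover of the punctured unit disk through the
covering map `w ↦ exp w`. -/
def leftHalfPlane : Set ℂ := {w | w.re < 0}

/-- The entrywise derivative of a matrix-valued function. -/
def matDeriv (F : ℂ → Matrix (Fin 2) (Fin 2) ℂ) (w : ℂ) : Matrix (Fin 2) (Fin 2) ℂ :=
  Matrix.of fun i j => deriv (fun x => F x i j) w

/-- `F` is a holomorphic null lift of `f` (defined on the universal cover), with Weierstrass data
`(g, ω)`, where `ω = om w dw`; so `g` is a secondary Gauss map of `f`. The equation
`F⁻¹ dF = (g, -g²; 1, -g) ω` is imposed where `g` is finite; at a pole of `g` its right-hand side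
is defined by continuity. That `F` is an immersion means that `(1 + |g|²)² |ω|²` is a Riemannian
metric. The normal form in `meromorphic` only fixes the values of `g` at isolated points. -/
structure IsNullLift (f : ℂ → Mink) (F : ℂ → Matrix (Fin 2) (Fin 2) ℂ) (g om : ℂ → ℂ) : Prop where
  meromorphic : MeromorphicNFOn g leftHalfPlane
  holomorphic_form : DifferentiableOn ℂ om leftHalfPlane
  holomorphic : ∀ i j, DifferentiableOn ℂ (fun w => F w i j) leftHalfPlane
  det_eq_one : ∀ w ∈ leftHalfPlane, (F w).det = 1
  immersion : ∀ w ∈ leftHalfPlane, matDeriv F w ≠ 0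
  ode : ∀ w ∈ leftHalfPlane, 0 ≤ meromorphicOrderAt g w →
    (F w)⁻¹ * matDeriv F w = om w • !![g w, -(g w) ^ 2; 1, -(g w)]
  projection : ∀ w ∈ leftHalfPlane, toHerm (f (Complex.exp w)) = F w * e3 * (F w)ᴴ

/-- The end at `0` is regular: the hyperbolic Gauss map `G = dF₁₁ / dF₂₁ = dF₁₂ / dF₂₂` has at most
a pole at `0`, that is, near `0` it is the quotient `p / q` of two holomorphic functions without
common zero at `0` (the constant `G = ∞` being allowed). -/
def IsRegularEnd (F : ℂ → Matrix (Fin 2) (Fin 2) ℂ) : Prop :=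
  ∃ p q : ℂ → ℂ, AnalyticAt ℂ p 0 ∧ AnalyticAt ℂ q 0 ∧ (p 0 ≠ 0 ∨ q 0 ≠ 0) ∧
    ∃ r : ℝ, 0 < r ∧ ∀ w ∈ leftHalfPlane, ‖Complex.exp w‖ < r → ∀ j : Fin 2,
      matDeriv F w 0 j * q (Complex.exp w) = matDeriv F w 1 j * p (Complex.exp w)

open Classical in
/-- The modulus of a meromorphic function, with value `∞` at the poles. -/
def extAbs (g : ℂ → ℂ) (w : ℂ) : ℝ≥0∞ :=
  if meromorphicOrderAt g w < 0 then ⊤ else ENNReal.ofReal ‖g w‖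

end CMCFace

end

/-! Near a complete end the induced metric `(1 - |g|²)² |ω|²` is nondegenerate, so `|g| ≠ 1` there.
Since a half-plane is connected, either `|g| < 1` or `|g| > 1` near the whole end
(`exists_extAbs_lt_one_or_one_lt`). No map converges to both ideal boundaries, so it suffices that
`|g| < 1` forces convergence to the future and `|g| > 1` to the past. The second case is the first
one for `-f`, with the columns of `F` exchanged and `g` replaced by `1/g`
(`IsNullLift.diskLift_neg`); a half turn of the sphere of rays makes `G` finite at the puncture
(`DiskLift.halfTurn`).

Let `|g| < 1`, let `z = exp w`, and let primes denote derivatives in `w`. Everything is governed by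
the potential `P = F₁₁ - G F₂₁`, through `P (F₂₂ + g F₂₁) = 1`, `P' = -G' F₂₁` and `g' P² = G'`. If
`|P F₂₁| → ∞`, `P / F₂₁ → 0` and `g` stays away from the unit circle, then `H = F e₃ F*` has `H₂₂ →
∞` and `H₁₂ / H₂₂ → G(0)` (`UnitaryFrame.endsAt_of_tendsto`), which means convergence to the future
null direction over `G(0)` (`EndsAt.tendsToFuture`).

If `G` is not constant, the growth is read off from the monodromy of `F`, a constant element of
`SU(1,1)` acting on `g` as a disk automorphism; it has a fixed point in the closed disk. An interior
fixed point makes it a rotation. Then `g'` is a positive real power of `z` times a unit, and so is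
`P²` up to the sign of the exponent; the only exponents that would spoil the limits make the induced
metric bounded, contradicting completeness (`UnitaryFrame.endsAt_of_exponent`). With a boundary
fixed point, `g` is moved to the right half-plane, where the monodromy is affine. A dilation
contradicts Schwarz-Pick (`eq_one_of_multiplicative_of_re_pos`), the identity is a rotation again,
and a translation makes `g` grow like `-log |z|`, which suffices
(`NullFrame.endsAt_of_translation`).

If `G` is constant, so is `g`, and after normalization `g = 0` and the metric is the flat metric
`|dΩ|` with `Ω = P F₂₁`. Completeness gives `Ω` a pole (`tendsto_norm_atTop_of_isCompleteDensity`),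
and the limits follow. -/

noncomputable section

namespace CMCFace

/-! ### Periodic holomorphic functions on a half-plane -/

/-- The half-plane `re w < a`. -/
def halfPlane (a : ℝ) : Set ℂ := {w | w.re < a}

theorem isOpen_halfPlane (a : ℝ) : IsOpen (halfPlane a) :=
  isOpen_lt Complex.continuous_re continuous_const

theorem convex_halfPlane (a : ℝ) : Convex ℝ (halfPlane a) :=
  convex_halfSpace_re_lt a

theorem halfPlane_mono {a b : ℝ} (h : a ≤ b) : halfPlane a ⊆ halfPlane b :=
  fun _ hw => lt_of_lt_of_le hw h

theorem mem_halfPlane_iff_norm_exp {a : ℝ} {w : ℂ} :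
    w ∈ halfPlane a ↔ ‖Complex.exp w‖ < Real.exp a := by
  rw [Complex.norm_exp, Real.exp_lt_exp]; rfl

theorem add_period_mem {a : ℝ} {w : ℂ} (hw : w ∈ halfPlane a) :
    w + 2 * Real.pi * Complex.I ∈ halfPlane a := by
  simpa [halfPlane] using hw

theorem exp_add_period (w : ℂ) :
    Complex.exp (w + 2 * Real.pi * Complex.I) = Complex.exp w :=
  Complex.exp_periodic w

theorem exists_halfPlane_of_eventually {p : ℂ → Prop} (h : ∀ᶠ z in 𝓝[≠] (0 : ℂ), p z) (a : ℝ) :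
    ∃ b ≤ a, ∀ w ∈ halfPlane b, p (Complex.exp w) := by
  rw [eventually_nhdsWithin_iff, Metric.eventually_nhds_iff] at h
  obtain ⟨ε, hε, h⟩ := h
  refine ⟨min a (Real.log ε), min_le_left _ _, fun w hw => h ?_ (Complex.exp_ne_zero w)⟩
  have : w ∈ halfPlane (Real.log ε) := halfPlane_mono (min_le_right _ _) hw
  rw [mem_halfPlane_iff_norm_exp, Real.exp_log hε] at this
  simpa using this

theorem log_mem_halfPlane {a : ℝ} {z : ℂ} (h0 : z ≠ 0) (hz : ‖z‖ < Real.exp a) :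
    Complex.log z ∈ halfPlane a := by
  rwa [mem_halfPlane_iff_norm_exp, Complex.exp_log h0]

theorem eventually_log_mem_halfPlane (a : ℝ) :
    ∀ᶠ z in 𝓝[≠] (0 : ℂ), Complex.log z ∈ halfPlane a := by
  rw [eventually_nhdsWithin_iff, Metric.eventually_nhds_iff]
  exact ⟨Real.exp a, Real.exp_pos a, fun z hz h0 => log_mem_halfPlane h0 (by simpa using hz)⟩

/-- The function descends to the punctured disk, and boundedness removes the singularity. The
extension is the cusp function of a function of real period. -/
theorem exists_differentiableOn_of_periodic {u : ℂ → ℂ} {a C : ℝ}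
    (hd : DifferentiableOn ℂ u (halfPlane a))
    (hp : ∀ w ∈ halfPlane a, u (w + 2 * Real.pi * Complex.I) = u w)
    (hb : ∀ w ∈ halfPlane a, ‖u w‖ ≤ C) :
    ∃ h : ℂ → ℂ, DifferentiableOn ℂ h (Metric.ball 0 (Real.exp a)) ∧
      ∀ w ∈ halfPlane a, u w = h (Complex.exp w) := by
  -- Multiplication by `I` turns the imaginary period into a real one and the left end into the
  -- cusp; the indicator makes periodicity hold on all of the plane.
  set f : ℂ → ℂ := fun z => (halfPlane a).indicator u (Complex.I * z) with hf
  have hpi : (0 : ℝ) < 2 * Real.pi := by positivity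
  have hper : Function.Periodic f ((2 * Real.pi : ℝ) : ℂ) := by
    intro z
    have e : Complex.I * (z + (2 * Real.pi : ℝ)) = Complex.I * z + 2 * Real.pi * Complex.I := by
      push_cast; ring
    simp only [hf, e]
    by_cases hz : Complex.I * z ∈ halfPlane a
    · rw [indicator_of_mem hz, indicator_of_mem (add_period_mem hz), hp _ hz]
    · rw [indicator_of_notMem hz, indicator_of_notMem]
      intro h; apply hz; simpa [halfPlane] using h
  have hq : ∀ z, Function.Periodic.qParam (2 * Real.pi) z = Complex.exp (Complex.I * z) := by
    intro z
    have : (Real.pi : ℂ) ≠ 0 := by exact_mod_cast Real.pi_ne_zero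
    rw [Function.Periodic.qParam]; congr 1; push_cast; field_simp
  have hdf : ∀ z, Complex.I * z ∈ halfPlane a → DifferentiableAt ℂ f z := by
    intro z hz
    have h1 : DifferentiableAt ℂ ((halfPlane a).indicator u) (Complex.I * z) := by
      refine ((hd.differentiableAt ((isOpen_halfPlane a).mem_nhds hz)).congr_of_eventuallyEq ?_)
      filter_upwards [(isOpen_halfPlane a).mem_nhds hz] with x hx using indicator_of_mem hx u
    exact h1.comp z (by fun_prop : DifferentiableAt ℂ (fun z => Complex.I * z) z)
  refine ⟨Function.Periodic.cuspFunction (2 * Real.pi) f, ?_, ?_⟩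
  · intro z hz
    apply DifferentiableAt.differentiableWithinAt
    rcases eq_or_ne z 0 with rfl | h0
    · have hI : ∀ᶠ z : ℂ in comap Complex.im atTop, Complex.I * z ∈ halfPlane a := by
        filter_upwards [(eventually_gt_atTop (-a)).comap Complex.im] with z hz
        simpa [halfPlane, neg_lt] using hz
      refine Function.Periodic.differentiableAt_cuspFunction_zero hpi hper
        (hI.mono hdf) (Asymptotics.IsBigO.of_bound C ?_)
      filter_upwards [hI] with z hz
      simpa [hf, indicator_of_mem hz] using hb _ hz
    · have e : z = Function.Periodic.qParam (2 * Real.pi) (-Complex.I * Complex.log z) := by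
        rw [hq, ← mul_assoc]; simp [Complex.exp_log h0]
      rw [e]
      apply Function.Periodic.differentiableAt_cuspFunction hpi.ne' hper
      apply hdf
      rw [← mul_assoc]
      simpa using log_mem_halfPlane h0 (by simpa using hz)
  · intro w hw
    have := Function.Periodic.eq_cuspFunction hpi.ne' hper (-Complex.I * w)
    rw [hq, ← mul_assoc] at this
    simp only [mul_neg, Complex.I_mul_I, neg_neg, one_mul] at this
    rw [this]
    simp only [hf, ← mul_assoc, mul_neg, Complex.I_mul_I, neg_neg, one_mul]
    rw [indicator_of_mem hw]

theorem eventually_eq_zero_or_eq_pow_mul {h : ℂ → ℂ} (hh : AnalyticAt ℂ h 0) :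
    (∀ᶠ z in 𝓝 0, h z = 0) ∨
      ∃ (n : ℕ) (k : ℂ → ℂ), AnalyticAt ℂ k 0 ∧ k 0 ≠ 0 ∧ ∀ᶠ z in 𝓝 0, h z = z ^ n * k z := by
  by_cases h0 : ∀ᶠ z in 𝓝 0, h z = 0
  · exact Or.inl h0
  · obtain ⟨n, k, hk, hk0, he⟩ := hh.exists_eventuallyEq_pow_smul_nonzero_iff.mpr h0
    exact Or.inr ⟨n, k, hk, hk0, by simpa using he⟩

theorem eqOn_zero_of_halfPlane {u : ℂ → ℂ} {a b : ℝ} (hba : b ≤ a)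
    (hd : DifferentiableOn ℂ u (halfPlane a)) (h0 : ∀ w ∈ halfPlane b, u w = 0) :
    ∀ w ∈ halfPlane a, u w = 0 := by
  have hb : ((b - 1 : ℝ) : ℂ) ∈ halfPlane b := by simp [halfPlane]
  have := (hd.analyticOnNhd (isOpen_halfPlane a)).eqOn_zero_of_preconnected_of_eventuallyEq_zero
    (convex_halfPlane a).isPreconnected (halfPlane_mono hba hb)
    (by filter_upwards [(isOpen_halfPlane b).mem_nhds hb] with w hw using h0 w hw)
  exact fun w hw => this hw

/-- A bounded holomorphic function on a half-plane on which the deck transformation acts by a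
unimodular constant is a power of `exp w` times a unit. -/
theorem exists_eq_exp_mul_of_multiplicative {u : ℂ → ℂ} {a C ν : ℝ}
    (hd : DifferentiableOn ℂ u (halfPlane a))
    (hp : ∀ w ∈ halfPlane a,
      u (w + 2 * Real.pi * Complex.I) = Complex.exp (2 * Real.pi * Complex.I * ν) * u w)
    (hb : ∀ w ∈ halfPlane a, ‖u w‖ ≤ C) (h0 : ∃ w ∈ halfPlane a, u w ≠ 0) :
    ∃ (n : ℤ) (h : ℂ → ℂ), AnalyticAt ℂ h 0 ∧ h 0 ≠ 0 ∧ ∃ b ≤ a, ∀ w ∈ halfPlane b,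
      u w = Complex.exp (((ν + n : ℝ) : ℂ) * w) * h (Complex.exp w) := by
  -- The factor `exp ((N - ν) w)` cancels the multiplier because `N` is an integer, and is bounded
  -- on the half-plane because `N ≥ ν`.
  set N : ℤ := ⌈ν⌉ with hN
  have hNν : 0 ≤ (N : ℝ) - ν := sub_nonneg.mpr (Int.le_ceil ν)
  have hC : 0 ≤ C := by
    obtain ⟨w, hw, -⟩ := h0
    exact (norm_nonneg _).trans (hb w hw)
  obtain ⟨h, hh, hu⟩ := exists_differentiableOn_of_periodic
    (u := fun w => Complex.exp (((N - ν : ℝ) : ℂ) * w) * u w) (a := a)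
    (C := Real.exp ((N - ν) * a) * C) (by fun_prop)
    (by
      intro w hw
      simp only [hp w hw, ← mul_assoc, ← Complex.exp_add]
      congr 1
      rw [Complex.exp_eq_exp_iff_exists_int]
      exact ⟨N, by push_cast; ring⟩)
    (by
      intro w hw
      rw [norm_mul, Complex.norm_exp]
      have : (((N - ν : ℝ) : ℂ) * w).re = (N - ν) * w.re := by
        rw [Complex.re_ofReal_mul]
      rw [this]
      have hwa : w.re < a := hw
      gcongr
      exact hb w hw)
  have hha : AnalyticAt ℂ h 0 := hh.analyticAt (Metric.ball_mem_nhds _ (Real.exp_pos a))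
  have hu' : ∀ w ∈ halfPlane a, u w = Complex.exp (((ν - N : ℝ) : ℂ) * w) * h (Complex.exp w) := by
    intro w hw
    rw [← hu w hw, ← mul_assoc, ← Complex.exp_add]
    simp [← add_mul]
  rcases eventually_eq_zero_or_eq_pow_mul hha with hz | ⟨n, k, hk, hk0, he⟩
  · exfalso
    obtain ⟨b, hba, hb0⟩ := exists_halfPlane_of_eventually (hz.filter_mono nhdsWithin_le_nhds) a
    obtain ⟨w, hw, hne⟩ := h0
    exact hne (eqOn_zero_of_halfPlane hba hd
      (fun w hw => by rw [hu' w (halfPlane_mono hba hw), hb0 w hw, mul_zero]) w hw)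
  · obtain ⟨b, hba, hb0⟩ := exists_halfPlane_of_eventually (he.filter_mono nhdsWithin_le_nhds) a
    refine ⟨n - N, k, hk, hk0, b, hba, fun w hw => ?_⟩
    rw [hu' w (halfPlane_mono hba hw), hb0 w hw, ← mul_assoc, ← Complex.exp_nat_mul,
      ← Complex.exp_add]
    congr 2
    push_cast; ring

/-- A weak Schwarz-Pick inequality for functions into the right half-plane. -/
theorem norm_deriv_le_of_re_pos {u : ℂ → ℂ} {c : ℂ} {R : ℝ} (hR : 0 < R)
    (hd : DifferentiableOn ℂ u (Metric.ball c R)) (hp : ∀ w ∈ Metric.ball c R, 0 < (u w).re) :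
    ‖deriv u c‖ ≤ 2 * (u c).re / R := by
  have hc : c ∈ Metric.ball c R := Metric.mem_ball_self hR
  set k : ℂ := starRingEnd ℂ (u c) with hk
  have hne : ∀ w ∈ Metric.ball c R, u w + k ≠ 0 := by
    intro w hw h
    have := congrArg Complex.re h
    simp [hk] at this
    linarith [hp w hw, hp c hc]
  -- The Cayley quotient sends the right half-plane to the unit disk and `u c` to `0`; its
  -- derivative at `c` is `u'(c) / (2 Re u(c))`, so the Schwarz lemma gives the claim.
  have hmaps : MapsTo (fun w => (u w - u c) / (u w + k)) (Metric.ball c R)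
      (Metric.ball ((u c - u c) / (u c + k)) 1) := by
    intro w hw
    simp only [sub_self, zero_div, Metric.mem_ball, dist_zero_right]
    rw [norm_div, div_lt_one (norm_pos_iff.mpr (hne w hw)), ← sq_lt_sq₀ (norm_nonneg _)
      (norm_nonneg _), ← Complex.normSq_eq_norm_sq, ← Complex.normSq_eq_norm_sq,
      Complex.normSq_apply, Complex.normSq_apply]
    simp [hk]
    nlinarith [mul_pos (hp w hw) (hp c hc)]
  have hdiff : DifferentiableOn ℂ (fun w => (u w - u c) / (u w + k)) (Metric.ball c R) :=
    (hd.sub_const _).div (hd.add_const _) hne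
  have := Complex.norm_deriv_le_div_of_mapsTo_ball hdiff
    (hmaps.mono_right Metric.ball_subset_closedBall) hR
  have hu : DifferentiableAt ℂ u c := hd.differentiableAt (Metric.ball_mem_nhds c hR)
  have hder : HasDerivAt (fun w => (u w - u c) / (u w + k)) (deriv u c / (u c + k)) c := by
    refine ((hu.hasDerivAt.sub_const (u c)).fun_div (hu.hasDerivAt.add_const k)
      (hne c hc)).congr_deriv ?_
    rw [div_eq_div_iff (pow_ne_zero 2 (hne c hc)) (hne c hc)]
    ring
  rw [hder.deriv] at this
  have hkk : u c + k = ((2 * (u c).re : ℝ) : ℂ) := by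
    rw [hk, Complex.add_conj]
  rw [hkk, norm_div, Complex.norm_real, Real.norm_of_nonneg (by linarith [hp c hc]),
    div_le_iff₀ (by linarith [hp c hc])] at this
  calc _ ≤ 1 / R * (2 * (u c).re) := this
    _ = _ := by ring

/-- The deck transformation cannot act as a hyperbolic translation. -/
theorem eq_one_of_multiplicative_of_re_pos {u : ℂ → ℂ} {a s : ℝ} (hs : 0 < s)
    (hd : DifferentiableOn ℂ u (halfPlane a)) (hp : ∀ w ∈ halfPlane a, 0 < (u w).re)
    (hm : ∀ w ∈ halfPlane a, u (w + 2 * Real.pi * Complex.I) = s * u w) : s = 1 := by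
  -- At depth `R` in the half-plane `log u` has derivative at most `2 / R`. The deck transformation
  -- moves points by only `2π` but adds `log s` to `log u`; then `R → ∞`.
  have key : ∀ R : ℝ, 0 < R → |Real.log s| ≤ 2 / R * (2 * Real.pi) := by
    intro R hR
    set w : ℂ := ((a - R : ℝ) : ℂ) with hw
    set S : Set ℂ := {x | x.re ≤ a - R} with hS
    have hSa : ∀ x ∈ S, x ∈ halfPlane a := fun x hx => by
      have : x.re ≤ a - R := hx
      show x.re < a
      linarith
    have hw0 : w ∈ S := by simp [hS, hw]
    have hw1 : w + 2 * Real.pi * Complex.I ∈ S := by simp [hS, hw]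
    have hball : ∀ x ∈ S, Metric.ball x R ⊆ halfPlane a := by
      intro x hx y hy
      have h1 : |(y - x).re| ≤ ‖y - x‖ := Complex.abs_re_le_norm _
      have h2 : ‖y - x‖ < R := by simpa [dist_eq_norm] using hy
      have h3 : x.re ≤ a - R := hx
      have h4 := (abs_le.mp h1).2
      rw [Complex.sub_re] at h4
      show y.re < a
      linarith
    have hda : ∀ x ∈ S, DifferentiableAt ℂ u x := fun x hx =>
      hd.differentiableAt ((isOpen_halfPlane a).mem_nhds (hSa x hx))
    have hmv := (convex_halfSpace_re_le (a - R)).norm_image_sub_le_of_norm_hasDerivWithin_le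
      (f := fun x => Complex.log (u x)) (f' := fun x => deriv u x / u x) (C := 2 / R)
      (fun x hx => ((hda x hx).hasDerivAt.clog (Or.inl (hp x (hSa x hx)))).hasDerivWithinAt)
      (by
        intro x hx
        have hpos := hp x (hSa x hx)
        have hne : u x ≠ 0 := fun h => by simp [h] at hpos
        rw [norm_div, div_le_iff₀ (norm_pos_iff.mpr hne)]
        refine (norm_deriv_le_of_re_pos hR (hd.mono (hball x hx))
          (fun y hy => hp y (hball x hx hy))).trans ?_
        have h1 : (u x).re ≤ ‖u x‖ := Complex.re_le_norm _
        calc 2 * (u x).re / R ≤ 2 * ‖u x‖ / R := by gcongr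
          _ = _ := by ring)
      hw0 hw1
    have hne : u w ≠ 0 := fun h => by simpa [h] using hp w (hSa w hw0)
    rw [hm w (hSa w hw0), Complex.log_ofReal_mul hs hne] at hmv
    simpa [abs_of_pos Real.pi_pos] using hmv
  have h0 : |Real.log s| ≤ 0 := by
    refine ge_of_tendsto (x := atTop) (f := fun R : ℝ => 2 / R * (2 * Real.pi)) ?_ ?_
    · simpa using (tendsto_id.const_div_atTop (2 : ℝ)).mul_const (2 * Real.pi)
    · filter_upwards [eventually_gt_atTop 0] with R hR using key R hR
  exact Real.eq_one_of_pos_of_log_eq_zero hs (abs_nonpos_iff.mp h0)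

/-! ### Path lifting through local homeomorphisms -/

/-- A path lifts through a separated local homeomorphism as soon as every partial lift has a cluster
point. -/
theorem exists_lift_of_mapClusterPt {E X : Type*} [TopologicalSpace E] [T2Space E]
    [TopologicalSpace X] [T2Space X] {p : E → X} (hp : IsLocalHomeomorph p) {γ : ℝ → X}
    (hγ : Continuous γ) {e₀ : E} (h0 : p e₀ = γ 0)
    (hlim : ∀ T ∈ Ioc (0 : ℝ) 1, ∀ ζ : ℝ → E, ContinuousOn ζ (Ico 0 T) → ζ 0 = e₀ →
      (∀ t ∈ Ico 0 T, p (ζ t) = γ t) → ∃ e, MapClusterPt e (𝓝[<] T) ζ) :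
    ∃ ζ : ℝ → E, ContinuousOn ζ (Icc 0 1) ∧ ζ 0 = e₀ ∧ ∀ t ∈ Icc (0 : ℝ) 1, p (ζ t) = γ t := by
  set Lift : ℝ → (ℝ → E) → Prop := fun T ζ =>
    ContinuousOn ζ (Icc 0 T) ∧ ζ 0 = e₀ ∧ ∀ t ∈ Icc (0 : ℝ) T, p (ζ t) = γ t with hLift
  have uniq : ∀ {T T' : ℝ} {ζ ζ' : ℝ → E}, T ≤ T' → Lift T ζ → Lift T' ζ' →
      EqOn ζ ζ' (Icc 0 T) := by
    intro T T' ζ ζ' hTT h h' t ht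
    have hsub : Icc (0 : ℝ) T ⊆ Icc 0 T' := Icc_subset_Icc_right hTT
    refine (T2Space.isSeparatedMap p).eqOn_of_comp_eqOn hp.isLocallyInjective isPreconnected_Icc
      h.1 (h'.1.mono hsub) (fun s hs => ?_) (left_mem_Icc.mpr (ht.1.trans ht.2))
      (h.2.1.trans h'.2.1.symm) ht
    simp only [Function.comp_apply, h.2.2 s hs, h'.2.2 s (hsub hs)]
  have extend : ∀ {t₁ T' : ℝ} {ζ : ℝ → E} (φ : OpenPartialHomeomorph E X), p = φ → 0 ≤ t₁ →
      t₁ ≤ T' → Lift t₁ ζ → ζ t₁ ∈ φ.source → (∀ t ∈ Icc t₁ T', γ t ∈ φ.target) →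
      ∃ ζ', Lift T' ζ' := by
    intro t₁ T' ζ φ hφ h01 h1T hζ hs ht
    have hR : EqOn (fun t => if t ≤ t₁ then ζ t else φ.symm (γ t)) (fun t => φ.symm (γ t))
        (Icc t₁ T') := by
      intro t h
      by_cases htt : t ≤ t₁
      · obtain rfl : t = t₁ := le_antisymm htt h.1
        simp only [le_refl, if_true]
        rw [← hζ.2.2 t (right_mem_Icc.mpr h01), hφ, φ.left_inv hs]
      · simp only [htt, if_false]
    have hL : EqOn (fun t => if t ≤ t₁ then ζ t else φ.symm (γ t)) ζ (Icc 0 t₁) :=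
      fun t h => if_pos h.2
    refine ⟨fun t => if t ≤ t₁ then ζ t else φ.symm (γ t), ?_, ?_, ?_⟩
    · rw [← Icc_union_Icc_eq_Icc h01 h1T]
      refine ContinuousOn.union_of_isClosed (hζ.1.congr hL) ?_ isClosed_Icc isClosed_Icc
      exact (φ.continuousOn_symm.comp hγ.continuousOn (fun t h => ht t h)).congr hR
    · simp only [h01, if_true]
      exact hζ.2.1
    · intro t h
      rcases le_total t t₁ with h' | h'
      · rw [hL ⟨h.1, h'⟩]
        exact hζ.2.2 t ⟨h.1, h'⟩
      · rw [hR ⟨h', h.2⟩]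
        simp only
        rw [hφ, φ.right_inv (ht t ⟨h', h.2⟩)]
  set S : Set ℝ := {T | T ∈ Icc (0 : ℝ) 1 ∧ ∃ ζ, Lift T ζ} with hS
  have hS0 : (0 : ℝ) ∈ S := by
    refine ⟨by simp, fun _ => e₀, continuousOn_const, rfl, fun t ht => ?_⟩
    obtain rfl : t = 0 := le_antisymm ht.2 ht.1
    exact h0
  have hbdd : BddAbove S := ⟨1, fun T hT => hT.1.2⟩
  set T := sSup S with hT
  have hT0 : 0 ≤ T := le_csSup hbdd hS0
  have hT1 : T ≤ 1 := csSup_le ⟨0, hS0⟩ fun T hT => hT.1.2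
  have hlift : ∀ t, 0 ≤ t → t < T → ∃ ζ, Lift t ζ := by
    intro t h0t htT
    obtain ⟨s, hs, hts⟩ := exists_lt_of_lt_csSup ⟨0, hS0⟩ htT
    obtain ⟨ζ, hζ⟩ := hs.2
    have hsub : Icc (0 : ℝ) t ⊆ Icc 0 s := Icc_subset_Icc_right hts.le
    exact ⟨ζ, hζ.1.mono hsub, hζ.2.1, fun x hx => hζ.2.2 x (hsub hx)⟩
  -- What is needed to pass the supremum `T`: a lift up to some `t₁ ≤ T` ending in a chart whose
  -- image contains the rest of the path up to `T`. For `T = 0` the chart is at `e₀`, otherwise at a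
  -- cluster point.
  obtain ⟨t₁, ζ₁, φ, h01, h1T, hφ, hζ₁, hs₁, htar, hTtar⟩ : ∃ (t₁ : ℝ) (ζ₁ : ℝ → E)
      (φ : OpenPartialHomeomorph E X), 0 ≤ t₁ ∧ t₁ ≤ T ∧ p = φ ∧ Lift t₁ ζ₁ ∧ ζ₁ t₁ ∈ φ.source ∧
      (∀ t ∈ Icc t₁ T, γ t ∈ φ.target) ∧ γ T ∈ φ.target := by
    rcases hT0.eq_or_lt with hTz | hTpos
    · obtain ⟨φ, hφs, hφ⟩ := hp e₀
      obtain ⟨ζ, hζ⟩ := hS0.2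
      have h0t : γ 0 ∈ φ.target := by
        rw [← h0, hφ]; exact φ.map_source hφs
      refine ⟨0, ζ, φ, le_rfl, hT0, hφ, hζ, by rwa [hζ.2.1], fun t ht => ?_, by rwa [← hTz]⟩
      obtain rfl : t = 0 := le_antisymm (by rw [hTz]; exact ht.2) ht.1
      exact h0t
    · have : Nonempty (ℝ → E) := ⟨fun _ => e₀⟩
      choose! Z hZ using hlift
      have hZeq : ∀ {t s}, 0 ≤ t → t ≤ s → s < T → Z t t = Z s t := fun h0 hts hsT =>
        uniq hts (hZ _ h0 (hts.trans_lt hsT)) (hZ _ (h0.trans hts) hsT) ⟨h0, le_rfl⟩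
      -- By uniqueness the chosen lifts agree, so the diagonal is one lift on the half-open
      -- interval.
      have hcont : ContinuousOn (fun t => Z t t) (Ico 0 T) := by
        intro t ht
        obtain ⟨s, hts, hsT⟩ := exists_between ht.2
        have h1 : ContinuousWithinAt (Z s) (Icc 0 s) t :=
          (hZ s (ht.1.trans hts.le) hsT).1 t ⟨ht.1, hts.le⟩
        have h2 : ContinuousWithinAt (fun t => Z t t) (Icc 0 s) t :=
          h1.congr (fun x hx => hZeq hx.1 hx.2 hsT) (hZeq ht.1 hts.le hsT)
        refine h2.mono_of_mem_nhdsWithin ?_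
        filter_upwards [self_mem_nhdsWithin, mem_nhdsWithin_of_mem_nhds (Iio_mem_nhds hts)]
          with x hx hx' using ⟨hx.1, le_of_lt hx'⟩
      have hpZ : ∀ t ∈ Ico 0 T, p (Z t t) = γ t := fun t ht =>
        (hZ t ht.1 ht.2).2.2 t ⟨ht.1, le_rfl⟩
      obtain ⟨e, he⟩ := hlim T ⟨hTpos, hT1⟩ (fun t => Z t t) hcont (hZ 0 le_rfl hTpos).2.1 hpZ
      have hIco : ∀ᶠ t in 𝓝[<] T, t ∈ Ico 0 T := Ico_mem_nhdsLT hTpos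
      have hpe : p e = γ T := by
        have h1 : MapClusterPt (p e) (𝓝[<] T) (p ∘ fun t => Z t t) :=
          he.continuousAt_comp hp.continuous.continuousAt
        have h2 : Tendsto (p ∘ fun t => Z t t) (𝓝[<] T) (𝓝 (γ T)) := by
          refine ((hγ.tendsto T).mono_left nhdsWithin_le_nhds).congr' ?_
          filter_upwards [hIco] with t ht using (hpZ t ht).symm
        exact eq_of_nhds_neBot (ClusterPt.mono h1 h2)
      obtain ⟨φ, hφs, hφ⟩ := hp e
      have hTt : γ T ∈ φ.target := by
        rw [← hpe, hφ]; exact φ.map_source hφs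
      have hev : ∀ᶠ t in 𝓝[<] T, t ∈ Ico 0 T ∧ ∀ s ∈ Icc t T, γ s ∈ φ.target := by
        refine hIco.and ?_
        obtain ⟨ε, hε, hball⟩ := Metric.mem_nhds_iff.mp
          (hγ.continuousAt.preimage_mem_nhds (φ.open_target.mem_nhds hTt))
        filter_upwards [Ioo_mem_nhdsLT (show T - ε < T by linarith)] with t ht s hs
        refine hball ?_
        rw [Metric.mem_ball, Real.dist_eq, abs_lt]
        constructor <;> linarith [hs.1, hs.2, ht.1]
      obtain ⟨t, hts, ht⟩ := ((he.frequently (φ.open_source.mem_nhds hφs)).and_eventually hev).exists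
      exact ⟨t, Z t, φ, ht.1.1, ht.1.2.le, hφ, hZ t ht.1.1 ht.1.2, hts, ht.2, hTt⟩
  obtain ⟨ε, hε, hball⟩ := Metric.mem_nhds_iff.mp
    (hγ.continuousAt.preimage_mem_nhds (φ.open_target.mem_nhds hTtar))
  have hext : ∀ T', T ≤ T' → T' < T + ε → ∃ ζ, Lift T' ζ := by
    intro T' hTT' hT'
    refine extend φ hφ h01 (h1T.trans hTT') hζ₁ hs₁ fun t ht => ?_
    rcases le_total t T with h | h
    · exact htar t ⟨ht.1, h⟩
    · refine hball ?_
      rw [Metric.mem_ball, Real.dist_eq, abs_lt]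
      constructor <;> linarith [ht.2]
  rcases hT1.lt_or_eq with h | h
  · exfalso
    have h1 : T < min 1 (T + ε / 2) := lt_min h (by linarith)
    have h2 : min 1 (T + ε / 2) ∈ S :=
      ⟨⟨hT0.trans h1.le, min_le_left _ _⟩,
        hext _ h1.le ((min_le_right _ _).trans_lt (by linarith))⟩
    exact absurd (le_csSup hbdd h2) (not_le.mpr h1)
  · obtain ⟨ζ, hζ⟩ := hext 1 hT1 (by linarith)
    exact ⟨ζ, hζ⟩

/-! ### Complete flat metrics on a punctured disk -/

/-- The punctured disk of radius `r`. -/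
def puncturedBall (r : ℝ) : Set ℂ := {z | 0 < ‖z‖ ∧ ‖z‖ < r}

theorem isOpen_puncturedBall (r : ℝ) : IsOpen (puncturedBall r) :=
  (isOpen_lt continuous_const continuous_norm).inter (isOpen_lt continuous_norm continuous_const)

theorem puncturedBall_mono {r s : ℝ} (h : r ≤ s) : puncturedBall r ⊆ puncturedBall s :=
  fun _ hz => ⟨hz.1, hz.2.trans_le h⟩

/-- The conformal metric `ρ |dz|` is complete at the puncture of the punctured disk. -/
def IsCompleteDensity (r : ℝ) (ρ : ℂ → ℝ) : Prop :=
  ∀ γ : ℝ → ℂ, ContDiffOn ℝ 1 γ (Ico 0 1) → MapsTo γ (Ico 0 1) (puncturedBall r) →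
    Tendsto γ (𝓝[<] 1) (𝓝 0) →
    ∫⁻ t in Ioo (0 : ℝ) 1, ENNReal.ofReal (ρ (γ t) * ‖deriv γ t‖) = ⊤

theorem IsCompleteDensity.mono {r s : ℝ} {ρ : ℂ → ℝ} (h : IsCompleteDensity s ρ) (hrs : r ≤ s) :
    IsCompleteDensity r ρ :=
  fun γ h1 h2 h3 => h γ h1 (h2.mono_right (puncturedBall_mono hrs)) h3

/-- Near each time the lift is a local inverse of `Ω` applied to an affine path. This regularity is
needed because completeness is tested on `C¹` paths only. -/
theorem lift_contDiffOn {Ω : ℂ → ℂ} {D : Set ℂ} (hD : IsOpen D) (hd : DifferentiableOn ℂ Ω D)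
    (hne : ∀ z ∈ D, deriv Ω z ≠ 0) {z : ℝ → ℂ} {c a : ℂ} {T : ℝ} (hz : ContinuousOn z (Ico 0 T))
    (hzD : ∀ t ∈ Ico 0 T, z t ∈ D) (hΩ : ∀ t ∈ Ico 0 T, Ω (z t) = c + t * a) :
    ContDiffOn ℝ 1 z (Ico 0 T) ∧
      ∀ t ∈ Ico 0 T, HasDerivWithinAt z (a / deriv Ω (z t)) (Ico 0 T) t := by
  have key : ∀ t ∈ Ico 0 T, ∃ ψ : ℂ → ℂ, ContDiffAt ℂ 1 ψ (c + t * a) ∧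
      HasDerivAt ψ (deriv Ω (z t))⁻¹ (c + t * a) ∧
      (∀ᶠ s in 𝓝[Ico 0 T] t, z s = ψ (c + s * a)) ∧ z t = ψ (c + t * a) := by
    intro t ht
    have hA : AnalyticAt ℂ Ω (z t) := hd.analyticAt (hD.mem_nhds (hzD t ht))
    have hs : HasStrictDerivAt Ω (deriv Ω (z t)) (z t) := hA.hasStrictDerivAt
    have hf := hs.hasStrictFDerivAt_equiv (hne _ (hzD t ht))
    have hC : ContDiffAt ℂ 1 Ω (z t) := hA.contDiffAt
    have hleft : ∀ᶠ y in 𝓝 (z t), hC.localInverse hf.hasFDerivAt one_ne_zero (Ω y) = y :=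
      hf.eventually_left_inverse
    refine ⟨hC.localInverse hf.hasFDerivAt one_ne_zero, ?_, ?_, ?_, ?_⟩
    · rw [← hΩ t ht]
      exact hC.to_localInverse hf.hasFDerivAt one_ne_zero
    · rw [← hΩ t ht]
      exact (hs.to_local_left_inverse (hne _ (hzD t ht)) hleft).hasDerivAt
    · filter_upwards [(hz t ht).eventually hleft, self_mem_nhdsWithin] with s hs hsT
      rw [← hΩ s hsT, hs]
    · rw [← hΩ t ht]
      exact hleft.self_of_nhds.symm
  constructor
  · intro t ht
    obtain ⟨ψ, h1, -, h3, h4⟩ := key t ht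
    have h5 : ContDiffAt ℝ 1 (fun s : ℝ => ψ (c + s * a)) t := by
      refine (h1.restrict_scalars ℝ).comp t (f := fun s : ℝ => c + (s : ℂ) * a) ?_
      exact contDiffAt_const.add (Complex.ofRealCLM.contDiff.contDiffAt.mul contDiffAt_const)
    exact h5.contDiffWithinAt.congr_of_eventuallyEq h3 h4
  · intro t ht
    obtain ⟨ψ, -, h2, h3, h4⟩ := key t ht
    have h5 : HasDerivAt (fun s : ℝ => c + (s : ℂ) * a) a t := by
      simpa using ((hasDerivAt_id t).ofReal_comp.mul_const a).const_add c
    have h6 := (h2.comp t h5)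
    refine (h6.hasDerivWithinAt.congr_of_eventuallyEq h3 h4).congr_deriv ?_
    rw [div_eq_inv_mul]

/-- Reaching the outer circle would require crossing the ring between the radii, within time at most
`1` and at speed at most `K`, which is less than its width. -/
theorem norm_lt_of_lift {z z' : ℝ → ℂ} {T r₁ r₂ K : ℝ} (hz : ContinuousOn z (Ico 0 T))
    (hT : T ≤ 1) (h0 : ‖z 0‖ < r₁) (h12 : r₁ < r₂)
    (hz' : ∀ t ∈ Ico 0 T, HasDerivWithinAt z (z' t) (Ico 0 T) t)
    (hK : ∀ t ∈ Ico 0 T, r₁ ≤ ‖z t‖ → ‖z t‖ ≤ r₂ → ‖z' t‖ ≤ K) (hK0 : 0 ≤ K) (hKr : K < r₂ - r₁) :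
    ∀ t ∈ Ico 0 T, ‖z t‖ < r₂ := by
  intro t₂ ht₂
  by_contra! hcon
  have hsub : Icc 0 t₂ ⊆ Ico 0 T := fun x hx => ⟨hx.1, hx.2.trans_lt ht₂.2⟩
  have hn : ContinuousOn (fun t => ‖z t‖) (Icc 0 t₂) := (hz.mono hsub).norm
  -- The crossing of the ring runs from the last visit `s` to the inner disk to the first arrival
  -- `t` at the outer radius.
  obtain ⟨t, ⟨htm, htr⟩, htl⟩ : ∃ t, IsLeast (Icc 0 t₂ ∩ (fun t => ‖z t‖) ⁻¹' Ici r₂) t :=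
    (isCompact_Icc.of_isClosed_subset (hn.preimage_isClosed_of_isClosed isClosed_Icc isClosed_Ici)
      inter_subset_left).exists_isLeast ⟨t₂, ⟨ht₂.1, le_rfl⟩, hcon⟩
  have hn' : ContinuousOn (fun t => ‖z t‖) (Icc 0 t) := hn.mono (Icc_subset_Icc_right htm.2)
  obtain ⟨s, ⟨hsm, hsr⟩, hsl⟩ : ∃ s, IsGreatest (Icc 0 t ∩ (fun t => ‖z t‖) ⁻¹' Iic r₁) s :=
    (isCompact_Icc.of_isClosed_subset (hn'.preimage_isClosed_of_isClosed isClosed_Icc isClosed_Iic)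
      inter_subset_left).exists_isGreatest ⟨0, ⟨le_rfl, htm.1⟩, h0.le⟩
  have htr' : r₂ ≤ ‖z t‖ := htr
  have hsr' : ‖z s‖ ≤ r₁ := hsr
  have hge : ∀ x ∈ Icc s t, r₁ ≤ ‖z x‖ := by
    intro x hx
    by_contra! hlt
    obtain ⟨y, hy, hy1⟩ := intermediate_value_Icc hx.2
      (hn'.mono (Icc_subset_Icc_left (hsm.1.trans hx.1))) ⟨hlt.le, h12.le.trans htr'⟩
    have hys : y ≤ s := hsl ⟨⟨(hsm.1.trans hx.1).trans hy.1, hy.2⟩, hy1.le⟩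
    obtain rfl : x = y := le_antisymm hy.1 (hys.trans hx.1)
    exact hlt.ne hy1
  have hle : ∀ x ∈ Ico s t, ‖z x‖ ≤ r₂ := by
    intro x hx
    by_contra! hlt
    exact absurd (htl ⟨⟨hsm.1.trans hx.1, hx.2.le.trans htm.2⟩, hlt.le⟩) (not_le.mpr hx.2)
  have hst : Icc s t ⊆ Ico 0 T := fun x hx => ⟨hsm.1.trans hx.1, (hx.2.trans htm.2).trans_lt ht₂.2⟩
  have hmv := norm_image_sub_le_of_norm_deriv_le_segment' (f := z) (f' := z') (a := s) (b := t)
    (C := K) (fun x hx => (hz' x (hst hx)).mono hst)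
    (fun x hx => hK x (hst (Ico_subset_Icc_self hx)) (hge x (Ico_subset_Icc_self hx)) (hle x hx))
    t ⟨hsm.2, le_rfl⟩
  have h1 : ‖z t‖ - ‖z s‖ ≤ ‖z t - z s‖ := norm_sub_norm_le _ _
  have h2 : t - s ≤ 1 := by linarith [hsm.1, htm.2, ht₂.2]
  have h3 : K * (t - s) ≤ K := by nlinarith
  linarith

section Flat

variable {Ω : ℂ → ℂ} {r : ℝ}

theorem isLocalHomeomorph_restrict (hd : DifferentiableOn ℂ Ω (puncturedBall r))
    (hne : ∀ z ∈ puncturedBall r, deriv Ω z ≠ 0) :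
    IsLocalHomeomorph (fun z : puncturedBall r => Ω z) := by
  have h1 : IsLocalHomeomorphOn Ω (puncturedBall r) := by
    refine IsLocalHomeomorphOn.mk Ω _ fun x hx => ?_
    have hs := (hd.analyticAt ((isOpen_puncturedBall r).mem_nhds hx)).hasStrictDerivAt
    exact ⟨(hs.hasStrictFDerivAt_equiv (hne x hx)).toOpenPartialHomeomorph Ω,
      (hs.hasStrictFDerivAt_equiv (hne x hx)).mem_toOpenPartialHomeomorph_source,
      fun _ _ => rfl⟩
  rw [isLocalHomeomorph_iff_isLocalHomeomorphOn_univ]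
  exact h1.comp (isOpen_puncturedBall r).isOpenEmbedding_subtypeVal.isLocalHomeomorph.isLocalHomeomorphOn
    (fun x _ => x.2)

/-- Segments in the image of the developing map of a complete flat metric lift, as long as they are
so short that their lifts cannot leave the punctured disk through the outer boundary. -/
theorem exists_lift_segment (hd : DifferentiableOn ℂ Ω (puncturedBall r))
    (hne : ∀ z ∈ puncturedBall r, deriv Ω z ≠ 0)
    (hc : IsCompleteDensity r fun z => ‖deriv Ω z‖) {r₁ r₂ m : ℝ} (h12 : r₁ < r₂)
    (h2r : r₂ < r) (hm0 : 0 < m) (hm : ∀ z, r₁ ≤ ‖z‖ → ‖z‖ ≤ r₂ → m ≤ ‖deriv Ω z‖)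
    (z₀ : puncturedBall r) (hz₀ : ‖(z₀ : ℂ)‖ < r₁) {a : ℂ} (ha : ‖a‖ < m * (r₂ - r₁)) :
    ∃ ζ : ℝ → puncturedBall r, ContinuousOn ζ (Icc 0 1) ∧ ζ 0 = z₀ ∧
      ∀ t ∈ Icc (0 : ℝ) 1, Ω (ζ t) = Ω z₀ + t * a := by
  refine exists_lift_of_mapClusterPt (isLocalHomeomorph_restrict hd hne)
    (γ := fun t : ℝ => Ω z₀ + t * a) (by fun_prop) (by simp) ?_
  intro T hT ζ hζ hζ0 hζΩ
  set z : ℝ → ℂ := fun t => (ζ t : ℂ) with hz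
  have hzc : ContinuousOn z (Ico 0 T) := continuous_subtype_val.comp_continuousOn hζ
  obtain ⟨hz1, hz2⟩ := lift_contDiffOn (isOpen_puncturedBall r) hd hne hzc
    (fun t _ => (ζ t).2) hζΩ
  have hlt : ∀ t ∈ Ico 0 T, ‖z t‖ < r₂ := by
    refine norm_lt_of_lift (K := ‖a‖ / m) hzc hT.2 (by rw [hz]; simpa [hζ0] using hz₀) h12 hz2 ?_
      (by positivity) (by rw [div_lt_iff₀ hm0]; linarith)
    intro t _ h1 h2
    rw [norm_div]
    exact div_le_div_of_nonneg_left (norm_nonneg a) hm0 (hm _ h1 h2)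
  have hIco : ∀ᶠ t in 𝓝[<] T, t ∈ Ico 0 T := Ico_mem_nhdsLT hT.1
  -- Measured by `|dΩ|` the lift has the finite length `‖a‖ T`, so completeness forbids it to run
  -- into the puncture.
  have hnot : ¬ Tendsto z (𝓝[<] T) (𝓝 0) := by
    intro hlim
    have hsc : MapsTo (fun t : ℝ => T * t) (Ico 0 1) (Ico 0 T) := fun t ht =>
      ⟨mul_nonneg hT.1.le ht.1, by nlinarith [ht.2, hT.1]⟩
    have hlen := hc (fun t => z (T * t))
      (hz1.comp (by fun_prop) hsc) (fun t _ => (ζ (T * t)).2) (by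
        refine hlim.comp (tendsto_nhdsWithin_iff.mpr ⟨?_, ?_⟩)
        · have : Tendsto (fun t : ℝ => T * t) (𝓝 1) (𝓝 (T * 1)) :=
            (continuous_const.mul continuous_id).tendsto 1
          rw [mul_one] at this
          exact this.mono_left nhdsWithin_le_nhds
        · filter_upwards [self_mem_nhdsWithin] with t ht
          have : t < 1 := ht
          show T * t < T
          nlinarith [hT.1])
    have hder : ∀ t ∈ Ioo (0 : ℝ) 1,
        ENNReal.ofReal (‖deriv Ω (z (T * t))‖ * ‖deriv (fun t => z (T * t)) t‖) =
          ENNReal.ofReal (‖a‖ * T) := by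
      intro t ht
      have htm : T * t ∈ Ico 0 T := hsc ⟨ht.1.le, ht.2⟩
      have h1 : HasDerivAt z (a / deriv Ω (z (T * t))) (T * t) :=
        (hz2 _ htm).hasDerivAt (Ico_mem_nhds (mul_pos hT.1 ht.1) htm.2)
      have h2 : HasDerivAt (fun t : ℝ => T * t) T t := by
        simpa using (hasDerivAt_id t).const_mul T
      have h3 : HasDerivAt (fun t => z (T * t)) (T • (a / deriv Ω (z (T * t)))) t :=
        h1.scomp t h2
      rw [h3.deriv, norm_smul, norm_div, Real.norm_of_nonneg hT.1.le]
      congr 1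
      have : ‖deriv Ω (z (T * t))‖ ≠ 0 := norm_ne_zero_iff.mpr (hne _ (ζ (T * t)).2)
      field_simp
    rw [setLIntegral_congr_fun measurableSet_Ioo hder] at hlen
    simp [ENNReal.mul_eq_top] at hlen
  obtain ⟨ε, hε, hfr⟩ : ∃ ε > 0, ∃ᶠ t in 𝓝[<] T, ε ≤ ‖z t‖ := by
    by_contra! h
    refine hnot (Metric.tendsto_nhds.mpr fun ε hε => ?_)
    filter_upwards [h ε hε] with t ht
    simpa using ht
  -- The lift keeps returning to this compact ring, which yields the cluster point.
  have hK : IsCompact {x : puncturedBall r | ε ≤ ‖(x : ℂ)‖ ∧ ‖(x : ℂ)‖ ≤ r₂} := by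
    rw [Subtype.isCompact_iff]
    have : Subtype.val '' {x : puncturedBall r | ε ≤ ‖(x : ℂ)‖ ∧ ‖(x : ℂ)‖ ≤ r₂} =
        Metric.closedBall 0 r₂ ∩ {x : ℂ | ε ≤ ‖x‖} := by
      ext x
      constructor
      · rintro ⟨y, hy, rfl⟩
        exact ⟨by simpa using hy.2, hy.1⟩
      · rintro ⟨h1, h2⟩
        have h1' : ‖x‖ ≤ r₂ := by simpa using h1
        exact ⟨⟨x, hε.trans_le h2, h1'.trans_lt h2r⟩, ⟨h2, h1'⟩, rfl⟩
    rw [this]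
    exact (isCompact_closedBall _ _).inter_right (isClosed_le continuous_const continuous_norm)
  obtain ⟨e, -, he⟩ := hK.exists_mapClusterPt_of_frequently (f := ζ) (l := 𝓝[<] T)
    ((hfr.and_eventually hIco).mono fun t ht => ⟨ht.1, (hlt t ht.2).le⟩)
  exact ⟨e, he⟩

/-- The density of a complete flat metric on a punctured disk is bounded below near the
puncture. -/
theorem exists_le_norm_deriv (hr : 0 < r) (hd : DifferentiableOn ℂ Ω (puncturedBall r))
    (hne : ∀ z ∈ puncturedBall r, deriv Ω z ≠ 0)
    (hc : IsCompleteDensity r fun z => ‖deriv Ω z‖) :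
    ∃ δ > 0, ∃ r₁ > 0, r₁ < r ∧ ∀ z ∈ puncturedBall r₁, δ ≤ ‖deriv Ω z‖ := by
  obtain ⟨m, hm0, hm⟩ : ∃ m > 0, ∀ z : ℂ, r / 3 ≤ ‖z‖ → ‖z‖ ≤ r / 2 → m ≤ ‖deriv Ω z‖ := by
    set A : Set ℂ := Metric.closedBall 0 (r / 2) ∩ {x : ℂ | r / 3 ≤ ‖x‖} with hA
    have hAs : A ⊆ puncturedBall r := fun x hx =>
      ⟨lt_of_lt_of_le (by positivity) hx.2, lt_of_le_of_lt (by simpa using hx.1) (by linarith)⟩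
    have hAc : IsCompact A :=
      (isCompact_closedBall _ _).inter_right (isClosed_le continuous_const continuous_norm)
    have hAne : A.Nonempty := ⟨((r / 2 : ℝ) : ℂ), by
      constructor
      · simp [abs_of_pos hr]
      · simp only [mem_ofPred_eq, Complex.norm_real, Real.norm_eq_abs]
        rw [abs_of_pos (by positivity)]; linarith⟩
    have hcont : ContinuousOn (fun z => ‖deriv Ω z‖) A :=
      ((hd.deriv (isOpen_puncturedBall r)).continuousOn.mono hAs).norm
    obtain ⟨x, hx, hmin⟩ := hAc.exists_isMinOn hAne hcont
    exact ⟨‖deriv Ω x‖, norm_pos_iff.mpr (hne x (hAs hx)), fun z h1 h2 =>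
      hmin ⟨by simpa using h2, h1⟩⟩
  -- A lower bound for the cost of crossing the ring in the flat metric. Segments shorter than `δ`
  -- starting inside it cannot escape outwards.
  set δ := m * (r / 2 - r / 3) with hδ
  have hδ0 : 0 < δ := mul_pos hm0 (by linarith)
  refine ⟨δ / (2 * r), by positivity, r / 3, by positivity, by linarith, fun z₀ hz₀ => ?_⟩
  have hz₀r : z₀ ∈ puncturedBall r := puncturedBall_mono (by linarith) hz₀
  set e₀ : puncturedBall r := ⟨z₀, hz₀r⟩ with he₀
  have hlift : ∀ a : ℂ, ‖a‖ < δ → ∃ ζ : ℝ → puncturedBall r, ContinuousOn ζ (Icc 0 1) ∧ ζ 0 = e₀ ∧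
      ∀ t ∈ Icc (0 : ℝ) 1, Ω (ζ t) = Ω z₀ + t * a := fun a ha =>
    exists_lift_segment hd hne hc (by linarith) (by linarith) hm0 hm e₀ hz₀.2 ha
  have : Nonempty (ℝ → puncturedBall r) := ⟨fun _ => e₀⟩
  choose! ζ hζc hζ0 hζΩ using hlift
  have hloc := isLocalHomeomorph_restrict hd hne
  have hcont : Continuous fun q : unitInterval × Metric.ball (0 : ℂ) δ => ζ q.2 q.1 := by
    refine hloc.continuous_lift (T2Space.isSeparatedMap _)
      ⟨fun q : unitInterval × Metric.ball (0 : ℂ) δ => Ω z₀ + ((q.1 : ℝ) : ℂ) * (q.2 : ℂ),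
        by fun_prop⟩ ?_ ?_ ?_
    · ext q
      exact hζΩ q.2 (mem_ball_zero_iff.mp q.2.2) q.1 q.1.2
    · have : ∀ a : Metric.ball (0 : ℂ) δ, ζ a ((0 : unitInterval) : ℝ) = e₀ := fun a => by
        simpa using hζ0 a (mem_ball_zero_iff.mp a.2)
      simp only [this]
      exact continuous_const
    · intro a
      exact continuousOn_iff_continuous_domRestrict.mp (hζc a (mem_ball_zero_iff.mp a.2))
  -- Endpoints of the lifted segments: a branch of the inverse of `Ω` on a disk of radius `δ`. Its
  -- values lie in a disk of radius `r`, so the Schwarz lemma bounds `Ψ'` and thus bounds `Ω'` from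
  -- below.
  set Ψ : ℂ → ℂ := fun x => (ζ (x - Ω z₀) 1 : ℂ) with hΨ
  have hΨc : ContinuousOn Ψ (Metric.ball (Ω z₀) δ) := by
    rw [continuousOn_iff_continuous_domRestrict]
    have h1 : Continuous fun x : Metric.ball (Ω z₀) δ =>
        ((1 : unitInterval), (⟨(x : ℂ) - Ω z₀, by
          rw [mem_ball_zero_iff, ← dist_eq_norm]; exact x.2⟩ : Metric.ball (0 : ℂ) δ)) := by
      fun_prop
    exact continuous_subtype_val.comp (hcont.comp h1)
  have hΨΩ : ∀ x ∈ Metric.ball (Ω z₀) δ, Ω (Ψ x) = x := by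
    intro x hx
    have := hζΩ (x - Ω z₀) (by simpa [dist_eq_norm] using hx) 1 (by simp)
    simpa using this
  have hball : ∀ x ∈ Metric.ball (Ω z₀) δ, Metric.ball (Ω z₀) δ ∈ 𝓝 x :=
    fun x hx => Metric.isOpen_ball.mem_nhds hx
  have hΨd : ∀ x ∈ Metric.ball (Ω z₀) δ, HasDerivAt Ψ (deriv Ω (Ψ x))⁻¹ x := by
    intro x hx
    have hmem : Ψ x ∈ puncturedBall r := (ζ (x - Ω z₀) 1).2
    refine HasDerivAt.of_local_left_inverse (hΨc.continuousAt (hball x hx))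
      (hd.differentiableAt ((isOpen_puncturedBall r).mem_nhds hmem)).hasDerivAt (hne _ hmem) ?_
    filter_upwards [hball x hx] with y hy using hΨΩ y hy
  -- The degenerate segment lifts to the constant path only.
  have hΨ0 : Ψ (Ω z₀) = z₀ := by
    have h := (T2Space.isSeparatedMap _).eqOn_of_comp_eqOn hloc.isLocallyInjective
      (isPreconnected_Icc (a := (0 : ℝ)) (b := 1)) (hζc 0 (by simpa using hδ0))
      (continuousOn_const (c := e₀))
      (fun t ht => by
        have := hζΩ 0 (by simpa using hδ0) t ht
        simpa using this)
      (a := 0) (by simp) (hζ0 0 (by simpa using hδ0)) (x := 1) (by simp)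
    simp [hΨ, h, he₀]
  have hSch := Complex.norm_deriv_le_div_of_mapsTo_ball (f := Ψ) (c := Ω z₀) (R₁ := δ)
    (R₂ := 2 * r) (fun x hx => (hΨd x hx).differentiableAt.differentiableWithinAt)
    (fun x _ => by
      have h1 : ‖Ψ x‖ < r := (ζ (x - Ω z₀) 1).2.2
      have h2 : ‖Ψ (Ω z₀)‖ < r := (ζ (Ω z₀ - Ω z₀) 1).2.2
      rw [Metric.mem_closedBall, dist_eq_norm]
      exact (norm_sub_le _ _).trans (by linarith)) hδ0
  rw [(hΨd (Ω z₀) (Metric.mem_ball_self hδ0)).deriv, hΨ0, norm_inv] at hSch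
  have hpos : 0 < ‖deriv Ω z₀‖ := norm_pos_iff.mpr (hne _ hz₀r)
  rw [inv_le_comm₀ hpos (by positivity)] at hSch
  rwa [inv_div] at hSch

end Flat

/-! ### Incompleteness of bounded densities and the pole of the developing map -/

theorem not_isCompleteDensity_of_le {r s C : ℝ} {ρ : ℂ → ℝ} (hs : 0 < s) (hsr : s ≤ r)
    (hρ : ∀ z ∈ puncturedBall s, ρ z ≤ C) : ¬ IsCompleteDensity r ρ := by
  intro hc
  set γ : ℝ → ℂ := fun t => ((s / 2 : ℝ) : ℂ) * (1 - t) with hγ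
  have hn : ∀ t ∈ Ico (0 : ℝ) 1, ‖γ t‖ = s / 2 * (1 - t) := by
    intro t ht
    have : γ t = ((s / 2 * (1 - t) : ℝ) : ℂ) := by simp [hγ]
    rw [this, Complex.norm_real, Real.norm_of_nonneg]
    exact mul_nonneg (by positivity) (by linarith [ht.2])
  have hmaps : ∀ t ∈ Ico (0 : ℝ) 1, γ t ∈ puncturedBall s := by
    intro t ht
    rw [puncturedBall, mem_ofPred_eq, hn t ht]
    exact ⟨mul_pos (by positivity) (by linarith [ht.2]), by nlinarith [ht.1]⟩
  have hder : ∀ t, HasDerivAt γ (-((s / 2 : ℝ) : ℂ)) t := by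
    intro t
    have h1 : HasDerivAt (fun t : ℝ => (1 : ℂ) - t) (-1) t := by
      simpa using (hasDerivAt_id t).ofReal_comp.const_sub (1 : ℂ)
    exact (h1.const_mul ((s / 2 : ℝ) : ℂ)).congr_deriv (by ring)
  have hγd : ContDiff ℝ 1 γ :=
    contDiff_const.mul (contDiff_const.sub Complex.ofRealCLM.contDiff)
  have hlen := hc γ hγd.contDiffOn (fun t ht => puncturedBall_mono hsr (hmaps t ht)) (by
    have : Tendsto γ (𝓝 1) (𝓝 (γ 1)) := hγd.continuous.tendsto 1
    simp only [hγ, Complex.ofReal_one, sub_self, mul_zero] at this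
    exact this.mono_left nhdsWithin_le_nhds)
  have hle : ∫⁻ t in Ioo (0 : ℝ) 1, ENNReal.ofReal (ρ (γ t) * ‖deriv γ t‖) ≤
      ∫⁻ _ in Ioo (0 : ℝ) 1, ENNReal.ofReal (C * (s / 2)) := by
    refine setLIntegral_mono measurable_const fun t ht => ENNReal.ofReal_le_ofReal ?_
    rw [(hder t).deriv, norm_neg, Complex.norm_real, Real.norm_of_nonneg (by positivity)]
    exact mul_le_mul_of_nonneg_right (hρ _ (hmaps t (Ioo_subset_Ico_self ht))) (by positivity)
  rw [hlen] at hle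
  simp at hle

theorem exists_analyticAt_of_bounded {f : ℂ → ℂ} {s C : ℝ} (hs : 0 < s)
    (hd : DifferentiableOn ℂ f (puncturedBall s)) (hb : ∀ z ∈ puncturedBall s, ‖f z‖ ≤ C) :
    ∃ h : ℂ → ℂ, AnalyticAt ℂ h 0 ∧ ∀ z ∈ puncturedBall s, f z = h z := by
  have hset : Metric.ball (0 : ℂ) s \ {0} = puncturedBall s := by
    ext z; simp [puncturedBall, and_comm]
  have hnhds : Metric.ball (0 : ℂ) s ∈ 𝓝 0 := Metric.ball_mem_nhds 0 hs
  have := Complex.differentiableOn_update_limUnder_of_bddAbove hnhds (hset ▸ hd)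
    ⟨C, by rintro _ ⟨z, hz, rfl⟩; exact hb z (hset ▸ hz)⟩
  exact ⟨_, this.analyticAt hnhds, fun z hz => (Function.update_of_ne (norm_pos_iff.mp hz.1) _ _).symm⟩

theorem exists_puncturedBall_of_eventually {p : ℂ → Prop} (h : ∀ᶠ z in 𝓝[≠] (0 : ℂ), p z)
    {r : ℝ} (hr : 0 < r) : ∃ s > 0, s ≤ r ∧ ∀ z ∈ puncturedBall s, p z := by
  rw [eventually_nhdsWithin_iff, Metric.eventually_nhds_iff] at h
  obtain ⟨ε, hε, h⟩ := h
  exact ⟨min ε r, lt_min hε hr, min_le_right _ _, fun z hz =>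
    h (by simpa using hz.2.trans_le (min_le_left _ _)) (norm_pos_iff.mp hz.1)⟩

theorem puncturedBall_mem_nhdsNE {s : ℝ} (hs : 0 < s) : puncturedBall s ∈ 𝓝[≠] (0 : ℂ) := by
  rw [mem_nhdsWithin]
  exact ⟨Metric.ball 0 s, Metric.isOpen_ball, Metric.mem_ball_self hs, fun z hz =>
    ⟨norm_pos_iff.mpr hz.2, by simpa using hz.1⟩⟩

theorem eventually_norm_le {h : ℂ → ℂ} (hh : ContinuousAt h 0) :
    ∀ᶠ z in 𝓝[≠] (0 : ℂ), ‖h z‖ ≤ ‖h 0‖ + 1 := by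
  have := hh.norm.eventually (gt_mem_nhds (show ‖h 0‖ < ‖h 0‖ + 1 by linarith))
  exact (this.mono fun z hz => hz.le).filter_mono nhdsWithin_le_nhds

/-- A function on a punctured disk whose derivative has moderate growth has moderate growth. -/
theorem norm_pow_mul_le_of_deriv {Ω : ℂ → ℂ} {s C : ℝ} {n : ℕ} (hs : 0 < s) (hs1 : s ≤ 1)
    (hd : DifferentiableOn ℂ Ω (puncturedBall s))
    (hb : ∀ z ∈ puncturedBall s, ‖deriv Ω z‖ ≤ C * ‖z‖⁻¹ ^ (n + 1)) :
    ∃ C', ∀ z ∈ puncturedBall (s / 2), ‖z ^ (n + 1) * Ω z‖ ≤ C' := by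
  have hmem : ((s / 2 : ℝ) : ℂ) ∈ puncturedBall s := by
    rw [puncturedBall, mem_ofPred_eq, Complex.norm_real, Real.norm_of_nonneg (by positivity)]
    constructor <;> linarith
  have hC : 0 ≤ C := by
    have := (norm_nonneg _).trans (hb _ hmem)
    refine nonneg_of_mul_nonneg_left this ?_
    have := hmem.1
    positivity
  set L : ℝ := Real.log (s / 2) with hL
  refine ⟨‖Ω ((s / 2 : ℝ) : ℂ)‖ + C * (1 + Real.pi + |L|), fun z hz => ?_⟩
  have hz0 : z ≠ 0 := norm_pos_iff.mp hz.1
  have hz1 : ‖z‖ ≤ 1 := by linarith [hz.2]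
  -- The mean value inequality is applied in the coordinate `log z`, where this strip is convex and
  -- the derivative is `z Ω'`, one power better than `Ω'`.
  set S : Set ℂ := {w | Real.log ‖z‖ ≤ w.re} ∩ {w | w.re ≤ L} with hS
  have hSconv : Convex ℝ S := (convex_halfSpace_re_ge _).inter (convex_halfSpace_re_le _)
  have hSm : ∀ w ∈ S, Complex.exp w ∈ puncturedBall s ∧ ‖z‖ ≤ ‖Complex.exp w‖ := by
    intro w hw
    have h1 : Real.log ‖z‖ ≤ w.re := hw.1
    have h2 : w.re ≤ L := hw.2
    refine ⟨⟨by simp, ?_⟩, ?_⟩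
    · rw [Complex.norm_exp]
      have := Real.exp_le_exp.mpr h2
      rw [hL, Real.exp_log (by positivity)] at this
      linarith
    · rw [Complex.norm_exp]
      have := Real.exp_le_exp.mpr h1
      rwa [Real.exp_log hz.1] at this
  have hzS : Complex.log z ∈ S := by
    refine ⟨?_, ?_⟩
    · simp [Complex.log_re]
    · simpa [Complex.log_re] using Real.log_le_log hz.1 hz.2.le
  have hLS : ((L : ℝ) : ℂ) ∈ S := by
    refine ⟨?_, ?_⟩
    · simpa using Real.log_le_log hz.1 hz.2.le
    · simp
  have hmv := hSconv.norm_image_sub_le_of_norm_hasDerivWithin_le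
    (f := fun w => Ω (Complex.exp w)) (f' := fun w => deriv Ω (Complex.exp w) * Complex.exp w)
    (C := C * ‖z‖⁻¹ ^ n)
    (fun w hw => ((hd.differentiableAt ((isOpen_puncturedBall s).mem_nhds
      (hSm w hw).1)).hasDerivAt.comp w (Complex.hasDerivAt_exp w)).hasDerivWithinAt)
    (by
      intro w hw
      obtain ⟨h1, h2⟩ := hSm w hw
      rw [norm_mul]
      have h3 := h1.1
      calc _ ≤ C * ‖Complex.exp w‖⁻¹ ^ (n + 1) * ‖Complex.exp w‖ := by gcongr; exact hb _ h1
        _ = C * ‖Complex.exp w‖⁻¹ ^ n := by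
          rw [pow_succ]; field_simp
        _ ≤ C * ‖z‖⁻¹ ^ n := by
          have := hz.1
          gcongr)
    hLS hzS
  have hexpL : Complex.exp (L : ℂ) = ((s / 2 : ℝ) : ℂ) := by
    rw [← Complex.ofReal_exp, hL, Real.exp_log (by positivity)]
  rw [Complex.exp_log hz0, hexpL] at hmv
  have hlog : ‖Complex.log z - L‖ ≤ |Real.log ‖z‖| + Real.pi + |L| := by
    refine (norm_sub_le _ _).trans ?_
    rw [Complex.norm_real, Real.norm_eq_abs]
    have h1 := Complex.norm_le_abs_re_add_abs_im (Complex.log z)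
    rw [Complex.log_re, Complex.log_im] at h1
    have h2 := Complex.abs_arg_le_pi z
    linarith
  -- The extra power of `z` in the conclusion absorbs the logarithm produced by integrating.
  have hzlog : ‖z‖ * |Real.log ‖z‖| ≤ 1 := by
    have := (Real.abs_log_mul_self_lt ‖z‖ hz.1 hz1).le
    rwa [abs_mul, abs_of_pos hz.1, mul_comm] at this
  have hpow : ‖z‖ ^ (n + 1) ≤ 1 := pow_le_one₀ hz.1.le hz1
  have hΩ : ‖Ω z‖ ≤ ‖Ω ((s / 2 : ℝ) : ℂ)‖ + C * ‖z‖⁻¹ ^ n * (|Real.log ‖z‖| + Real.pi + |L|) := by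
    have h1 := norm_le_norm_add_norm_sub' (Ω z) (Ω ((s / 2 : ℝ) : ℂ))
    have h2 : C * ‖z‖⁻¹ ^ n * ‖Complex.log z - L‖ ≤
        C * ‖z‖⁻¹ ^ n * (|Real.log ‖z‖| + Real.pi + |L|) := by gcongr
    linarith
  rw [norm_mul, norm_pow]
  calc ‖z‖ ^ (n + 1) * ‖Ω z‖ ≤ ‖z‖ ^ (n + 1) *
        (‖Ω ((s / 2 : ℝ) : ℂ)‖ + C * ‖z‖⁻¹ ^ n * (|Real.log ‖z‖| + Real.pi + |L|)) := by gcongr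
    _ = ‖z‖ ^ (n + 1) * ‖Ω ((s / 2 : ℝ) : ℂ)‖ +
        C * (‖z‖ * |Real.log ‖z‖| + ‖z‖ * (Real.pi + |L|)) := by
      have := hz.1.ne'
      rw [pow_succ, inv_pow]; field_simp
      ring
    _ ≤ 1 * ‖Ω ((s / 2 : ℝ) : ℂ)‖ + C * (1 + 1 * (Real.pi + |L|)) := by
      have := Real.pi_pos
      gcongr
    _ = _ := by ring

/-- The developing map of a complete flat metric on a punctured disk has a pole at the puncture. -/
theorem tendsto_norm_atTop_of_isCompleteDensity {Ω : ℂ → ℂ} {r : ℝ} (hr : 0 < r)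
    (hd : DifferentiableOn ℂ Ω (puncturedBall r)) (hne : ∀ z ∈ puncturedBall r, deriv Ω z ≠ 0)
    (hc : IsCompleteDensity r fun z => ‖deriv Ω z‖) :
    Tendsto (fun z => ‖Ω z‖) (𝓝[≠] 0) atTop := by
  obtain ⟨δ, hδ, r₁, hr₁, hr₁r, hlow⟩ := exists_le_norm_deriv hr hd hne hc
  have hsub := puncturedBall_mono hr₁r.le
  have hd' := hd.deriv (isOpen_puncturedBall r)
  -- The lower bound on `|Ω'|` makes `1 / Ω'` extend holomorphically. So `Ω'` has at most a pole,
  -- `Ω` has moderate growth, and some power of `z` times `Ω` extends too.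
  obtain ⟨κ, hκ, hκe⟩ := exists_analyticAt_of_bounded (f := fun z => (deriv Ω z)⁻¹) (C := δ⁻¹) hr₁
    ((hd'.mono hsub).inv fun z hz => hne z (hsub hz))
    (fun z hz => by rw [norm_inv]; exact inv_anti₀ hδ (hlow z hz))
  rcases eventually_eq_zero_or_eq_pow_mul hκ with h0 | ⟨n, k, hk, hk0, hkn⟩
  · obtain ⟨z, hz0, hz⟩ := ((h0.filter_mono nhdsWithin_le_nhds).and
      (puncturedBall_mem_nhdsNE hr₁)).exists
    rw [← hκe z hz] at hz0
    exact absurd hz0 (inv_ne_zero (hne z (hsub hz)))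
  have hkinv : ContinuousAt (fun z => (k z)⁻¹) 0 := hk.continuousAt.inv₀ hk0
  obtain ⟨s, hs, hs1, hsP⟩ := exists_puncturedBall_of_eventually
    ((eventually_norm_le hkinv).and (hkn.filter_mono nhdsWithin_le_nhds))
    (lt_min hr₁ one_pos : 0 < min r₁ 1)
  have hsr₁ : puncturedBall s ⊆ puncturedBall r₁ :=
    puncturedBall_mono (hs1.trans (min_le_left _ _))
  set C := ‖(k 0)⁻¹‖ + 1 with hC
  obtain ⟨C', hC'⟩ := norm_pow_mul_le_of_deriv (n := n) (C := C) hs (hs1.trans (min_le_right _ _))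
    (hd.mono (hsr₁.trans hsub)) (by
      intro z hz
      obtain ⟨h1, h2⟩ := hsP z hz
      have h3 : deriv Ω z = (z ^ n * k z)⁻¹ := by
        rw [← h2, ← hκe z (hsr₁ hz), inv_inv]
      have h4 : 1 ≤ ‖z‖⁻¹ := (one_le_inv₀ hz.1).mpr (hz.2.le.trans (hs1.trans (min_le_right _ _)))
      rw [h3, mul_inv, norm_mul, norm_inv, norm_pow, ← inv_pow, mul_comm]
      refine mul_le_mul h1 (pow_le_pow_right₀ h4 (Nat.le_succ n)) (by positivity) (by positivity))
  have hs2 : puncturedBall (s / 2) ⊆ puncturedBall r :=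
    (puncturedBall_mono (by linarith)).trans (hsr₁.trans hsub)
  obtain ⟨h, hh, hhe⟩ := exists_analyticAt_of_bounded (f := fun z => z ^ (n + 1) * Ω z)
    (half_pos hs) ((by fun_prop : DifferentiableOn ℂ (fun z : ℂ => z ^ (n + 1)) _).mul
      (hd.mono hs2)) hC'
  have hball := puncturedBall_mem_nhdsNE (half_pos hs)
  -- A removable singularity of `Ω` would bound its derivative near the puncture, against
  -- completeness. Only a genuine pole remains.
  have hbad : ∀ q : ℂ → ℂ, AnalyticAt ℂ q 0 → ¬ ∀ᶠ z in 𝓝[≠] (0 : ℂ), Ω z = q z := by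
    intro q hq hΩq
    obtain ⟨t, ht, htr, hP⟩ := exists_puncturedBall_of_eventually
      (hΩq.and (eventually_norm_le hq.deriv.continuousAt)) hr
    refine not_isCompleteDensity_of_le ht htr (C := ‖deriv q 0‖ + 1) (fun z hz => ?_) hc
    have : Ω =ᶠ[𝓝 z] q := by
      filter_upwards [(isOpen_puncturedBall t).mem_nhds hz] with x hx using (hP x hx).1
    rw [this.deriv_eq]
    exact (hP z hz).2
  rcases eventually_eq_zero_or_eq_pow_mul hh with h0 | ⟨j, q, hq, hq0, hqj⟩
  · refine absurd ?_ (hbad 0 analyticAt_const)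
    filter_upwards [hball, h0.filter_mono nhdsWithin_le_nhds, self_mem_nhdsWithin] with z hz hz0 hzn
    rw [← hhe z hz] at hz0
    simpa [show z ≠ 0 from hzn] using hz0
  · have hev : ∀ᶠ z in 𝓝[≠] (0 : ℂ), z ^ (n + 1) * Ω z = z ^ j * q z := by
      filter_upwards [hball, hqj.filter_mono nhdsWithin_le_nhds] with z hz hzq
      rw [← hzq, ← hhe z hz]
    rcases le_or_gt (n + 1) j with hnj | hnj
    · obtain ⟨i, rfl⟩ := Nat.exists_eq_add_of_le hnj
      refine absurd ?_ (hbad (fun z => z ^ i * q z) ((analyticAt_id.pow i).mul hq))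
      filter_upwards [hev, self_mem_nhdsWithin] with z hz hzn
      have hz0 : z ≠ 0 := hzn
      rw [pow_add z (n + 1) i, mul_assoc] at hz
      exact mul_left_cancel₀ (pow_ne_zero _ hz0) hz
    · obtain ⟨i, hi⟩ := Nat.exists_eq_add_of_lt hnj
      have h1 : Tendsto (fun z : ℂ => ‖z‖⁻¹ ^ (i + 1) * ‖q z‖) (𝓝[≠] 0) atTop := by
        refine Tendsto.atTop_mul_pos (norm_pos_iff.mpr hq0) ?_
          (hq.continuousAt.norm.tendsto.mono_left nhdsWithin_le_nhds)
        exact (tendsto_pow_atTop (Nat.succ_ne_zero i)).comp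
          (tendsto_inv_nhdsGT_zero.comp tendsto_norm_nhdsNE_zero)
      refine h1.congr' ?_
      filter_upwards [hev, self_mem_nhdsWithin] with z hz hzn
      have hz0 : z ≠ 0 := hzn
      have hz1 : ‖z‖ ≠ 0 := norm_ne_zero_iff.mpr hz0
      have h2 : z ^ (i + 1) * Ω z = q z := by
        apply mul_left_cancel₀ (pow_ne_zero j hz0)
        rw [← hz, hi]; ring
      rw [← h2, norm_mul, norm_pow, ← mul_assoc, ← mul_pow, inv_mul_cancel₀ hz1, one_pow, one_mul]

/-! ### Null frames -/

/-- A holomorphic null immersion `F` into `SL₂ ℂ` of a half-plane, with finite secondary Gauss map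
`g` and with hyperbolic Gauss map `G` descending to a disk through `exp`. -/
structure NullFrame (a : ℝ) (F : ℂ → Matrix (Fin 2) (Fin 2) ℂ) (g G : ℂ → ℂ) : Prop where
  diff : ∀ i j, DifferentiableOn ℂ (fun w => F w i j) (halfPlane a)
  diff_secondary : DifferentiableOn ℂ g (halfPlane a)
  diff_hyperbolic : DifferentiableOn ℂ G (Metric.ball 0 (Real.exp a))
  det_eq : ∀ w ∈ halfPlane a, F w 0 0 * F w 1 1 - F w 0 1 * F w 1 0 = 1
  deriv_col : ∀ w ∈ halfPlane a, ∀ i,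
    deriv (fun x => F x i 1) w = -g w * deriv (fun x => F x i 0) w
  deriv_row : ∀ w ∈ halfPlane a, ∀ j,
    deriv (fun x => F x 0 j) w = G (Complex.exp w) * deriv (fun x => F x 1 j) w
  deriv_ne : ∀ w ∈ halfPlane a, deriv (fun x => F x 1 0) w ≠ 0

/-- The combination `F₁₁ - G F₂₁`. -/
def potential (F : ℂ → Matrix (Fin 2) (Fin 2) ℂ) (G : ℂ → ℂ) (w : ℂ) : ℂ :=
  F w 0 0 - G (Complex.exp w) * F w 1 0

/-- The derivative of `G` with respect to the coordinate `w` of the half-plane. -/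
def logDerivative (G : ℂ → ℂ) (w : ℂ) : ℂ := deriv G (Complex.exp w) * Complex.exp w

namespace NullFrame

variable {a : ℝ} {F : ℂ → Matrix (Fin 2) (Fin 2) ℂ} {g G : ℂ → ℂ} {w : ℂ}

theorem mono (hF : NullFrame a F g G) {b : ℝ} (h : b ≤ a) : NullFrame b F g G where
  diff i j := (hF.diff i j).mono (halfPlane_mono h)
  diff_secondary := hF.diff_secondary.mono (halfPlane_mono h)
  diff_hyperbolic := hF.diff_hyperbolic.mono (Metric.ball_subset_ball (Real.exp_le_exp.mpr h))
  det_eq w hw := hF.det_eq w (halfPlane_mono h hw)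
  deriv_col w hw := hF.deriv_col w (halfPlane_mono h hw)
  deriv_row w hw := hF.deriv_row w (halfPlane_mono h hw)
  deriv_ne w hw := hF.deriv_ne w (halfPlane_mono h hw)

theorem hasDerivAt (hF : NullFrame a F g G) (hw : w ∈ halfPlane a) (i j : Fin 2) :
    HasDerivAt (fun x => F x i j) (deriv (fun x => F x i j) w) w :=
  ((hF.diff i j).differentiableAt ((isOpen_halfPlane a).mem_nhds hw)).hasDerivAt

theorem hasDerivAt_secondary (hF : NullFrame a F g G) (hw : w ∈ halfPlane a) :
    HasDerivAt g (deriv g w) w :=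
  (hF.diff_secondary.differentiableAt ((isOpen_halfPlane a).mem_nhds hw)).hasDerivAt

theorem hasDerivAt_hyperbolic (hF : NullFrame a F g G) (hw : w ∈ halfPlane a) :
    HasDerivAt (fun x => G (Complex.exp x)) (logDerivative G w) w := by
  have : Complex.exp w ∈ Metric.ball (0 : ℂ) (Real.exp a) := by
    simpa using mem_halfPlane_iff_norm_exp.mp hw
  exact (hF.diff_hyperbolic.differentiableAt (Metric.isOpen_ball.mem_nhds this)).hasDerivAt.comp w
    (Complex.hasDerivAt_exp w)

/-- Differentiate `det F = 1`, express all derivatives through `F₂₁'`, and cancel it. -/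
theorem potential_col (hF : NullFrame a F g G) (hw : w ∈ halfPlane a) :
    F w 0 1 - G (Complex.exp w) * F w 1 1 = -g w * potential F G w := by
  have h1 := ((hF.hasDerivAt hw 0 0).mul (hF.hasDerivAt hw 1 1)).sub
    ((hF.hasDerivAt hw 0 1).mul (hF.hasDerivAt hw 1 0))
  have h2 : HasDerivAt (fun x => F x 0 0 * F x 1 1 - F x 0 1 * F x 1 0) 0 w := by
    refine (hasDerivAt_const w (1 : ℂ)).congr_of_eventuallyEq ?_
    filter_upwards [(isOpen_halfPlane a).mem_nhds hw] with x hx using hF.det_eq x hx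
  have h3 := h1.unique h2
  rw [hF.deriv_row w hw 0, hF.deriv_row w hw 1, hF.deriv_col w hw 1] at h3
  rw [potential]
  apply mul_left_cancel₀ (hF.deriv_ne w hw)
  linear_combination -h3

/-- This is `det F = 1` after eliminating the first row. In particular `P` has no zeros, so `1 / P`
is available everywhere. -/
theorem potential_mul (hF : NullFrame a F g G) (hw : w ∈ halfPlane a) :
    potential F G w * (F w 1 1 + g w * F w 1 0) = 1 := by
  have h1 := hF.potential_col hw
  have h2 := hF.det_eq w hw
  rw [potential] at *
  linear_combination h2 + F w 1 0 * h1

theorem potential_ne_zero (hF : NullFrame a F g G) (hw : w ∈ halfPlane a) :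
    potential F G w ≠ 0 := left_ne_zero_of_mul_eq_one (hF.potential_mul hw)

theorem hasDerivAt_potential (hF : NullFrame a F g G) (hw : w ∈ halfPlane a) :
    HasDerivAt (potential F G) (-(logDerivative G w * F w 1 0)) w := by
  refine ((hF.hasDerivAt hw 0 0).sub
    ((hF.hasDerivAt_hyperbolic hw).mul (hF.hasDerivAt hw 1 0))).congr_deriv ?_
  rw [hF.deriv_row w hw 0]; ring

/-- Differentiating `F₁₂ - G F₂₂ = -g P` ties the two Gauss maps together: `P²` is the quotient of
their derivatives, so the orders of `g'` and `G'` determine that of `P`. -/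
theorem deriv_secondary_mul (hF : NullFrame a F g G) (hw : w ∈ halfPlane a) :
    deriv g w * potential F G w ^ 2 = logDerivative G w := by
  have h1 := (hF.hasDerivAt hw 0 1).sub
    ((hF.hasDerivAt_hyperbolic hw).mul (hF.hasDerivAt hw 1 1))
  have h2 := (hF.hasDerivAt_secondary hw).neg.mul (hF.hasDerivAt_potential hw)
  have h3 := h2.congr_of_eventuallyEq (f₁ := fun x => F x 0 1 - G (Complex.exp x) * F x 1 1) (by
    filter_upwards [(isOpen_halfPlane a).mem_nhds hw] with x hx using hF.potential_col hx)
  have h4 := h1.unique h3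
  rw [hF.deriv_row w hw 1] at h4
  have h5 := hF.potential_mul hw
  simp only [Pi.neg_apply] at h4
  linear_combination potential F G w * h4 + logDerivative G w * h5

theorem form_eq (hF : NullFrame a F g G) (hw : w ∈ halfPlane a) :
    F w 0 0 * deriv (fun x => F x 1 0) w - F w 1 0 * deriv (fun x => F x 0 0) w =
      potential F G w * deriv (fun x => F x 1 0) w := by
  rw [hF.deriv_row w hw 0, potential]; ring

/-- Constant factors on the right change `g` by a Möbius map and leave `G` alone. This freedom is
used to normalize the monodromy. -/
theorem mul_const (hF : NullFrame a F g G) {C : Matrix (Fin 2) (Fin 2) ℂ}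
    (hC : C 0 0 * C 1 1 - C 0 1 * C 1 0 = 1) (hne : ∀ w ∈ halfPlane a, C 0 0 - g w * C 1 0 ≠ 0) :
    NullFrame a (fun w => F w * C)
      (fun w => (g w * C 1 1 - C 0 1) / (C 0 0 - g w * C 1 0)) G := by
  have hd : ∀ w ∈ halfPlane a, ∀ i j, HasDerivAt (fun x => (F x * C) i j)
      (deriv (fun x => F x i 0) w * (C 0 j - g w * C 1 j)) w := by
    intro w hw i j
    simp only [Matrix.mul_apply, Fin.sum_univ_two]
    refine (((hF.hasDerivAt hw i 0).mul_const _).add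
      ((hF.hasDerivAt hw i 1).mul_const _)).congr_deriv ?_
    rw [hF.deriv_col w hw i]; ring
  refine ⟨fun i j w hw => (hd w hw i j).differentiableAt.differentiableWithinAt, ?_,
    hF.diff_hyperbolic, ?_, ?_, ?_, ?_⟩
  · exact ((hF.diff_secondary.mul_const _).sub_const _).div
      ((hF.diff_secondary.mul_const _).const_sub _) hne
  · intro w hw
    simp only [Matrix.mul_apply, Fin.sum_univ_two]
    linear_combination hF.det_eq w hw + (F w 0 0 * F w 1 1 - F w 0 1 * F w 1 0) * hC
  · intro w hw i
    rw [(hd w hw i 1).deriv, (hd w hw i 0).deriv]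
    have := hne w hw
    field_simp
    ring
  · intro w hw j
    rw [(hd w hw 0 j).deriv, (hd w hw 1 j).deriv, hF.deriv_row w hw 0]; ring
  · intro w hw
    rw [(hd w hw 1 0).deriv]
    exact mul_ne_zero (hF.deriv_ne w hw) (hne w hw)

end NullFrame

/-- A null frame for which the Hermitian form `F e₃ F*` descends to the punctured disk, with
`|g| < 1`. The function `ρ` is the density of the induced metric. -/
structure UnitaryFrame (a : ℝ) (F : ℂ → Matrix (Fin 2) (Fin 2) ℂ) (g G : ℂ → ℂ)
    (H : ℂ → Matrix (Fin 2) (Fin 2) ℂ) (ρ : ℂ → ℝ) : Prop extends NullFrame a F g G where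
  norm_lt : ∀ w ∈ halfPlane a, ‖g w‖ < 1
  projection : ∀ w ∈ halfPlane a, H (Complex.exp w) = F w * e3 * (F w)ᴴ
  density : ∀ w ∈ halfPlane a, ρ (Complex.exp w) * ‖Complex.exp w‖ = (1 - ‖g w‖ ^ 2) *
    ‖F w 0 0 * deriv (fun x => F x 1 0) w - F w 1 0 * deriv (fun x => F x 0 0) w‖

/-- If a function and its conjugate are both holomorphic, comparing the real differentials on `1`
and `I` kills the derivative. -/
theorem exists_eq_const_of_conj {u v : ℂ → ℂ} {a : ℝ} (hu : DifferentiableOn ℂ u (halfPlane a))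
    (hv : DifferentiableOn ℂ v (halfPlane a))
    (huv : ∀ w ∈ halfPlane a, v w = starRingEnd ℂ (u w)) :
    ∃ c, ∀ w ∈ halfPlane a, u w = c := by
  refine (isOpen_halfPlane a).exists_is_const_of_deriv_eq_zero (convex_halfPlane a).isPreconnected
    hu fun w hw => ?_
  have hn := (isOpen_halfPlane a).mem_nhds hw
  have h1 := (hu.differentiableAt hn).hasDerivAt.hasFDerivAt.restrictScalars ℝ
  have h2 := (hv.differentiableAt hn).hasDerivAt.hasFDerivAt.restrictScalars ℝ
  have h3 := (Complex.conjCLE.hasFDerivAt.comp w h1).congr_of_eventuallyEq (f₁ := v) (by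
    filter_upwards [hn] with x hx using huv x hx)
  have h4 := h2.unique h3
  have e1 := DFunLike.congr_fun h4 1
  have e2 := DFunLike.congr_fun h4 Complex.I
  simp at e1 e2
  rw [e1] at e2
  have h5 : starRingEnd ℂ (deriv u w) = 0 := by
    apply mul_left_cancel₀ Complex.I_ne_zero
    linear_combination e2 / 2
  simpa using h5

namespace UnitaryFrame

variable {a : ℝ} {F : ℂ → Matrix (Fin 2) (Fin 2) ℂ} {g G : ℂ → ℂ}
  {H : ℂ → Matrix (Fin 2) (Fin 2) ℂ} {ρ : ℂ → ℝ} {w : ℂ}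

theorem mono (hF : UnitaryFrame a F g G H ρ) {b : ℝ} (h : b ≤ a) : UnitaryFrame b F g G H ρ where
  toNullFrame := hF.toNullFrame.mono h
  norm_lt w hw := hF.norm_lt w (halfPlane_mono h hw)
  projection w hw := hF.projection w (halfPlane_mono h hw)
  density w hw := hF.density w (halfPlane_mono h hw)

theorem projection_apply (hF : UnitaryFrame a F g G H ρ) (hw : w ∈ halfPlane a) (i j : Fin 2) :
    H (Complex.exp w) i j = F w i 0 * starRingEnd ℂ (F w j 0) - F w i 1 * starRingEnd ℂ (F w j 1) := by
  rw [hF.projection w hw]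
  simp [Matrix.mul_apply, Fin.sum_univ_two, e3, Matrix.conjTranspose_apply, sub_eq_add_neg]

theorem one_sub_ne_zero {x y z : ℂ} (hxy : ‖x‖ ^ 2 - ‖y‖ ^ 2 = 1) (hz : ‖z‖ ≤ 1) :
    x - z * starRingEnd ℂ y ≠ 0 := by
  intro h
  have h1 : ‖x‖ = ‖z‖ * ‖y‖ := by rw [sub_eq_zero.mp h, norm_mul, Complex.norm_conj]
  have h2 : ‖x‖ ≤ ‖y‖ := by rw [h1]; exact mul_le_of_le_one_left (norm_nonneg _) hz
  nlinarith [norm_nonneg x]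

theorem mul_conj_eq {x y : ℂ} (hxy : ‖x‖ ^ 2 - ‖y‖ ^ 2 = 1) :
    x * starRingEnd ℂ x - y * starRingEnd ℂ y = 1 := by
  rw [Complex.mul_conj, Complex.mul_conj, Complex.normSq_eq_norm_sq, Complex.normSq_eq_norm_sq]
  exact_mod_cast hxy

theorem norm_sq_moebius {x y z : ℂ} (hxy : ‖x‖ ^ 2 - ‖y‖ ^ 2 = 1) :
    ‖x - z * starRingEnd ℂ y‖ ^ 2 - ‖z * starRingEnd ℂ x - y‖ ^ 2 = 1 - ‖z‖ ^ 2 := by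
  have h := mul_conj_eq hxy
  have : ((‖x - z * starRingEnd ℂ y‖ ^ 2 - ‖z * starRingEnd ℂ x - y‖ ^ 2 : ℝ) : ℂ) =
      ((1 - ‖z‖ ^ 2 : ℝ) : ℂ) := by
    push_cast
    simp only [← Complex.mul_conj', map_sub, map_mul, Complex.conj_conj]
    linear_combination (1 - z * starRingEnd ℂ z) * h
  exact_mod_cast this

/-- Right multiplication by an element of `SU(1,1)` moves the secondary Gauss map by an
automorphism of the unit disk. -/
theorem mul_unitary (hF : UnitaryFrame a F g G H ρ) {x y : ℂ} (hxy : ‖x‖ ^ 2 - ‖y‖ ^ 2 = 1) :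
    UnitaryFrame a (fun w => F w * !![x, y; starRingEnd ℂ y, starRingEnd ℂ x])
      (fun w => (g w * starRingEnd ℂ x - y) / (x - g w * starRingEnd ℂ y)) G H ρ := by
  have hdet := mul_conj_eq hxy
  have hne : ∀ w ∈ halfPlane a, x - g w * starRingEnd ℂ y ≠ 0 := fun w hw =>
    one_sub_ne_zero hxy (hF.norm_lt w hw).le
  have hN := hF.toNullFrame.mul_const (C := !![x, y; starRingEnd ℂ y, starRingEnd ℂ x])
    (by simpa using hdet) (by simpa using hne)
  have hn : ∀ w ∈ halfPlane a, 1 - ‖(g w * starRingEnd ℂ x - y) / (x - g w * starRingEnd ℂ y)‖ ^ 2 =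
      (1 - ‖g w‖ ^ 2) / ‖x - g w * starRingEnd ℂ y‖ ^ 2 := by
    intro w hw
    have h1 : ‖x - g w * starRingEnd ℂ y‖ ^ 2 ≠ 0 := pow_ne_zero _ (norm_ne_zero_iff.mpr (hne w hw))
    rw [norm_div, div_pow, eq_div_iff h1, sub_mul, div_mul_cancel₀ _ h1, one_mul,
      norm_sq_moebius hxy]
  refine ⟨by simpa using hN, ?_, ?_, ?_⟩
  · intro w hw
    have h1 : 0 < (1 - ‖g w‖ ^ 2) / ‖x - g w * starRingEnd ℂ y‖ ^ 2 := by
      have := hF.norm_lt w hw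
      have h2 := norm_pos_iff.mpr (hne w hw)
      have h3 : 0 < 1 - ‖g w‖ ^ 2 := by nlinarith [norm_nonneg (g w)]
      positivity
    rw [← hn w hw] at h1
    exact (sq_lt_one_iff₀ (norm_nonneg _)).mp (by linarith)
  · intro w hw
    -- The matrix lies in `SU(1,1)`, so `F e₃ F*` is unchanged.
    have h1 : !![x, y; starRingEnd ℂ y, starRingEnd ℂ x] * e3 *
        !![x, y; starRingEnd ℂ y, starRingEnd ℂ x]ᴴ = e3 := by
      ext i j
      fin_cases i <;> fin_cases j <;>
        simp [Matrix.mul_apply, Fin.sum_univ_two, e3, Matrix.conjTranspose_apply]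
      · linear_combination hdet
      · ring
      · ring
      · linear_combination -hdet
    rw [hF.projection w hw, Matrix.conjTranspose_mul]
    nth_rewrite 1 [← h1]
    simp only [Matrix.mul_assoc]
  · intro w hw
    have hd : ∀ i, deriv (fun v => (F v * !![x, y; starRingEnd ℂ y, starRingEnd ℂ x]) i 0) w =
        deriv (fun v => F v i 0) w * (x - g w * starRingEnd ℂ y) := by
      intro i
      simp only [Matrix.mul_apply, Fin.sum_univ_two]
      refine HasDerivAt.deriv ((((hF.hasDerivAt hw i 0).mul_const _).add
        ((hF.hasDerivAt hw i 1).mul_const _)).congr_deriv ?_)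
      rw [hF.deriv_col w hw i]; simp; ring
    have h2 := hF.deriv_col w hw
    rw [hF.density w hw, hn w hw, hd, hd]
    have h3 := hF.potential_mul hw
    have h4 := hF.potential_col hw
    -- The holomorphic form acquires the factor `(x - g ȳ)²`, whose modulus cancels the denominator
    -- of the new `1 - |g|²`; the metric is therefore unchanged.
    have h5 : (F w * !![x, y; starRingEnd ℂ y, starRingEnd ℂ x]) 0 0 *
          (deriv (fun v => F v 1 0) w * (x - g w * starRingEnd ℂ y)) -
        (F w * !![x, y; starRingEnd ℂ y, starRingEnd ℂ x]) 1 0 *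
          (deriv (fun v => F v 0 0) w * (x - g w * starRingEnd ℂ y)) =
        (F w 0 0 * deriv (fun v => F v 1 0) w - F w 1 0 * deriv (fun v => F v 0 0) w) *
          (x - g w * starRingEnd ℂ y) ^ 2 := by
      simp only [Matrix.mul_apply, Fin.sum_univ_two]
      rw [hF.deriv_row w hw 0]
      simp only [potential] at h4
      simp
      linear_combination deriv (fun v => F v 1 0) w * (x - g w * starRingEnd ℂ y) *
        starRingEnd ℂ y * h4
    rw [h5, norm_mul, norm_pow]
    have := norm_ne_zero_iff.mpr (hne w hw)
    field_simp

/-- The monodromy of a unitary frame acts on the secondary Gauss map as an automorphism of the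
unit disk. -/
theorem exists_monodromy (hF : UnitaryFrame a F g G H ρ) :
    ∃ α β : ℂ, ‖α‖ ^ 2 - ‖β‖ ^ 2 = 1 ∧ ∀ w ∈ halfPlane a,
      g (w + 2 * Real.pi * Complex.I) * (α - starRingEnd ℂ β * g w) =
        starRingEnd ℂ α * g w - β := by
  set p : ℂ := 2 * Real.pi * Complex.I with hp
  -- This is `F(w)⁻¹ F(w + 2πi)`. Single-valuedness of `F e₃ F*` puts it pointwise in `SU(1,1)`.
  set A : ℂ → Matrix (Fin 2) (Fin 2) ℂ := fun w => (F w).adjugate * F (w + p) with hA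
  have hdet : ∀ w ∈ halfPlane a, (F w).det = 1 := fun w hw => by
    rw [Matrix.det_fin_two, hF.det_eq w hw]
  have hFA : ∀ w ∈ halfPlane a, F (w + p) = F w * A w := by
    intro w hw
    rw [hA, ← Matrix.mul_assoc, Matrix.mul_adjugate, hdet w hw, one_smul, Matrix.one_mul]
  have hAdet : ∀ w ∈ halfPlane a, (A w).det = 1 := by
    intro w hw
    rw [hA, Matrix.det_mul, Matrix.det_adjugate, hdet w hw, hdet _ (add_period_mem hw)]; simp
  have hAe : ∀ w ∈ halfPlane a, A w * e3 * (A w)ᴴ = e3 := by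
    intro w hw
    have h1 := hF.projection _ (add_period_mem hw)
    rw [exp_add_period, hF.projection w hw, ← hp, hFA w hw, Matrix.conjTranspose_mul] at h1
    have h2 := congrArg (fun M => (F w).adjugate * M * ((F w).adjugate)ᴴ) h1
    have h3 : (F w).adjugate * F w = 1 := by rw [Matrix.adjugate_mul, hdet w hw, one_smul]
    have h4 : (F w)ᴴ * ((F w).adjugate)ᴴ = 1 := by
      rw [← Matrix.conjTranspose_mul, h3, Matrix.conjTranspose_one]
    calc A w * e3 * (A w)ᴴ
        = ((F w).adjugate * F w) * (A w * e3 * (A w)ᴴ) * ((F w)ᴴ * ((F w).adjugate)ᴴ) := by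
          rw [h3, h4, Matrix.one_mul, Matrix.mul_one]
      _ = ((F w).adjugate * F w) * e3 * ((F w)ᴴ * ((F w).adjugate)ᴴ) := by
          simp only [Matrix.mul_assoc] at h2 ⊢
          exact h2.symm
      _ = e3 := by rw [h3, h4, Matrix.one_mul, Matrix.mul_one]
  have he3 : e3 * e3 = 1 := by
    ext i j; fin_cases i <;> fin_cases j <;> simp [e3]
  have hadj : ∀ w ∈ halfPlane a, (A w).adjugate = e3 * (A w)ᴴ * e3 := by
    intro w hw
    have h1 : A w * (e3 * (A w)ᴴ * e3) = 1 := by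
      rw [← Matrix.mul_assoc, ← Matrix.mul_assoc, hAe w hw, he3]
    have h2 : (A w).adjugate * A w = 1 := by rw [Matrix.adjugate_mul, hAdet w hw, one_smul]
    calc (A w).adjugate = (A w).adjugate * (A w * (e3 * (A w)ᴴ * e3)) := by
          rw [h1, Matrix.mul_one]
      _ = _ := by rw [← Matrix.mul_assoc, h2, Matrix.one_mul]
  have h11 : ∀ w ∈ halfPlane a, A w 1 1 = starRingEnd ℂ (A w 0 0) := by
    intro w hw
    have := congrFun (congrFun (hadj w hw) 0) 0
    simpa [Matrix.adjugate_fin_two, e3, Matrix.mul_apply, Fin.sum_univ_two, Matrix.vecMul,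
      dotProduct] using this
  have h10 : ∀ w ∈ halfPlane a, A w 1 0 = starRingEnd ℂ (A w 0 1) := by
    intro w hw
    have := congrFun (congrFun (hadj w hw) 1) 0
    simpa [Matrix.adjugate_fin_two, e3, Matrix.mul_apply, Fin.sum_univ_two, Matrix.vecMul,
      dotProduct] using this
  have hdF : ∀ i j, DifferentiableOn ℂ (fun w => F (w + p) i j) (halfPlane a) := fun i j =>
    (hF.diff i j).comp (by fun_prop) fun w hw => add_period_mem hw
  have hdA : ∀ i j, DifferentiableOn ℂ (fun w => A w i j) (halfPlane a) := by
    intro i j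
    simp only [hA, Matrix.mul_apply, Fin.sum_univ_two, Matrix.adjugate_fin_two]
    have h := hF.diff
    fin_cases i
    · simpa using ((h 1 1).fun_mul (hdF 0 j)).fun_add ((h 0 1).fun_mul (hdF 1 j)).fun_neg
    · simpa using ((h 1 0).fun_mul (hdF 0 j)).fun_neg.fun_add ((h 0 0).fun_mul (hdF 1 j))
  -- The entries are holomorphic and conjugate in pairs, hence constant.
  obtain ⟨α, hα⟩ := exists_eq_const_of_conj (hdA 0 0) (hdA 1 1) h11
  obtain ⟨β, hβ⟩ := exists_eq_const_of_conj (hdA 0 1) (hdA 1 0) h10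
  have hAF : ∀ w ∈ halfPlane a, ∀ i, F (w + p) i 0 = F w i 0 * α + F w i 1 * starRingEnd ℂ β ∧
      F (w + p) i 1 = F w i 0 * β + F w i 1 * starRingEnd ℂ α := by
    intro w hw i
    have h1 := h10 w hw
    have h2 := h11 w hw
    rw [hα w hw] at h2
    rw [hβ w hw] at h1
    constructor <;> rw [hFA w hw] <;>
      simp only [Matrix.mul_apply, Fin.sum_univ_two, hα w hw, hβ w hw, h1, h2]
  have hnorm : ‖α‖ ^ 2 - ‖β‖ ^ 2 = 1 := by
    obtain ⟨w, hw⟩ : (halfPlane a).Nonempty := ⟨((a - 1 : ℝ) : ℂ), by simp [halfPlane]⟩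
    have h1 := hAdet w hw
    rw [Matrix.det_fin_two, h11 w hw, h10 w hw, hα w hw, hβ w hw, Complex.mul_conj,
      Complex.mul_conj, Complex.normSq_eq_norm_sq, Complex.normSq_eq_norm_sq] at h1
    exact_mod_cast h1
  refine ⟨α, β, hnorm, fun w hw => ?_⟩
  -- The action on `g` comes from differentiating the second row of `F(w + 2πi) = F(w) A`, as `-g`
  -- is the quotient of the derivatives of its two entries.
  have hder : ∀ j, HasDerivAt (fun x => F (x + p) 1 j) (deriv (fun x => F x 1 j) (w + p)) w :=
    fun j => (hF.hasDerivAt (add_period_mem hw) 1 j).comp_add_const w p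
  have hev : ∀ᶠ x in 𝓝 w, x ∈ halfPlane a := (isOpen_halfPlane a).mem_nhds hw
  have h0 := (hder 0).unique (((hF.hasDerivAt hw 1 0).mul_const α).add
    ((hF.hasDerivAt hw 1 1).mul_const (starRingEnd ℂ β)) |>.congr_of_eventuallyEq
      (hev.mono fun x hx => (hAF x hx 1).1))
  have h1 := (hder 1).unique (((hF.hasDerivAt hw 1 0).mul_const β).add
    ((hF.hasDerivAt hw 1 1).mul_const (starRingEnd ℂ α)) |>.congr_of_eventuallyEq
      (hev.mono fun x hx => (hAF x hx 1).2))
  have h2 := hF.deriv_col _ (add_period_mem hw) 1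
  rw [← hp, h0, h1, hF.deriv_col w hw 1] at h2
  apply mul_left_cancel₀ (hF.deriv_ne w hw)
  linear_combination h2

end UnitaryFrame

/-! ### Asymptotics of frames -/

/-- The Hermitian matrices `H z` tend to infinity, in the direction of the positive semidefinite
matrix of rank one with kernel orthogonal to `(G 0, 1)`. -/
def EndsAt (H : ℂ → Matrix (Fin 2) (Fin 2) ℂ) (G : ℂ → ℂ) : Prop :=
  Tendsto (fun z => (H z 1 1).re) (𝓝[≠] 0) atTop ∧
    Tendsto (fun z => H z 0 1 / H z 1 1) (𝓝[≠] 0) (𝓝 (G 0))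

theorem NullFrame.tendsto_hyperbolic {a : ℝ} {F : ℂ → Matrix (Fin 2) (Fin 2) ℂ} {g G : ℂ → ℂ}
    (hF : NullFrame a F g G) : Tendsto G (𝓝[≠] 0) (𝓝 (G 0)) :=
  (hF.diff_hyperbolic.differentiableAt (Metric.ball_mem_nhds 0
    (Real.exp_pos a))).continuousAt.tendsto.mono_left nhdsWithin_le_nhds

/-- Writing the second row as `F₂₁ (1, 1/(P F₂₁) - g)` reduces `H₂₂` to `|F₂₁|²` times an explicit
factor. -/
theorem NullFrame.col_eq {a : ℝ} {F : ℂ → Matrix (Fin 2) (Fin 2) ℂ} {g G : ℂ → ℂ} {w : ℂ}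
    (hF : NullFrame a F g G) (hw : w ∈ halfPlane a) (hc : F w 1 0 ≠ 0) :
    F w 1 1 = F w 1 0 * ((potential F G w * F w 1 0)⁻¹ - g w) := by
  have h1 := hF.potential_mul hw
  have h2 := hF.potential_ne_zero hw
  field_simp
  linear_combination h1

theorem tendsto_div_of_sub_eq_mul {H : ℂ → Matrix (Fin 2) (Fin 2) ℂ} {G u v : ℂ → ℂ} {K : ℝ}
    (hG : Tendsto G (𝓝[≠] 0) (𝓝 (G 0))) (hu : Tendsto u (𝓝[≠] 0) (𝓝 0))
    (hv : ∀ᶠ z in 𝓝[≠] 0, ‖v z‖ ≤ K)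
    (h : ∀ᶠ z in 𝓝[≠] 0, H z 0 1 / H z 1 1 = G z + u z * v z) :
    Tendsto (fun z => H z 0 1 / H z 1 1) (𝓝[≠] 0) (𝓝 (G 0)) := by
  have h1 : Tendsto (fun z => u z * v z) (𝓝[≠] 0) (𝓝 0) :=
    hu.zero_mul_isBoundedUnder_le ⟨K, by simpa using hv⟩
  have h2 := hG.add h1
  rw [add_zero] at h2
  exact h2.congr' (h.mono fun z hz => hz.symm)

/-- If `g` stays away from the unit circle, the growth of the frame forces convergence. -/
theorem UnitaryFrame.endsAt_of_tendsto {a q : ℝ} {F : ℂ → Matrix (Fin 2) (Fin 2) ℂ} {g G : ℂ → ℂ}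
    {H : ℂ → Matrix (Fin 2) (Fin 2) ℂ} {ρ : ℂ → ℝ} (hF : UnitaryFrame a F g G H ρ) (hq : q < 1)
    (hg : ∀ᶠ z in 𝓝[≠] 0, ‖g (Complex.log z)‖ ≤ q)
    (h1 : Tendsto (fun z => ‖potential F G (Complex.log z) * F (Complex.log z) 1 0‖) (𝓝[≠] 0) atTop)
    (h2 : Tendsto (fun z => potential F G (Complex.log z) / F (Complex.log z) 1 0) (𝓝[≠] 0) (𝓝 0)) :
    EndsAt H G := by
  set P := potential F G with hP
  set κ : ℂ → ℂ := fun z => (P (Complex.log z) * F (Complex.log z) 1 0)⁻¹ - g (Complex.log z) with hκ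
  -- Since `1 / (P F₂₁) → 0`, the ratio `κ = F₂₂ / F₂₁` is close to `-g` and stays below the
  -- midpoint between `q` and `1`.
  set q' := (1 + q) / 2 with hq'
  have hκq : ∀ᶠ z in 𝓝[≠] 0, ‖κ z‖ ≤ q' := by
    have h3 := h1.inv_tendsto_atTop.eventually (gt_mem_nhds (show 0 < (1 - q) / 2 by linarith))
    filter_upwards [hg, h3] with z hz hz3
    refine (norm_sub_le _ _).trans ?_
    rw [norm_inv]
    simp only [Pi.inv_apply] at hz3
    linarith
  have hq'1 : q' < 1 := by rw [hq']; linarith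
  have hq'0 : 0 ≤ q' := by
    obtain ⟨z, hz⟩ := hκq.exists
    exact (norm_nonneg _).trans hz
  have hmain : ∀ᶠ z in 𝓝[≠] (0 : ℂ), Complex.log z ∈ halfPlane a ∧ Complex.exp (Complex.log z) = z ∧
      F (Complex.log z) 1 0 ≠ 0 ∧ F (Complex.log z) 1 1 = F (Complex.log z) 1 0 * κ z := by
    filter_upwards [eventually_log_mem_halfPlane a, self_mem_nhdsWithin,
      h1.eventually (eventually_gt_atTop 0)] with z hz hz0 hz1
    have hc : F (Complex.log z) 1 0 ≠ 0 := fun h => by simp [h] at hz1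
    exact ⟨hz, Complex.exp_log hz0, hc, hF.col_eq hz hc⟩
  have hH : ∀ᶠ z in 𝓝[≠] (0 : ℂ), H z 1 1 =
      ((‖F (Complex.log z) 1 0‖ ^ 2 * (1 - ‖κ z‖ ^ 2) : ℝ) : ℂ) := by
    filter_upwards [hmain] with z ⟨hz, hez, hc, hcol⟩
    have := hF.projection_apply hz 1 1
    rw [hez, hcol, Complex.mul_conj', Complex.mul_conj', norm_mul] at this
    rw [this]; push_cast; ring
  have hκ2 : ∀ᶠ z in 𝓝[≠] (0 : ℂ), 1 - q' ^ 2 ≤ 1 - ‖κ z‖ ^ 2 := by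
    filter_upwards [hκq] with z hz
    have := norm_nonneg (κ z)
    nlinarith
  have hq2 : 0 < 1 - q' ^ 2 := by nlinarith
  refine ⟨?_, ?_⟩
  -- Eventually `|P| < |F₂₁|`, so `|F₂₁|² ≥ |P F₂₁|`, which tends to infinity.
  · refine tendsto_atTop_mono' _ ?_ (h1.atTop_mul_const hq2)
    have h3 := (tendsto_norm_zero.comp h2).eventually (gt_mem_nhds one_pos)
    filter_upwards [hH, hκ2, hmain, h3] with z hz hz2 hm hz3
    rw [hz, Complex.ofReal_re]
    have hc0 : 0 < ‖F (Complex.log z) 1 0‖ := norm_pos_iff.mpr hm.2.2.1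
    simp only [Function.comp_apply, norm_div, div_lt_one hc0] at hz3
    rw [norm_mul]
    refine mul_le_mul ?_ hz2 hq2.le (by positivity)
    rw [sq]
    gcongr
  · refine tendsto_div_of_sub_eq_mul (K := (1 + 1) / (1 - q' ^ 2)) (v := fun z =>
      (1 + g (Complex.log z) * starRingEnd ℂ (κ z)) / ((1 - ‖κ z‖ ^ 2 : ℝ) : ℂ))
      hF.tendsto_hyperbolic h2 ?_ ?_
    · filter_upwards [hκ2, hκq, hmain] with z hz2 hzq hm
      rw [norm_div, Complex.norm_real, Real.norm_of_nonneg (hq2.le.trans hz2)]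
      gcongr
      refine (norm_add_le _ _).trans ?_
      rw [norm_one, norm_mul, Complex.norm_conj]
      have := hF.norm_lt _ hm.1
      gcongr
      exact mul_le_one₀ this.le (norm_nonneg _) (hzq.trans hq'1.le)
    · filter_upwards [hH, hκ2, hmain] with z hz hz2 ⟨hm, hez, hc, hcol⟩
      have e1 := hF.projection_apply hm 0 1
      have e2 := hF.projection_apply hm 1 1
      have e3 := hF.potential_col hm
      have hne : ((1 - ‖κ z‖ ^ 2 : ℝ) : ℂ) ≠ 0 := by
        exact_mod_cast (hq2.trans_le hz2).ne'
      rw [hez] at e1 e2 e3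
      have e4 : H z 0 1 = G z * H z 1 1 + P (Complex.log z) * starRingEnd ℂ (F (Complex.log z) 1 0) *
          (1 + g (Complex.log z) * starRingEnd ℂ (κ z)) := by
        have e5 : P (Complex.log z) = F (Complex.log z) 0 0 - G z * F (Complex.log z) 1 0 := by
          rw [hP, potential, hez]
        have e6 : starRingEnd ℂ (F (Complex.log z) 1 1) =
            starRingEnd ℂ (F (Complex.log z) 1 0) * starRingEnd ℂ (κ z) := by rw [hcol, map_mul]
        rw [e1, e2]
        linear_combination -starRingEnd ℂ (F (Complex.log z) 1 1) * e3 -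
          starRingEnd ℂ (F (Complex.log z) 1 0) * e5 + P (Complex.log z) * g (Complex.log z) * e6
      have e7 : H z 1 1 = F (Complex.log z) 1 0 * starRingEnd ℂ (F (Complex.log z) 1 0) *
          ((1 - ‖κ z‖ ^ 2 : ℝ) : ℂ) := by
        rw [hz, Complex.mul_conj']; push_cast; ring
      have hc' : starRingEnd ℂ (F (Complex.log z) 1 0) ≠ 0 := by simpa using hc
      have hH0 : H z 1 1 ≠ 0 := by rw [e7]; exact mul_ne_zero (mul_ne_zero hc hc') hne
      rw [e4, add_div, mul_div_cancel_right₀ _ hH0, e7]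
      congr 1
      field_simp

/-- The parabolic counterpart of `UnitaryFrame.endsAt_of_tendsto`, with the secondary Gauss map in
the right half-plane. -/
theorem NullFrame.endsAt_of_tendsto {a K : ℝ} {F : ℂ → Matrix (Fin 2) (Fin 2) ℂ} {g G : ℂ → ℂ}
    {H : ℂ → Matrix (Fin 2) (Fin 2) ℂ} (hF : NullFrame a F g G)
    (hH : ∀ w ∈ halfPlane a, ∀ i j, H (Complex.exp w) i j =
      -(F w i 0 * starRingEnd ℂ (F w j 1) + F w i 1 * starRingEnd ℂ (F w j 0)))
    (hg : Tendsto (fun z => (g (Complex.log z)).re) (𝓝[≠] 0) atTop)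
    (hgK : ∀ᶠ z in 𝓝[≠] 0, ‖g (Complex.log z)‖ ≤ K * (g (Complex.log z)).re)
    (hc0 : ∀ᶠ z in 𝓝[≠] 0, F (Complex.log z) 1 0 ≠ 0)
    (h1 : ∀ᶠ z in 𝓝[≠] 0, ‖(potential F G (Complex.log z) * F (Complex.log z) 1 0)⁻¹‖ ≤ K)
    (h2 : Tendsto (fun z => potential F G (Complex.log z) / F (Complex.log z) 1 0) (𝓝[≠] 0) (𝓝 0)) :
    EndsAt H G := by
  set P := potential F G with hP
  set τ : ℂ → ℂ := fun z => (P (Complex.log z) * F (Complex.log z) 1 0)⁻¹ with hτ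
  have hmain : ∀ᶠ z in 𝓝[≠] (0 : ℂ), Complex.log z ∈ halfPlane a ∧ Complex.exp (Complex.log z) = z ∧
      F (Complex.log z) 1 0 ≠ 0 ∧
      F (Complex.log z) 1 1 = F (Complex.log z) 1 0 * (τ z - g (Complex.log z)) ∧
      P (Complex.log z) ≠ 0 := by
    filter_upwards [eventually_log_mem_halfPlane a, self_mem_nhdsWithin, hc0] with z hz hz0 hc
    exact ⟨hz, Complex.exp_log hz0, hc, hF.col_eq hz hc, hF.potential_ne_zero hz⟩
  have hKpos : 0 < K := by
    obtain ⟨z, hz, hz1⟩ := (hmain.and h1).exists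
    exact (norm_pos_iff.mpr (inv_ne_zero (mul_ne_zero hz.2.2.2.2 hz.2.2.1))).trans_le hz1
  have hH11 : ∀ᶠ z in 𝓝[≠] (0 : ℂ), H z 1 1 = ((‖F (Complex.log z) 1 0‖ ^ 2 *
      (2 * ((g (Complex.log z)).re - (τ z).re)) : ℝ) : ℂ) := by
    filter_upwards [hmain] with z ⟨hz, hez, hc, hcol, _⟩
    have := hH _ hz 1 1
    rw [hez, hcol] at this
    have h3 := Complex.add_conj (g (Complex.log z) - τ z)
    rw [Complex.sub_re] at h3
    rw [this, Complex.ofReal_mul, ← h3]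
    push_cast
    rw [← Complex.mul_conj']
    simp only [map_mul, map_sub]
    ring
  have hre : ∀ᶠ z in 𝓝[≠] (0 : ℂ), (g (Complex.log z)).re ≤
      2 * ((g (Complex.log z)).re - (τ z).re) ∧ 1 ≤ (g (Complex.log z)).re := by
    filter_upwards [h1, hg.eventually (eventually_ge_atTop (2 * K)),
      hg.eventually (eventually_ge_atTop 1)] with z hz hz2 hz3
    have := (Complex.re_le_norm (τ z)).trans hz
    exact ⟨by linarith, hz3⟩
  refine ⟨?_, ?_⟩
  · refine tendsto_atTop_mono' _ ?_ (hg.const_mul_atTop (inv_pos.mpr hKpos))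
    have h3 := (tendsto_norm_zero.comp h2).eventually (gt_mem_nhds one_pos)
    filter_upwards [hH11, hre, hmain, h3, h1] with z hz hz2 ⟨_, _, hc, _, hP0⟩ hz3 hz4
    rw [hz, Complex.ofReal_re]
    have hc0 : 0 < ‖F (Complex.log z) 1 0‖ := norm_pos_iff.mpr hc
    have hP1 : 0 < ‖P (Complex.log z)‖ := norm_pos_iff.mpr hP0
    simp only [Function.comp_apply, norm_div, div_lt_one hc0] at hz3
    simp only [norm_inv, norm_mul] at hz4
    -- Here `|F₂₁|²` need only be bounded below, through `|F₂₁|² ≥ |P F₂₁| ≥ 1/K`; the divergence of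
    -- `H₂₂` comes from `Re g`.
    have h5 : K⁻¹ ≤ ‖F (Complex.log z) 1 0‖ ^ 2 := by
      refine ((inv_le_comm₀ (by positivity) hKpos).mp hz4).trans ?_
      rw [sq]; gcongr
    have h6 := hz2.2
    gcongr
    exact hz2.1
  · refine tendsto_div_of_sub_eq_mul (K := 2 * K + K) (v := fun z =>
      (2 * (g (Complex.log z)).re - starRingEnd ℂ (τ z)) /
        ((2 * ((g (Complex.log z)).re - (τ z).re) : ℝ) : ℂ))
      hF.tendsto_hyperbolic h2 ?_ ?_
    · filter_upwards [hre, hgK, h1] with z hz hz2 hz3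
      have h4 : 0 < 2 * ((g (Complex.log z)).re - (τ z).re) := by linarith [hz.1, hz.2]
      rw [norm_div, Complex.norm_real, Real.norm_of_nonneg h4.le, div_le_iff₀ h4]
      refine (norm_sub_le _ _).trans ?_
      rw [Complex.norm_conj, norm_mul, Complex.norm_real, Complex.norm_two]
      have h5 : ‖τ z‖ ≤ K := hz3
      have h6 : |(g (Complex.log z)).re| ≤ ‖g (Complex.log z)‖ := Complex.abs_re_le_norm _
      rw [Real.norm_eq_abs]
      nlinarith [hz.1, hz.2]
    · filter_upwards [hH11, hre, hmain] with z hz hz2 ⟨hm, hez, hc, hcol, hP0⟩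
      have e1 := hH _ hm 0 1
      have e2 := hH _ hm 1 1
      have e3 := hF.potential_col hm
      have hne : ((2 * ((g (Complex.log z)).re - (τ z).re) : ℝ) : ℂ) ≠ 0 := by
        have : 0 < 2 * ((g (Complex.log z)).re - (τ z).re) := by linarith [hz2.1, hz2.2]
        exact_mod_cast this.ne'
      rw [hez] at e1 e2 e3
      have e4 : H z 0 1 = G z * H z 1 1 + P (Complex.log z) * starRingEnd ℂ (F (Complex.log z) 1 0) *
          (2 * (g (Complex.log z)).re - starRingEnd ℂ (τ z)) := by
        have e5 : P (Complex.log z) = F (Complex.log z) 0 0 - G z * F (Complex.log z) 1 0 := by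
          rw [hP, potential, hez]
        have e6 : starRingEnd ℂ (F (Complex.log z) 1 1) = starRingEnd ℂ (F (Complex.log z) 1 0) *
            (starRingEnd ℂ (τ z) - starRingEnd ℂ (g (Complex.log z))) := by
          rw [hcol, map_mul, map_sub]
        have e8 := Complex.add_conj (g (Complex.log z))
        push_cast at e8
        rw [e1, e2]
        linear_combination -starRingEnd ℂ (F (Complex.log z) 1 0) * e3 +
          starRingEnd ℂ (F (Complex.log z) 1 1) * e5 - P (Complex.log z) * e6 +
          P (Complex.log z) * starRingEnd ℂ (F (Complex.log z) 1 0) * e8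
      have e7 : H z 1 1 = F (Complex.log z) 1 0 * starRingEnd ℂ (F (Complex.log z) 1 0) *
          ((2 * ((g (Complex.log z)).re - (τ z).re) : ℝ) : ℂ) := by
        rw [hz, Complex.mul_conj']; push_cast; ring
      have hc' : starRingEnd ℂ (F (Complex.log z) 1 0) ≠ 0 := by simpa using hc
      have hH0 : H z 1 1 ≠ 0 := by rw [e7]; exact mul_ne_zero (mul_ne_zero hc hc') hne
      rw [e4, add_div, mul_div_cancel_right₀ _ hH0, e7]
      congr 1
      field_simp

/-! ### Exponents of a frame with nonconstant Gauss maps -/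

theorem norm_exp_ofReal_mul_log (μ : ℝ) {z : ℂ} (hz : z ≠ 0) :
    ‖Complex.exp ((μ : ℂ) * Complex.log z)‖ = ‖z‖ ^ μ := by
  rw [Complex.norm_exp, Complex.re_ofReal_mul, Complex.log_re,
    Real.rpow_def_of_pos (norm_pos_iff.mpr hz), mul_comm]

theorem tendsto_norm_rpow {s : ℝ} (hs : 0 < s) :
    Tendsto (fun z : ℂ => ‖z‖ ^ s) (𝓝[≠] 0) (𝓝 0) := by
  have h : Tendsto (fun z : ℂ => ‖z‖) (𝓝[≠] 0) (𝓝 0) :=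
    tendsto_norm_zero.mono_left nhdsWithin_le_nhds
  simpa [hs.ne'] using h.rpow_const (Or.inr hs.le)

theorem tendsto_norm_rpow_mul {s : ℝ} (hs : 0 < s) {u : ℂ → ℂ} (hu : ContinuousAt u 0) :
    Tendsto (fun z : ℂ => ‖z‖ ^ s * ‖u z‖) (𝓝[≠] 0) (𝓝 0) := by
  simpa using (tendsto_norm_rpow hs).mul (hu.norm.tendsto.mono_left nhdsWithin_le_nhds)

/-- Data describing the growth of the frame: in the coordinate of the half-plane `dG` is the `m`-th
power of `exp w` times `U`, and the logarithmic derivative `L` of the potential is holomorphic at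
the puncture. -/
structure FrameGrowth (a : ℝ) (F : ℂ → Matrix (Fin 2) (Fin 2) ℂ) (G : ℂ → ℂ) (μ : ℝ) (m : ℕ)
    (U L : ℂ → ℂ) : Prop where
  one_le : 1 ≤ m
  analytic_unit : AnalyticAt ℂ U 0
  analytic_exponent : AnalyticAt ℂ L 0
  exponent_zero : L 0 = (m - μ) / 2
  logDerivative_eq : ∀ w ∈ halfPlane a, logDerivative G w = Complex.exp w ^ m * U (Complex.exp w)
  mul_col : ∀ w ∈ halfPlane a,
    logDerivative G w * F w 1 0 = -(L (Complex.exp w) * potential F G w)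

theorem eventually_ne_zero_of_continuousAt {k : ℂ → ℂ} (hk : ContinuousAt k 0) (h0 : k 0 ≠ 0) :
    ∀ᶠ z in 𝓝[≠] (0 : ℂ), k z ≠ 0 :=
  (hk.eventually_ne h0).filter_mono nhdsWithin_le_nhds

/-- `P² = G' / g'` is `exp ((m - μ) w)` times a unit `V(z)`. Hence the logarithmic derivative `L` of
`P` extends over the puncture with value `(m - μ)/2`, and `P' = -G' F₂₁` turns it into a formula for
`F₂₁`. -/
theorem NullFrame.exists_growth {a μ : ℝ} {F : ℂ → Matrix (Fin 2) (Fin 2) ℂ} {g G k : ℂ → ℂ}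
    (hF : NullFrame a F g G) (hk : AnalyticAt ℂ k 0) (hk0 : k 0 ≠ 0)
    (hg : ∀ w ∈ halfPlane a, deriv g w = Complex.exp (μ * w) * k (Complex.exp w)) :
    ∃ b ≤ a, ∃ m U L, FrameGrowth b F G μ m U L := by
  have hGa : AnalyticAt ℂ G 0 :=
    hF.diff_hyperbolic.analyticAt (Metric.ball_mem_nhds 0 (Real.exp_pos a))
  -- `G'` inherits nonvanishing from `g'` through `g' P² = G'`.
  have hW : ∀ᶠ z in 𝓝[≠] (0 : ℂ), deriv G z ≠ 0 := by
    obtain ⟨b, hba, hb⟩ := exists_halfPlane_of_eventually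
      (eventually_ne_zero_of_continuousAt hk.continuousAt hk0) a
    filter_upwards [eventually_log_mem_halfPlane b, self_mem_nhdsWithin] with z hz hz0
    have h1 := hF.deriv_secondary_mul (halfPlane_mono hba hz)
    rw [hg _ (halfPlane_mono hba hz)] at h1
    intro h0
    rw [logDerivative, Complex.exp_log hz0, h0, zero_mul] at h1
    have h2 := hb _ hz
    rw [Complex.exp_log hz0] at h2
    exact mul_ne_zero (mul_ne_zero (Complex.exp_ne_zero _) h2)
      (pow_ne_zero 2 (hF.potential_ne_zero (halfPlane_mono hba hz))) h1
  rcases eventually_eq_zero_or_eq_pow_mul hGa.deriv with h0 | ⟨j, U, hU, hU0, hUj⟩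
  · obtain ⟨z, h1, h2⟩ := (hW.and (h0.filter_mono nhdsWithin_le_nhds)).exists
    exact absurd h2 h1
  have hV : AnalyticAt ℂ (fun z => U z / k z) 0 := hU.div hk hk0
  have hV0 : U 0 / k 0 ≠ 0 := div_ne_zero hU0 hk0
  set V : ℂ → ℂ := fun z => U z / k z with hVdef
  set L : ℂ → ℂ := fun z => (((j + 1 : ℕ) - μ : ℂ) + z * (deriv V z / V z)) / 2 with hL
  have hLa : AnalyticAt ℂ L 0 :=
    ((analyticAt_const.add (analyticAt_id.mul (hV.deriv.div hV hV0))).div analyticAt_const two_ne_zero)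
  obtain ⟨b, hba, hb⟩ := exists_halfPlane_of_eventually
    (((hUj.filter_mono nhdsWithin_le_nhds).and
      (eventually_ne_zero_of_continuousAt hU.continuousAt hU0)).and
      ((eventually_ne_zero_of_continuousAt hk.continuousAt hk0).and
        (hV.eventually_analyticAt.filter_mono nhdsWithin_le_nhds))) a
  -- The order is `j + 1` instead of `j` because `d/dw = z d/dz`; this is why `m ≥ 1`.
  have hWU : ∀ w ∈ halfPlane b,
      logDerivative G w = Complex.exp w ^ (j + 1) * U (Complex.exp w) := by
    intro w hw
    rw [logDerivative, (hb w hw).1.1, pow_succ]; ring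
  refine ⟨b, hba, j + 1, U, L, Nat.succ_pos j, hU, hLa, by simp [hL], hWU, ?_⟩
  intro w hw
  have hwa := halfPlane_mono hba hw
  have hsq : ∀ x ∈ halfPlane b, potential F G x ^ 2 =
      Complex.exp (((j + 1 : ℕ) - μ : ℂ) * x) * V (Complex.exp x) := by
    intro x hx
    have h1 := hF.deriv_secondary_mul (halfPlane_mono hba hx)
    rw [hg x (halfPlane_mono hba hx), hWU x hx] at h1
    have h2 := (hb x hx).2.1
    have h3 : Complex.exp x ^ (j + 1) =
        Complex.exp (μ * x) * Complex.exp (((j + 1 : ℕ) - μ : ℂ) * x) := by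
      rw [← Complex.exp_nat_mul, ← Complex.exp_add]; congr 1; ring
    rw [h3] at h1
    have h4 := Complex.exp_ne_zero (μ * x)
    apply mul_left_cancel₀ (mul_ne_zero h4 h2)
    rw [h1, hVdef]
    field_simp
  have hVw := (hb w hw).2.2
  have hd1 := (hF.hasDerivAt_potential hwa).pow 2
  have hd2 : HasDerivAt (fun x => Complex.exp (((j + 1 : ℕ) - μ : ℂ) * x) * V (Complex.exp x))
      (((j + 1 : ℕ) - μ : ℂ) * Complex.exp (((j + 1 : ℕ) - μ : ℂ) * w) * V (Complex.exp w) +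
        Complex.exp (((j + 1 : ℕ) - μ : ℂ) * w) * (deriv V (Complex.exp w) * Complex.exp w)) w := by
    have h1 : HasDerivAt (fun x : ℂ => ((j + 1 : ℕ) - μ : ℂ) * x) ((j + 1 : ℕ) - μ : ℂ) w := by
      simpa using (hasDerivAt_id w).const_mul ((j + 1 : ℕ) - μ : ℂ)
    refine (h1.cexp.mul (hVw.differentiableAt.hasDerivAt.comp w
      (Complex.hasDerivAt_exp w))).congr_deriv ?_
    simp only [Function.comp_apply]
    ring
  have hd3 := hd1.unique (hd2.congr_of_eventuallyEq (by
    filter_upwards [(isOpen_halfPlane b).mem_nhds hw] with x hx using hsq x hx))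
  have hVne : V (Complex.exp w) ≠ 0 := div_ne_zero (hb w hw).1.2 (hb w hw).2.1
  have hP := hF.potential_ne_zero hwa
  have h5 : ((j + 1 : ℕ) - μ : ℂ) * Complex.exp (((j + 1 : ℕ) - μ : ℂ) * w) * V (Complex.exp w) +
      Complex.exp (((j + 1 : ℕ) - μ : ℂ) * w) * (deriv V (Complex.exp w) * Complex.exp w) =
      2 * L (Complex.exp w) * potential F G w ^ 2 := by
    rw [hsq w hw, hL]
    field_simp
  rw [h5] at hd3
  apply mul_left_cancel₀ hP
  simp only [Nat.cast_ofNat, Nat.add_one_sub_one, pow_one] at hd3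
  linear_combination -hd3 / 2

namespace FrameGrowth

variable {a μ : ℝ} {F : ℂ → Matrix (Fin 2) (Fin 2) ℂ} {g G U L k : ℂ → ℂ} {m : ℕ} {w : ℂ}

theorem potential_mul_col (hE : FrameGrowth a F G μ m U L) (hF : NullFrame a F g G)
    (hw : w ∈ halfPlane a) :
    deriv g w * (potential F G w * F w 1 0) = -L (Complex.exp w) := by
  have h1 := hE.mul_col w hw
  have h2 := hF.deriv_secondary_mul hw
  apply mul_left_cancel₀ (hF.potential_ne_zero hw)
  rw [← h2] at h1
  linear_combination h1

theorem potential_div_col (hE : FrameGrowth a F G μ m U L) (hF : NullFrame a F g G)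
    (hw : w ∈ halfPlane a) (hL : L (Complex.exp w) ≠ 0) :
    F w 1 0 ≠ 0 ∧ potential F G w / F w 1 0 = -(logDerivative G w / L (Complex.exp w)) := by
  have h1 := hE.mul_col w hw
  have hc : F w 1 0 ≠ 0 := by
    intro h
    rw [h, mul_zero] at h1
    exact mul_ne_zero hL (hF.potential_ne_zero hw) (neg_eq_zero.mp h1.symm)
  refine ⟨hc, ?_⟩
  field_simp
  linear_combination h1

end FrameGrowth

/-- The case of nonconstant Gauss maps and elliptic monodromy. -/
theorem UnitaryFrame.endsAt_of_exponent {a μ q : ℝ} {F : ℂ → Matrix (Fin 2) (Fin 2) ℂ}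
    {g G k : ℂ → ℂ} {H : ℂ → Matrix (Fin 2) (Fin 2) ℂ} {ρ : ℂ → ℝ}
    (hF : UnitaryFrame a F g G H ρ) (hc : IsCompleteDensity (Real.exp a) ρ) (hμ : 0 < μ)
    (hk : AnalyticAt ℂ k 0) (hk0 : k 0 ≠ 0)
    (hg : ∀ w ∈ halfPlane a, deriv g w = Complex.exp (μ * w) * k (Complex.exp w)) (hq : q < 1)
    (hgq : ∀ᶠ z in 𝓝[≠] 0, ‖g (Complex.log z)‖ ≤ q) : EndsAt H G := by
  obtain ⟨b, hba, m, U, L, hE⟩ := hF.toNullFrame.exists_growth hk hk0 hg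
  have hFb := hF.mono hba
  have hbase : ∀ᶠ z in 𝓝[≠] (0 : ℂ), Complex.log z ∈ halfPlane b ∧
      Complex.exp (Complex.log z) = z ∧ z ≠ 0 ∧ k z ≠ 0 := by
    filter_upwards [eventually_log_mem_halfPlane b, self_mem_nhdsWithin,
      eventually_ne_zero_of_continuousAt hk.continuousAt hk0] with z hz hz0 hkz
    exact ⟨hz, Complex.exp_log hz0, hz0, hkz⟩
  -- With `L` of order `l`, `P F₂₁ = -L / g'` has order `l - μ` and `P / F₂₁ = -G' / L` has order `m
  -- - l`; both limits hold if `l` is below `μ` and `m`.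
  have good : ∀ (l : ℕ) (M : ℂ → ℂ), AnalyticAt ℂ M 0 → M 0 ≠ 0 →
      (∀ᶠ z in 𝓝 0, L z = z ^ l * M z) → (l : ℝ) < μ → l < m → EndsAt H G := by
    intro l M hM hM0 hLM hlμ hlm
    have hall : ∀ᶠ z in 𝓝[≠] (0 : ℂ), L z = z ^ l * M z ∧ M z ≠ 0 :=
      (hLM.filter_mono nhdsWithin_le_nhds).and
        (eventually_ne_zero_of_continuousAt hM.continuousAt hM0)
    refine hFb.endsAt_of_tendsto hq hgq ?_ ?_
    · have h1 : Tendsto (fun z : ℂ => ‖z‖ ^ (μ - l) * ‖k z / M z‖) (𝓝[≠] 0) (𝓝[>] 0) := by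
        refine tendsto_nhdsWithin_iff.mpr ⟨tendsto_norm_rpow_mul (sub_pos.mpr hlμ)
          (hk.continuousAt.div hM.continuousAt hM0), ?_⟩
        filter_upwards [hbase, hall] with z hz hz1
        have := norm_pos_iff.mpr hz.2.2.1
        have := norm_pos_iff.mpr (div_ne_zero hz.2.2.2 hz1.2)
        exact mul_pos (by positivity) this
      refine h1.inv_tendsto_nhdsGT_zero.congr' ?_
      filter_upwards [hbase, hall] with z ⟨hz, hez, hz0, hkz⟩ ⟨hLz, hMz⟩
      have h2 := hE.potential_mul_col hFb.toNullFrame hz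
      rw [hg _ (halfPlane_mono hba hz), hez, hLz] at h2
      have h3 := congrArg norm h2
      simp only [norm_mul, norm_exp_ofReal_mul_log μ hz0, norm_neg, norm_pow] at h3
      have h4 := norm_pos_iff.mpr hz0
      have h5 := norm_pos_iff.mpr hkz
      have h6 := norm_pos_iff.mpr hMz
      have h7 : ‖z‖ ^ μ = ‖z‖ ^ (μ - l) * ‖z‖ ^ l := by
        rw [← Real.rpow_natCast, ← Real.rpow_add h4]; congr 1; ring
      have h8 : 0 < ‖z‖ ^ (μ - l) := Real.rpow_pos_of_pos h4 _
      rw [h7] at h3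
      simp only [Pi.inv_apply, norm_div, norm_mul]
      have h9 : 0 < ‖z‖ ^ l := by positivity
      apply mul_left_cancel₀ (mul_pos (mul_pos h8 h9) h5).ne'
      rw [h3]
      field_simp
    · rw [tendsto_zero_iff_norm_tendsto_zero]
      have h1 : Tendsto (fun z : ℂ => ‖z‖ ^ ((m : ℝ) - l) * ‖U z / M z‖) (𝓝[≠] 0) (𝓝 0) :=
        tendsto_norm_rpow_mul (sub_pos.mpr (by exact_mod_cast hlm))
          (hE.analytic_unit.continuousAt.div hM.continuousAt hM0)
      refine h1.congr' ?_
      filter_upwards [hbase, hall] with z ⟨hz, hez, hz0, hkz⟩ ⟨hLz, hMz⟩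
      have hLne : L (Complex.exp (Complex.log z)) ≠ 0 := by
        rw [hez, hLz]; exact mul_ne_zero (pow_ne_zero _ hz0) hMz
      rw [(hE.potential_div_col hFb.toNullFrame hz hLne).2, hE.logDerivative_eq _ hz, hez, hLz]
      have h4 := norm_pos_iff.mpr hz0
      have h6 := norm_pos_iff.mpr hMz
      have h7 : ‖z‖ ^ m = ‖z‖ ^ ((m : ℝ) - l) * ‖z‖ ^ l := by
        rw [← Real.rpow_natCast, ← Real.rpow_natCast, ← Real.rpow_add h4]; congr 1; ring
      simp only [norm_neg, norm_div, norm_mul, norm_pow]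
      rw [h7]
      field_simp
  -- If `μ = m` and `z ^ m` divides `L`, then `P F₂₁` extends holomorphically as `R(z)`. From `G'
  -- F₂₁ = -L P` one gets `P F₂₁' = (P F₂₁)' - L P F₂₁`, which is `z` times the bounded `S`; so the
  -- induced metric is bounded, against completeness.
  have bad : ∀ N : ℂ → ℂ, AnalyticAt ℂ N 0 → (∀ᶠ z in 𝓝 0, L z = z ^ m * N z) → μ ≠ m := by
    intro N hN hLN hμm
    set R : ℂ → ℂ := fun z => -(N z / k z) with hR
    have hRa : AnalyticAt ℂ R 0 := (hN.div hk hk0).neg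
    set S : ℂ → ℂ := fun z => deriv R z - z ^ (m - 1) * N z * R z with hS
    have hSa : AnalyticAt ℂ S 0 := hRa.deriv.sub (((analyticAt_id.pow _).mul hN).mul hRa)
    obtain ⟨b', hb'b, hb'⟩ := exists_halfPlane_of_eventually
      (((hLN.and hRa.eventually_analyticAt).filter_mono nhdsWithin_le_nhds).and
        ((eventually_ne_zero_of_continuousAt hk.continuousAt hk0).and
          (eventually_norm_le hSa.continuousAt))) b
    have hPc : ∀ w ∈ halfPlane b', potential F G w * F w 1 0 = R (Complex.exp w) := by
      intro w hw
      have h1 := hE.potential_mul_col hFb.toNullFrame (halfPlane_mono hb'b hw)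
      obtain ⟨⟨h2, -⟩, h3, -⟩ := hb' w hw
      rw [hg _ (halfPlane_mono (hb'b.trans hba) hw), h2, hμm] at h1
      have h4 : Complex.exp w ^ m = Complex.exp (((m : ℝ) : ℂ) * w) := by
        rw [← Complex.exp_nat_mul]; simp
      rw [h4] at h1
      have h5 := Complex.exp_ne_zero (((m : ℝ) : ℂ) * w)
      apply mul_left_cancel₀ (mul_ne_zero h5 h3)
      rw [h1, hR]
      field_simp
    refine not_isCompleteDensity_of_le (s := Real.exp b') (C := ‖S 0‖ + 1) (Real.exp_pos _)
      (Real.exp_le_exp.mpr (hb'b.trans hba)) ?_ hc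
    intro z hz
    have hz0 : z ≠ 0 := norm_pos_iff.mp hz.1
    have hw : Complex.log z ∈ halfPlane b' := log_mem_halfPlane hz0 hz.2
    have hwb := halfPlane_mono hb'b hw
    have hez := Complex.exp_log hz0
    have h1 := hFb.density _ hwb
    rw [hez, hFb.form_eq hwb] at h1
    have h2 := (hFb.hasDerivAt_potential hwb).mul (hFb.hasDerivAt hwb 1 0)
    obtain ⟨⟨h3, h4⟩, h5, h6⟩ := hb' _ hw
    have h7 : HasDerivAt (fun x => R (Complex.exp x)) (deriv R z * z) (Complex.log z) := by
      have := h4.differentiableAt.hasDerivAt.comp (Complex.log z) (Complex.hasDerivAt_exp _)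
      rwa [hez] at this
    have h8 := h2.unique (h7.congr_of_eventuallyEq (by
      filter_upwards [(isOpen_halfPlane b').mem_nhds hw] with x hx using hPc x hx))
    have h9 := hE.mul_col _ hwb
    have h10 := hPc _ hw
    rw [hez] at h3 h6 h9 h10
    have h11 : potential F G (Complex.log z) * deriv (fun x => F x 1 0) (Complex.log z) =
        z * S z := by
      obtain ⟨i, hi⟩ := Nat.exists_eq_add_of_le hE.one_le
      have h12 : z ^ m = z * z ^ (m - 1) := by rw [hi]; simp [pow_add]
      rw [h3, h12] at h9
      simp only [hS]
      linear_combination h8 + F (Complex.log z) 1 0 * h9 - z * z ^ (m - 1) * N z * h10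
    rw [h11, norm_mul] at h1
    have h13 : ρ z * ‖z‖ ≤ (‖S 0‖ + 1) * ‖z‖ := by
      rw [h1]
      have h14 : 1 - ‖g (Complex.log z)‖ ^ 2 ≤ 1 := by nlinarith [sq_nonneg ‖g (Complex.log z)‖]
      calc _ ≤ 1 * (‖z‖ * ‖S z‖) := by gcongr
        _ ≤ 1 * (‖z‖ * (‖S 0‖ + 1)) := by gcongr
        _ = _ := by ring
    exact le_of_mul_le_mul_right h13 hz.1
  have hexp0 : L 0 = 0 → μ = m := by
    intro h
    have := hE.exponent_zero
    rw [h, eq_div_iff two_ne_zero, zero_mul] at this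
    exact_mod_cast (sub_eq_zero.mp this.symm).symm
  -- If `L(0) ≠ 0`, then `l = 0` is below both `μ > 0` and `m ≥ 1`. If `L(0) = 0`, then `μ = m`, and
  -- the order of `L` is either below `m` or excluded by `bad`.
  rcases eventually_eq_zero_or_eq_pow_mul hE.analytic_exponent with h0 | ⟨l, M, hM, hM0, hLM⟩
  · exact absurd (hexp0 h0.self_of_nhds) (bad 0 analyticAt_const (h0.mono fun z hz => by simp [hz]))
  · rcases Nat.eq_zero_or_pos l with rfl | hl
    · exact good 0 M hM hM0 hLM (by simpa using hμ) hE.one_le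
    · have h1 := hexp0 (by rw [hLM.self_of_nhds, zero_pow hl.ne', zero_mul])
      rcases lt_or_ge l m with hlm | hlm
      · exact good l M hM hM0 hLM (by rw [h1]; exact_mod_cast hlm) hlm
      · obtain ⟨i, rfl⟩ := Nat.exists_eq_add_of_le hlm
        exact absurd h1 (bad (fun z => z ^ i * M z) ((analyticAt_id.pow i).mul hM)
          (hLM.mono fun z hz => by rw [hz, pow_add, mul_assoc]))

/-! ### The monodromy cases -/

theorem exponent_nonneg {a μ : ℝ} {u h : ℂ → ℂ} (hh : ContinuousAt h 0) (h0 : h 0 ≠ 0)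
    (hu : ∀ w ∈ halfPlane a, u w = Complex.exp (μ * w) * h (Complex.exp w))
    (hb : ∀ w ∈ halfPlane a, ‖u w‖ ≤ 1) : 0 ≤ μ := by
  by_contra! hμ
  have h1 := tendsto_norm_rpow (neg_pos.mpr hμ)
  have h2 : Tendsto (fun z => ‖h z‖) (𝓝[≠] 0) (𝓝 ‖h 0‖) :=
    hh.norm.tendsto.mono_left nhdsWithin_le_nhds
  have h3 : ‖h 0‖ ≤ 0 := by
    refine le_of_tendsto_of_tendsto h2 h1 ?_
    filter_upwards [eventually_log_mem_halfPlane a, self_mem_nhdsWithin] with z hz hz0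
    have hz0' : z ≠ 0 := hz0
    have h4 := hb _ hz
    rw [hu _ hz, Complex.exp_log hz0', norm_mul, norm_exp_ofReal_mul_log μ hz0'] at h4
    have h5 := Real.rpow_pos_of_pos (norm_pos_iff.mpr hz0') μ
    rw [Real.rpow_neg (norm_nonneg z), ← one_div, le_div_iff₀ h5]
    linarith
  exact h0 (norm_le_zero_iff.mp h3)

theorem hasDerivAt_exp_mul {μ : ℝ} {h : ℂ → ℂ} {w : ℂ}
    (hh : DifferentiableAt ℂ h (Complex.exp w)) :
    HasDerivAt (fun x => Complex.exp (μ * x) * h (Complex.exp x))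
      (Complex.exp (μ * w) * (μ * h (Complex.exp w) + Complex.exp w * deriv h (Complex.exp w)))
      w := by
  have h1 : HasDerivAt (fun x : ℂ => (μ : ℂ) * x) μ w := by
    simpa using (hasDerivAt_id w).const_mul (μ : ℂ)
  refine (h1.cexp.mul (hh.hasDerivAt.comp w (Complex.hasDerivAt_exp w))).congr_deriv ?_
  simp only [Function.comp_apply]
  ring

section Cases

variable {a : ℝ} {F : ℂ → Matrix (Fin 2) (Fin 2) ℂ} {g G : ℂ → ℂ}
  {H : ℂ → Matrix (Fin 2) (Fin 2) ℂ} {ρ : ℂ → ℝ}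

/-- A bounded `g` with unimodular multiplier is `exp (μ w) h(z)` with `μ ≥ 0` and `h(0) ≠ 0`. This
gives both the power law for `g'` and a limit of `|g|` below `1`. -/
theorem UnitaryFrame.endsAt_of_elliptic (hF : UnitaryFrame a F g G H ρ)
    (hc : IsCompleteDensity (Real.exp a) ρ) (hG : ∃ w ∈ halfPlane a, logDerivative G w ≠ 0) {l : ℂ}
    (hl : ‖l‖ = 1)
    (hm : ∀ w ∈ halfPlane a, g (w + 2 * Real.pi * Complex.I) = l * g w) : EndsAt H G := by
  have hnc : ¬ ∃ b ≤ a, ∀ w ∈ halfPlane b, deriv g w = 0 := by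
    rintro ⟨b, hba, hb⟩
    obtain ⟨w, hw, hne⟩ := hG
    rw [← hF.deriv_secondary_mul hw, eqOn_zero_of_halfPlane hba
      (hF.diff_secondary.deriv (isOpen_halfPlane a)) hb w hw, zero_mul] at hne
    exact hne rfl
  have hg0 : ∃ w ∈ halfPlane a, g w ≠ 0 := by
    by_contra! h
    refine hnc ⟨a, le_rfl, fun w hw => ?_⟩
    have : g =ᶠ[𝓝 w] fun _ => 0 := by
      filter_upwards [(isOpen_halfPlane a).mem_nhds hw] with x hx using h x hx
    rw [this.deriv_eq]; simp
  obtain ⟨n, h, hh, hh0, b, hba, hb⟩ := exists_eq_exp_mul_of_multiplicative (C := 1)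
    (ν := l.arg / (2 * Real.pi)) hF.diff_secondary
    (by
      intro w hw
      rw [hm w hw]
      congr 1
      have h1 := Complex.norm_mul_exp_arg_mul_I l
      rw [hl, Complex.ofReal_one, one_mul] at h1
      rw [← h1]
      congr 1
      have : (Real.pi : ℂ) ≠ 0 := by exact_mod_cast Real.pi_ne_zero
      rw [h1]
      push_cast
      field_simp)
    (fun w hw => (hF.norm_lt w hw).le) hg0
  set μ : ℝ := l.arg / (2 * Real.pi) + n with hμ
  have hμ0 : 0 ≤ μ := exponent_nonneg hh.continuousAt hh0 hb
    fun w hw => (hF.norm_lt w (halfPlane_mono hba hw)).le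
  obtain ⟨b', hb'b, hb'⟩ := exists_halfPlane_of_eventually
    (hh.eventually_analyticAt.filter_mono nhdsWithin_le_nhds) b
  have hd : ∀ w ∈ halfPlane b', deriv g w =
      Complex.exp (μ * w) * (μ * h (Complex.exp w) + Complex.exp w * deriv h (Complex.exp w)) := by
    intro w hw
    refine HasDerivAt.deriv ((hasDerivAt_exp_mul (hb' w hw).differentiableAt).congr_of_eventuallyEq ?_)
    filter_upwards [(isOpen_halfPlane b').mem_nhds hw] with x hx using hb x (halfPlane_mono hb'b hx)
  have hgz : ∀ᶠ z in 𝓝[≠] (0 : ℂ), z ≠ 0 ∧ Complex.log z ∈ halfPlane a ∧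
      g (Complex.log z) = Complex.exp (μ * Complex.log z) * h z := by
    filter_upwards [eventually_log_mem_halfPlane b, self_mem_nhdsWithin] with z hz hz0
    refine ⟨hz0, halfPlane_mono hba hz, ?_⟩
    rw [hb _ hz, Complex.exp_log hz0]
  have hb'a := hb'b.trans hba
  have hc' := hc.mono (Real.exp_le_exp.mpr hb'a)
  -- For `μ = 0`, `g` descends to `h`, and the exponent of `g'` is one more than the order of `h'`,
  -- again from `d/dw = z d/dz`. For `μ > 0`, `g → 0` and the exponent is `μ` itself.
  rcases hμ0.eq_or_lt with hμz | hμpos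
  · rw [← hμz] at hgz hd
    simp only [Complex.ofReal_zero, zero_mul, Complex.exp_zero, one_mul, zero_add] at hgz hd
    have hlt : ∀ᶠ z in 𝓝[≠] (0 : ℂ), ‖h z‖ < 1 := by
      filter_upwards [hgz] with z ⟨_, hz1, hz2⟩
      rw [← hz2]
      exact hF.norm_lt _ hz1
    have hle : ‖h 0‖ ≤ 1 := le_of_tendsto
      (hh.continuousAt.norm.tendsto.mono_left nhdsWithin_le_nhds) (hlt.mono fun z hz => hz.le)
    -- By the maximum principle: `|h(0)| = 1` would be a local maximum, making `h` constant of
    -- modulus `1` nearby.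
    have hlt0 : ‖h 0‖ < 1 := by
      refine lt_of_le_of_ne hle fun h1 => ?_
      have hmax : IsLocalMax (norm ∘ h) 0 := by
        have := eventually_nhdsWithin_iff.mp hlt
        filter_upwards [this] with z hz
        by_cases hz0 : z = 0
        · rw [hz0]
        · simp only [Function.comp_apply]; rw [h1]; exact (hz hz0).le
      have h2 := Complex.eventually_eq_of_isLocalMax_norm
        (hh.eventually_analyticAt.mono fun z hz => hz.differentiableAt) hmax
      obtain ⟨z, hz1, hz2⟩ := (hlt.and (h2.filter_mono nhdsWithin_le_nhds)).exists
      rw [hz2, h1] at hz1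
      exact lt_irrefl _ hz1
    rcases eventually_eq_zero_or_eq_pow_mul hh.deriv with h0 | ⟨j, k, hk, hk0, hkj⟩
    · obtain ⟨b₂, hb₂b, hb₂⟩ := exists_halfPlane_of_eventually
        (h0.filter_mono nhdsWithin_le_nhds) b'
      exact absurd ⟨b₂, hb₂b.trans hb'a, fun w hw => by
        rw [hd w (halfPlane_mono hb₂b hw), hb₂ w hw, mul_zero]⟩ hnc
    · obtain ⟨b₂, hb₂b, hb₂⟩ := exists_halfPlane_of_eventually
        (hkj.filter_mono nhdsWithin_le_nhds) b'
      refine (hF.mono (hb₂b.trans hb'a)).endsAt_of_exponent (μ := (j + 1 : ℕ)) (k := k)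
        (q := (1 + ‖h 0‖) / 2) (hc.mono (Real.exp_le_exp.mpr (hb₂b.trans hb'a))) (by positivity)
        hk hk0 (fun w hw => ?_) (by linarith) ?_
      · rw [hd w (halfPlane_mono hb₂b hw), hb₂ w hw, Complex.ofReal_natCast, Complex.exp_nat_mul,
          pow_succ]
        ring
      · have h3 : ∀ᶠ z in 𝓝[≠] (0 : ℂ), ‖h z‖ < (1 + ‖h 0‖) / 2 :=
          (hh.continuousAt.norm.tendsto.mono_left nhdsWithin_le_nhds).eventually
            (gt_mem_nhds (by linarith))
        filter_upwards [hgz, h3] with z ⟨_, _, hz⟩ hz3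
        rw [hz]; exact hz3.le
  · refine (hF.mono hb'a).endsAt_of_exponent (μ := μ)
      (k := fun z => μ * h z + z * deriv h z) (q := 1 / 2) hc' hμpos
      ((analyticAt_const.mul hh).add (analyticAt_id.mul hh.deriv)) ?_ hd (by norm_num) ?_
    · simpa using ⟨hμpos.ne', hh0⟩
    · filter_upwards [hgz, (tendsto_norm_rpow_mul hμpos hh.continuousAt).eventually
        (gt_mem_nhds (show (0 : ℝ) < 1 / 2 by norm_num))] with z ⟨hz0, _, hz⟩ hz1
      rw [hz, norm_mul, norm_exp_ofReal_mul_log μ hz0]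
      exact hz1.le

/-- A local branch of the logarithm through `w` carries differentiability from the covering down to
the disk. -/
theorem differentiableOn_of_comp_exp {Ω u : ℂ → ℂ} (hu : DifferentiableOn ℂ u (halfPlane a))
    (h : ∀ w ∈ halfPlane a, u w = Ω (Complex.exp w)) {w : ℂ} (hw : w ∈ halfPlane a) :
    HasDerivAt Ω (deriv u w / Complex.exp w) (Complex.exp w) := by
  set z₀ := Complex.exp w with hz₀
  have hz0 : z₀ ≠ 0 := Complex.exp_ne_zero w
  have h1 : HasDerivAt (fun z => Complex.log (z / z₀) + w) (1 / z₀) z₀ := by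
    have h2 : HasDerivAt (fun z => z / z₀) (1 / z₀) z₀ := (hasDerivAt_id z₀).div_const z₀
    have h3 := h2.clog (by rw [div_self hz0]; exact Complex.one_mem_slitPlane)
    simpa [div_self hz0] using h3.add_const w
  have hval : Complex.log (z₀ / z₀) + w = w := by simp [div_self hz0]
  have h4 : HasDerivAt u (deriv u w) (Complex.log (z₀ / z₀) + w) := by
    rw [hval]
    exact (hu.differentiableAt ((isOpen_halfPlane a).mem_nhds hw)).hasDerivAt
  have h5 := h4.comp z₀ h1
  rw [mul_one_div] at h5
  refine h5.congr_of_eventuallyEq ?_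
  have h6 : ∀ᶠ z in 𝓝 z₀, Complex.log (z / z₀) + w ∈ halfPlane a :=
    h1.continuousAt.eventually_mem ((isOpen_halfPlane a).mem_nhds (by rwa [hval]))
  filter_upwards [h6, isOpen_ne.mem_nhds hz0] with z hz hzne
  rw [Function.comp_apply, h _ hz, Complex.exp_add, Complex.exp_log (div_ne_zero hzne hz0), ← hz₀,
    div_mul_cancel₀ _ hz0]

/-- The case of vanishing secondary Gauss map. -/
theorem UnitaryFrame.endsAt_of_eq_zero (hF : UnitaryFrame a F g G H ρ)
    (hc : IsCompleteDensity (Real.exp a) ρ) (hg : ∀ w ∈ halfPlane a, g w = 0) : EndsAt H G := by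
  have hg' : ∀ w ∈ halfPlane a, deriv g w = 0 := fun w hw => by
    have : g =ᶠ[𝓝 w] fun _ => 0 := by
      filter_upwards [(isOpen_halfPlane a).mem_nhds hw] with x hx using hg x hx
    rw [this.deriv_eq]; simp
  have hP' : ∀ w ∈ halfPlane a, HasDerivAt (potential F G) 0 w := fun w hw => by
    have := hF.hasDerivAt_potential hw
    rwa [← hF.deriv_secondary_mul hw, hg' w hw, zero_mul, zero_mul, neg_zero] at this
  obtain ⟨P₀, hP₀⟩ := (isOpen_halfPlane a).exists_is_const_of_deriv_eq_zero
    (convex_halfPlane a).isPreconnected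
    (fun w hw => (hP' w hw).differentiableAt.differentiableWithinAt) (fun w hw => (hP' w hw).deriv)
  -- For `g = 0` and constant `P = P₀` one has `H₁₂ - G H₂₂ = P₀ conj F₂₁`. Solving for `P₀ F₂₁` in
  -- terms of `H` and `G`, which live on the disk, shows that it is single-valued.
  set Ω : ℂ → ℂ := fun z => P₀ * starRingEnd ℂ ((H z 0 1 - G z * H z 1 1) / P₀) with hΩ
  have hne0 : P₀ ≠ 0 := by
    have hw : ((a - 1 : ℝ) : ℂ) ∈ halfPlane a := by simp [halfPlane]
    rw [← hP₀ _ hw]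
    exact hF.potential_ne_zero hw
  have hΩF : ∀ w ∈ halfPlane a, P₀ * F w 1 0 = Ω (Complex.exp w) := by
    intro w hw
    have h1 := hF.potential_col hw
    rw [hg w hw] at h1
    have h2 := hP₀ w hw
    rw [potential] at h2
    have h3 : H (Complex.exp w) 0 1 - G (Complex.exp w) * H (Complex.exp w) 1 1 =
        P₀ * starRingEnd ℂ (F w 1 0) := by
      rw [hF.projection_apply hw, hF.projection_apply hw]
      linear_combination starRingEnd ℂ (F w 1 0) * h2 - starRingEnd ℂ (F w 1 1) * h1
    rw [hΩ]
    simp only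
    rw [h3, mul_div_cancel_left₀ _ hne0, Complex.conj_conj]
  have hder : ∀ w ∈ halfPlane a, HasDerivAt Ω
      (P₀ * deriv (fun x => F x 1 0) w / Complex.exp w) (Complex.exp w) := by
    intro w hw
    have h1 := differentiableOn_of_comp_exp ((hF.diff 1 0).const_mul P₀) hΩF hw
    rwa [((hF.hasDerivAt hw 1 0).const_mul P₀).deriv] at h1
  have hlog : ∀ z ∈ puncturedBall (Real.exp a), Complex.log z ∈ halfPlane a ∧
      Complex.exp (Complex.log z) = z := fun z hz =>
    ⟨log_mem_halfPlane (norm_pos_iff.mp hz.1) hz.2, Complex.exp_log (norm_pos_iff.mp hz.1)⟩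
  have hder' : ∀ z ∈ puncturedBall (Real.exp a), HasDerivAt Ω
      (P₀ * deriv (fun x => F x 1 0) (Complex.log z) / z) z := by
    intro z hz
    have := hder _ (hlog z hz).1
    rwa [(hlog z hz).2] at this
  have hρ : ∀ z ∈ puncturedBall (Real.exp a), ρ z = ‖deriv Ω z‖ := by
    intro z hz
    obtain ⟨h1, h2⟩ := hlog z hz
    have h3 := hF.density _ h1
    rw [hF.form_eq h1, hg _ h1, hP₀ _ h1, h2] at h3
    rw [(hder' z hz).deriv, norm_div, eq_div_iff hz.1.ne', h3]
    simp
  have hlim := tendsto_norm_atTop_of_isCompleteDensity (Real.exp_pos a) (Ω := Ω)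
    (fun z hz => (hder' z hz).differentiableAt.differentiableWithinAt)
    (fun z hz => by
      rw [(hder' z hz).deriv]
      exact div_ne_zero (mul_ne_zero hne0 (hF.deriv_ne _ (hlog z hz).1)) (norm_pos_iff.mp hz.1))
    (fun γ h1 h2 h3 => by
      rw [← hc γ h1 h2 h3]
      refine setLIntegral_congr_fun measurableSet_Ioo fun t ht => ?_
      simp only
      rw [hρ _ (h2 (Ioo_subset_Ico_self ht))])
  have hball := puncturedBall_mem_nhdsNE (Real.exp_pos a)
  have hΩlog : ∀ᶠ z in 𝓝[≠] (0 : ℂ), P₀ * F (Complex.log z) 1 0 = Ω z ∧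
      potential F G (Complex.log z) = P₀ := by
    filter_upwards [hball] with z hz
    have := hΩF _ (hlog z hz).1
    rw [(hlog z hz).2] at this
    exact ⟨this, hP₀ _ (hlog z hz).1⟩
  refine hF.endsAt_of_tendsto zero_lt_one ?_ (hlim.congr' ?_) ?_
  · filter_upwards [hball] with z hz
    rw [hg _ (hlog z hz).1, norm_zero]
  · filter_upwards [hΩlog] with z hz
    rw [hz.2, hz.1]
  · rw [tendsto_zero_iff_norm_tendsto_zero]
    have h1 := hlim.inv_tendsto_atTop.const_mul (‖P₀‖ ^ 2)
    rw [mul_zero] at h1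
    refine h1.congr' ?_
    filter_upwards [hΩlog] with z hz
    have := norm_ne_zero_iff.mpr hne0
    rw [hz.2, Pi.inv_apply, ← hz.1, norm_mul, norm_div]
    field_simp

end Cases

/-! ### Parabolic monodromy -/

/-- The case of parabolic monodromy, with the secondary Gauss map in the right half-plane. -/
theorem NullFrame.endsAt_of_translation {a b : ℝ} {F : ℂ → Matrix (Fin 2) (Fin 2) ℂ} {g G : ℂ → ℂ}
    {H : ℂ → Matrix (Fin 2) (Fin 2) ℂ} (hF : NullFrame a F g G)
    (hH : ∀ w ∈ halfPlane a, ∀ i j, H (Complex.exp w) i j =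
      -(F w i 0 * starRingEnd ℂ (F w j 1) + F w i 1 * starRingEnd ℂ (F w j 0)))
    (hre : ∀ w ∈ halfPlane a, 0 < (g w).re) (hb : b ≠ 0)
    (hm : ∀ w ∈ halfPlane a, g (w + 2 * Real.pi * Complex.I) = g w + Complex.I * b) :
    EndsAt H G := by
  have hpi := Real.pi_pos
  have hpiC : (Real.pi : ℂ) ≠ 0 := by exact_mod_cast hpi.ne'
  have hb0 : 0 < |b| := abs_pos.mpr hb
  -- With this `κ`, `exp (-κ g)` is invariant under the translation of `g` by `i b`. It is bounded
  -- because `Re g > 0`, hence equals `z ^ μ` times a unit.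
  set κ : ℝ := 2 * Real.pi / |b| with hκ
  have hκ0 : 0 < κ := by positivity
  have hκC : (κ : ℂ) ≠ 0 := by exact_mod_cast hκ0.ne'
  have hθn : ∀ w, ‖Complex.exp (-κ * g w)‖ = Real.exp (-κ * (g w).re) := by
    intro w; rw [Complex.norm_exp]; simp
  have hθd : DifferentiableOn ℂ (fun w => Complex.exp (-κ * g w)) (halfPlane a) :=
    (hF.diff_secondary.const_mul _).cexp
  have hκb : Complex.exp (-κ * (Complex.I * b)) = 1 := by
    rcases lt_or_gt_of_ne hb with h | h
    · rw [hκ, abs_of_neg h, ← Complex.exp_two_pi_mul_I]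
      congr 1
      have : (b : ℂ) ≠ 0 := by exact_mod_cast hb
      push_cast
      field_simp
    · rw [hκ, abs_of_pos h, ← inv_one, ← Complex.exp_two_pi_mul_I, ← Complex.exp_neg]
      congr 1
      have : (b : ℂ) ≠ 0 := by exact_mod_cast hb
      push_cast
      field_simp
  have hθ1 : ∀ w ∈ halfPlane a, ‖Complex.exp (-κ * g w)‖ ≤ 1 := by
    intro w hw
    rw [hθn, Real.exp_le_one_iff]
    nlinarith [hre w hw]
  obtain ⟨n, h, hh, hh0, c, hca, hc⟩ := exists_eq_exp_mul_of_multiplicative (C := 1) (ν := 0) hθd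
    (by
      intro w hw
      rw [hm w hw, mul_add, Complex.exp_add, hκb]; simp)
    hθ1 ⟨((a - 1 : ℝ) : ℂ), by simp [halfPlane], Complex.exp_ne_zero _⟩
  set μ : ℝ := 0 + n with hμ
  have hμ0 : 0 ≤ μ := exponent_nonneg hh.continuousAt hh0 hc
    fun w hw => hθ1 w (halfPlane_mono hca hw)
  set k : ℂ → ℂ := fun z => -(1 / κ) * (μ + z * deriv h z / h z) with hk
  have hka : AnalyticAt ℂ k 0 := analyticAt_const.mul
    (analyticAt_const.add ((analyticAt_id.mul hh.deriv).div hh hh0))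
  have hk0 : k 0 = -(1 / κ) * μ := by simp [hk]
  obtain ⟨d, hdc, hd⟩ := exists_halfPlane_of_eventually ((hh.eventually_analyticAt.filter_mono
    nhdsWithin_le_nhds).and (eventually_ne_zero_of_continuousAt hh.continuousAt hh0)) c
  have hda := hdc.trans hca
  have hg' : ∀ w ∈ halfPlane d, deriv g w = k (Complex.exp w) := by
    intro w hw
    have h1 : HasDerivAt (fun w => Complex.exp (-κ * g w))
        (Complex.exp (-κ * g w) * (-κ * deriv g w)) w :=
      ((hF.hasDerivAt_secondary (halfPlane_mono hda hw)).const_mul _).cexp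
    have h2 := (hasDerivAt_exp_mul (μ := μ) (hd w hw).1.differentiableAt).congr_of_eventuallyEq
      (f₁ := fun w => Complex.exp (-κ * g w)) (by
        filter_upwards [(isOpen_halfPlane d).mem_nhds hw] with x hx
          using hc x (halfPlane_mono hdc hx))
    have h3 := h1.unique h2
    have h4 := (hd w hw).2
    rw [hc w (halfPlane_mono hdc hw), mul_assoc] at h3
    have h5 := mul_left_cancel₀ (Complex.exp_ne_zero _) h3
    simp only [hk]
    field_simp
    linear_combination -h5
  -- If `μ = 0`, then `g' → 0` at the puncture, and over a segment of length `2π` the value `g`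
  -- changes by at most `|b| / 2` instead of `|b|`.
  have hμne : μ ≠ 0 := by
    intro h0
    have hk00 : k 0 = 0 := by rw [hk0, h0]; simp
    have h1 : ∀ᶠ z in 𝓝[≠] (0 : ℂ), ‖k z‖ < |b| / (4 * Real.pi) := by
      refine (hka.continuousAt.norm.tendsto.mono_left nhdsWithin_le_nhds).eventually
        (gt_mem_nhds ?_)
      rw [hk00, norm_zero]; positivity
    obtain ⟨e, hed, he⟩ := exists_halfPlane_of_eventually h1 d
    have hw : ((e - 1 : ℝ) : ℂ) ∈ halfPlane e := by simp [halfPlane]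
    have h2 := (convex_halfPlane e).norm_image_sub_le_of_norm_deriv_le (f := g) (𝕜 := ℂ)
      (fun w hw => (hF.hasDerivAt_secondary
        (halfPlane_mono (hed.trans hda) hw)).differentiableAt)
      (fun w hw => by rw [hg' w (halfPlane_mono hed hw)]; exact (he w hw).le)
      hw (add_period_mem hw)
    rw [hm _ (halfPlane_mono (hed.trans hda) hw)] at h2
    have h3 : ‖(2 * Real.pi * Complex.I : ℂ)‖ = 2 * Real.pi := by
      simp [abs_of_pos hpi]
    rw [add_sub_cancel_left, add_sub_cancel_left, h3, norm_mul, Complex.norm_I, one_mul,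
      Complex.norm_real, Real.norm_eq_abs,
      show |b| / (4 * Real.pi) * (2 * Real.pi) = |b| / 2 by field_simp; norm_num] at h2
    linarith
  have hμpos : 0 < μ := lt_of_le_of_ne hμ0 hμne.symm
  have hk00 : k 0 ≠ 0 := by
    rw [hk0]
    have : (μ : ℂ) ≠ 0 := by exact_mod_cast hμne
    simp [hκC, this]
  -- Now `g'` has a nonzero limit, so the growth exponent is `0` and `L(0) = m / 2 ≠ 0`.
  obtain ⟨e, hed, m, U, L, hE⟩ := (hF.mono hda).exists_growth (μ := 0) hka hk00
    (fun w hw => by rw [hg' w hw]; simp)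
  have hea := hed.trans hda
  have hL0 : L 0 ≠ 0 := by
    rw [hE.exponent_zero]
    have := hE.one_le
    have : (m : ℂ) ≠ 0 := by exact_mod_cast (by omega : m ≠ 0)
    simpa using this
  have hFe := hF.mono hea
  have hbase : ∀ᶠ z in 𝓝[≠] (0 : ℂ), Complex.log z ∈ halfPlane e ∧
      Complex.exp (Complex.log z) = z ∧ z ≠ 0 ∧ L z ≠ 0 ∧ k z ≠ 0 := by
    filter_upwards [eventually_log_mem_halfPlane e, self_mem_nhdsWithin,
      eventually_ne_zero_of_continuousAt hE.analytic_exponent.continuousAt hL0,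
      eventually_ne_zero_of_continuousAt hka.continuousAt hk00] with z hz hz0 hLz hkz
    exact ⟨hz, Complex.exp_log hz0, hz0, hLz, hkz⟩
  have hkb := eventually_norm_le hka.continuousAt
  obtain ⟨d', hd'd, hd'⟩ := exists_halfPlane_of_eventually hkb d
  set M : ℝ := ‖k 0‖ + 1 with hM
  have hM0 : 0 < M := by positivity
  set w₁ : ℂ := ((d' - 1 : ℝ) : ℂ) with hw₁
  have hw₁' : w₁ ∈ halfPlane d' := by simp [halfPlane, hw₁]
  have hlip : ∀ w ∈ halfPlane d', ‖g w - g w₁‖ ≤ M * ‖w - w₁‖ := fun w hw =>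
    (convex_halfPlane d').norm_image_sub_le_of_norm_deriv_le (f := g) (𝕜 := ℂ)
      (fun w hw => (hF.hasDerivAt_secondary (halfPlane_mono (hd'd.trans hda) hw)).differentiableAt)
      (fun w hw => by rw [hg' w (halfPlane_mono hd'd hw)]; exact hd' w hw) hw₁' hw
  have ht : Tendsto (fun z : ℂ => -Real.log ‖z‖) (𝓝[≠] 0) atTop :=
    tendsto_neg_atBot_atTop.comp (Real.tendsto_log_nhdsGT_zero.comp tendsto_norm_nhdsNE_zero)
  -- Taking `log |·|` of `exp (-κ g) = z ^ μ h` gives `Re g = (μ/κ)(-log |z|) - (1/κ) log |h|`; half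
  -- of the leading term absorbs the term with `h`.
  have hglow : ∀ᶠ z in 𝓝[≠] (0 : ℂ),
      μ / (2 * κ) * -Real.log ‖z‖ ≤ (g (Complex.log z)).re := by
    filter_upwards [hbase, eventually_norm_le hh.continuousAt,
      eventually_ne_zero_of_continuousAt hh.continuousAt hh0,
      eventually_log_mem_halfPlane c,
      ht.eventually_ge_atTop (2 / μ * Real.log (‖h 0‖ + 1))] with z hz hhz hhz0 hzc hzt
    have h1 := congrArg (fun x : ℂ => Real.log ‖x‖) (hc _ hzc)
    rw [hθn, Real.log_exp, hz.2.1, norm_mul, norm_exp_ofReal_mul_log μ hz.2.2.1,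
      Real.log_mul (Real.rpow_pos_of_pos (norm_pos_iff.mpr hz.2.2.1) _).ne'
        (norm_ne_zero_iff.mpr hhz0), Real.log_rpow (norm_pos_iff.mpr hz.2.2.1)] at h1
    have h2 := Real.log_le_log (norm_pos_iff.mpr hhz0) hhz
    rw [div_mul_eq_mul_div, div_le_iff₀ hμpos] at hzt
    rw [div_mul_eq_mul_div, div_le_iff₀ (by positivity)]
    nlinarith
  have hgup : ∀ᶠ z in 𝓝[≠] (0 : ℂ), ‖g (Complex.log z)‖ ≤ (M + 1) * -Real.log ‖z‖ := by
    filter_upwards [hbase, eventually_log_mem_halfPlane d', ht.eventually_ge_atTop 0,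
      ht.eventually_ge_atTop (‖g w₁‖ + M * (Real.pi + ‖w₁‖))] with z hz hzd hz0 hzt
    have h1 := hlip _ hzd
    have h2 : ‖Complex.log z‖ ≤ -Real.log ‖z‖ + Real.pi := by
      refine (Complex.norm_le_abs_re_add_abs_im _).trans ?_
      rw [Complex.log_re, abs_of_nonpos (by linarith), Complex.log_im]
      linarith [Complex.abs_arg_le_pi z]
    have h3 := norm_sub_le (Complex.log z) w₁
    have h4 := norm_le_norm_add_norm_sub' (g (Complex.log z)) (g w₁)
    have h5 : M * ‖Complex.log z - w₁‖ ≤ M * (-Real.log ‖z‖ + Real.pi + ‖w₁‖) :=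
      mul_le_mul_of_nonneg_left (by linarith) hM0.le
    nlinarith
  have hkL : ContinuousAt (fun z => k z / L z) 0 :=
    hka.continuousAt.div hE.analytic_exponent.continuousAt hL0
  refine hFe.endsAt_of_tendsto
    (K := max ((M + 1) * (2 * κ / μ)) (‖k 0 / L 0‖ + 1))
    (fun w hw => hH w (halfPlane_mono hea hw)) ?_ ?_ ?_ ?_ ?_
  · exact tendsto_atTop_mono' _ hglow (ht.const_mul_atTop (by positivity))
  · filter_upwards [hglow, hgup, ht.eventually_ge_atTop 0] with z h1 h2 h3
    have h4 : -Real.log ‖z‖ ≤ 2 * κ / μ * (g (Complex.log z)).re := by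
      calc -Real.log ‖z‖ = 2 * κ / μ * (μ / (2 * κ) * -Real.log ‖z‖) := by field_simp
        _ ≤ _ := mul_le_mul_of_nonneg_left h1 (by positivity)
    have h5 : 0 ≤ (g (Complex.log z)).re := le_trans (by positivity) h1
    calc ‖g (Complex.log z)‖ ≤ (M + 1) * -Real.log ‖z‖ := h2
      _ ≤ (M + 1) * (2 * κ / μ * (g (Complex.log z)).re) :=
          mul_le_mul_of_nonneg_left h4 (by positivity)
      _ = (M + 1) * (2 * κ / μ) * (g (Complex.log z)).re := by ring
      _ ≤ _ := mul_le_mul_of_nonneg_right (le_max_left _ _) h5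
  · filter_upwards [hbase] with z hz
    exact (hE.potential_div_col hFe hz.1 (by rw [hz.2.1]; exact hz.2.2.2.1)).1
  · filter_upwards [hbase, eventually_norm_le hkL] with z hz hz1
    have h1 := hE.potential_mul_col hFe hz.1
    rw [hg' _ (halfPlane_mono hed hz.1), hz.2.1] at h1
    have h2 : (potential F G (Complex.log z) * F (Complex.log z) 1 0)⁻¹ = -(k z / L z) := by
      have h3 : potential F G (Complex.log z) * F (Complex.log z) 1 0 ≠ 0 := by
        intro h0
        rw [h0, mul_zero] at h1
        exact hz.2.2.2.1 (neg_eq_zero.mp h1.symm)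
      refine inv_eq_of_mul_eq_one_left ?_
      rw [neg_mul, div_mul_eq_mul_div, h1, neg_div, div_self hz.2.2.2.1, neg_neg]
    rw [h2, norm_neg]
    exact hz1.trans (le_max_right _ _)
  · have h1 : Tendsto (fun z => -(z ^ m * U z / L z)) (𝓝[≠] 0) (𝓝 0) := by
      have h2 : ContinuousAt (fun z => -(z ^ m * U z / L z)) 0 :=
        (((continuousAt_id.pow m).mul hE.analytic_unit.continuousAt).div
          hE.analytic_exponent.continuousAt hL0).neg
      have h3 := h2.tendsto.mono_left (nhdsWithin_le_nhds (s := {0}ᶜ))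
      have : m ≠ 0 := by have := hE.one_le; omega
      simpa [this] using h3
    refine h1.congr' ?_
    filter_upwards [hbase] with z hz
    rw [(hE.potential_div_col hFe hz.1 (by rw [hz.2.1]; exact hz.2.2.2.1)).2,
      hE.logDerivative_eq _ hz.1, hz.2.1]

/-! ### The end of a unitary frame with complete metric -/

/-- The fixed-point equation of a disk automorphism is invariant under reflection `ζ ↦ 1 / conj ζ`
in the unit circle, so a root outside yields one inside. -/
theorem exists_norm_le_one_fixed (α β : ℂ) : ∃ ζ : ℂ, ‖ζ‖ ≤ 1 ∧
    starRingEnd ℂ β * ζ ^ 2 + (starRingEnd ℂ α - α) * ζ - β = 0 := by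
  by_cases hβ : β = 0
  · exact ⟨0, by simp, by simp [hβ]⟩
  have hβ' : starRingEnd ℂ β ≠ 0 := by simpa using hβ
  obtain ⟨ζ, hζ⟩ := IsAlgClosed.exists_eq_mul_self
    (discrim (starRingEnd ℂ β) (starRingEnd ℂ α - α) (-β))
  obtain ⟨ζ, hζ⟩ := exists_quadratic_eq_zero hβ' ⟨ζ, hζ⟩
  rcases le_or_gt ‖ζ‖ 1 with h | h
  · exact ⟨ζ, h, by linear_combination hζ⟩
  · have h0 : starRingEnd ℂ ζ ≠ 0 := by
      intro h0
      rw [map_eq_zero] at h0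
      norm_num [h0] at h
    refine ⟨(starRingEnd ℂ ζ)⁻¹, ?_, ?_⟩
    · rw [norm_inv, Complex.norm_conj]; exact inv_le_one_of_one_le₀ h.le
    · have h1 := congrArg (starRingEnd ℂ) hζ
      simp only [map_add, map_mul, map_sub, map_neg, Complex.conj_conj, map_zero] at h1
      field_simp
      linear_combination -h1

namespace UnitaryFrame

variable {a : ℝ} {F : ℂ → Matrix (Fin 2) (Fin 2) ℂ} {g G : ℂ → ℂ}
  {H : ℂ → Matrix (Fin 2) (Fin 2) ℂ} {ρ : ℂ → ℝ}

theorem exists_norm_sq_sub_eq_one {ζ : ℂ} (hζ : ‖ζ‖ < 1) :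
    ∃ s : ℝ, 0 < s ∧ ‖(s : ℂ)‖ ^ 2 - ‖ζ * s‖ ^ 2 = 1 := by
  have h1 : 0 < 1 - ‖ζ‖ ^ 2 := by nlinarith [norm_nonneg ζ]
  refine ⟨(√(1 - ‖ζ‖ ^ 2))⁻¹, by positivity, ?_⟩
  have h2 := Real.sq_sqrt h1.le
  have h3 : √(1 - ‖ζ‖ ^ 2) ≠ 0 := by positivity
  rw [norm_mul, Complex.norm_real, Real.norm_eq_abs, mul_pow, sq_abs, inv_pow, h2]
  field_simp

/-- Moving the fixed point to the origin by an element of `SU(1,1)` turns the monodromy into a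
rotation. -/
theorem endsAt_of_fixed_interior (hF : UnitaryFrame a F g G H ρ)
    (hc : IsCompleteDensity (Real.exp a) ρ) (hG : ∃ w ∈ halfPlane a, logDerivative G w ≠ 0)
    {α β ζ : ℂ} (hαβ : ‖α‖ ^ 2 - ‖β‖ ^ 2 = 1)
    (hm : ∀ w ∈ halfPlane a, g (w + 2 * Real.pi * Complex.I) * (α - starRingEnd ℂ β * g w) =
      starRingEnd ℂ α * g w - β)
    (hζ : ‖ζ‖ < 1) (hfix : starRingEnd ℂ β * ζ ^ 2 + (starRingEnd ℂ α - α) * ζ - β = 0) :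
    EndsAt H G := by
  obtain ⟨s, hs, hsζ⟩ := exists_norm_sq_sub_eq_one hζ
  have hsC : (s : ℂ) ≠ 0 := by exact_mod_cast hs.ne'
  have hden : α + starRingEnd ℂ ζ * β ≠ 0 := by
    have := one_sub_ne_zero (x := starRingEnd ℂ α) (y := -β) (z := ζ) (by simpa using hαβ) hζ.le
    rw [map_neg, mul_neg, sub_neg_eq_add] at this
    intro h
    apply this
    simpa using congrArg (starRingEnd ℂ) h
  have hfix' := congrArg (starRingEnd ℂ) hfix
  simp only [map_add, map_mul, map_sub, map_pow, Complex.conj_conj, map_zero] at hfix'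
  refine (hF.mul_unitary hsζ).endsAt_of_elliptic hc hG
    (l := (starRingEnd ℂ α + ζ * starRingEnd ℂ β) / (α + starRingEnd ℂ ζ * β)) ?_ fun w hw => ?_
  · rw [norm_div, div_eq_one_iff_eq (norm_ne_zero_iff.mpr hden), ← Complex.norm_conj]
    simp
  · have hD : α - g w * starRingEnd ℂ β ≠ 0 := one_sub_ne_zero hαβ (hF.norm_lt w hw).le
    have h1 : (s : ℂ) - g w * starRingEnd ℂ (ζ * s) ≠ 0 :=
      one_sub_ne_zero hsζ (hF.norm_lt w hw).le
    have h2 : (s : ℂ) - g (w + 2 * Real.pi * Complex.I) * starRingEnd ℂ (ζ * s) ≠ 0 :=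
      one_sub_ne_zero hsζ (hF.norm_lt _ (add_period_mem hw)).le
    have hX := hm w hw
    set X := g (w + 2 * Real.pi * Complex.I)
    rw [div_mul_div_comm, div_eq_div_iff h2 (mul_ne_zero hden h1)]
    simp only [map_mul, Complex.conj_ofReal]
    have e1 : (X - ζ) * (α - g w * starRingEnd ℂ β) =
        (starRingEnd ℂ α + ζ * starRingEnd ℂ β) * (g w - ζ) := by
      linear_combination hX + hfix
    have e2 : (1 - starRingEnd ℂ ζ * X) * (α - g w * starRingEnd ℂ β) =
        (α + starRingEnd ℂ ζ * β) * (1 - starRingEnd ℂ ζ * g w) := by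
      linear_combination -starRingEnd ℂ ζ * hX + g w * hfix'
    apply mul_right_cancel₀ hD
    linear_combination s ^ 2 * (α + starRingEnd ℂ ζ * β) * (1 - starRingEnd ℂ ζ * g w) * e1 -
      s ^ 2 * (starRingEnd ℂ α + ζ * starRingEnd ℂ β) * (g w - ζ) * e2

theorem re_cayley_pos {u : ℂ} (hu : ‖u‖ < 1) : 0 < ((1 + u) / (1 - u)).re := by
  have h1 : 1 - u ≠ 0 := by
    intro h
    rw [← sub_eq_zero.mp h] at hu
    simp at hu
  have h2 := Complex.normSq_pos.mpr h1
  have h3 : u.re ^ 2 + u.im ^ 2 < 1 := by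
    have h4 := Complex.sq_norm u
    rw [Complex.normSq_apply] at h4
    nlinarith [norm_nonneg u]
  rw [Complex.div_re, ← add_div]
  refine div_pos ?_ h2
  simp
  nlinarith

/-- The Cayley map sending `ζ` to infinity turns disk automorphisms fixing `ζ` into affine maps `u ↦
x² u + i b` of the right half-plane. -/
theorem endsAt_of_fixed_boundary (hF : UnitaryFrame a F g G H ρ)
    (hc : IsCompleteDensity (Real.exp a) ρ) (hG : ∃ w ∈ halfPlane a, logDerivative G w ≠ 0)
    {α β ζ : ℂ} (hαβ : ‖α‖ ^ 2 - ‖β‖ ^ 2 = 1)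
    (hm : ∀ w ∈ halfPlane a, g (w + 2 * Real.pi * Complex.I) * (α - starRingEnd ℂ β * g w) =
      starRingEnd ℂ α * g w - β)
    (hζ : ‖ζ‖ = 1) (hfix : starRingEnd ℂ β * ζ ^ 2 + (starRingEnd ℂ α - α) * ζ - β = 0) :
    EndsAt H G := by
  have hζζ : starRingEnd ℂ ζ * ζ = 1 := by
    rw [mul_comm, Complex.mul_conj, Complex.normSq_eq_norm_sq, hζ]; simp
  have hζ0 : ζ ≠ 0 := by rintro rfl; simp at hζ
  -- The scaling `s² = ζ / 2` gives the Cayley matrix determinant `1`.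
  obtain ⟨s, hs⟩ := IsAlgClosed.exists_eq_mul_self (ζ / 2)
  have hs0 : s ≠ 0 := by
    rintro rfl
    simp [hζ0] at hs
  have hss : s * starRingEnd ℂ s = 1 / 2 := by
    have h1 := congrArg norm hs
    rw [norm_div, hζ, norm_mul] at h1
    rw [Complex.mul_conj, Complex.normSq_eq_norm_sq, sq, ← h1]
    simp
  have hu : ∀ w ∈ halfPlane a, ‖starRingEnd ℂ ζ * g w‖ < 1 := fun w hw => by
    rw [norm_mul, Complex.norm_conj, hζ, one_mul]; exact hF.norm_lt w hw
  have hne : ∀ w ∈ halfPlane a, 1 - starRingEnd ℂ ζ * g w ≠ 0 := fun w hw h => by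
    have := hu w hw
    rw [← sub_eq_zero.mp h] at this
    simp at this
  have hF' := hF.toNullFrame.mul_const
    (C := !![s, -s; s * starRingEnd ℂ ζ, s * starRingEnd ℂ ζ])
    (by simp; linear_combination 2 * starRingEnd ℂ ζ * -hs + hζζ)
    (fun w hw => by
      have := mul_ne_zero hs0 (hne w hw)
      rw [show s * (1 - starRingEnd ℂ ζ * g w) = s - g w * (s * starRingEnd ℂ ζ) by ring] at this
      simpa using this)
  have hg' : ∀ w ∈ halfPlane a,
      (g w * (!![s, -s; s * starRingEnd ℂ ζ, s * starRingEnd ℂ ζ] : Matrix (Fin 2) (Fin 2) ℂ) 1 1 -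
        (!![s, -s; s * starRingEnd ℂ ζ, s * starRingEnd ℂ ζ] : Matrix (Fin 2) (Fin 2) ℂ) 0 1) /
      ((!![s, -s; s * starRingEnd ℂ ζ, s * starRingEnd ℂ ζ] : Matrix (Fin 2) (Fin 2) ℂ) 0 0 -
        g w * (!![s, -s; s * starRingEnd ℂ ζ, s * starRingEnd ℂ ζ] : Matrix (Fin 2) (Fin 2) ℂ) 1 0) =
      (1 + starRingEnd ℂ ζ * g w) / (1 - starRingEnd ℂ ζ * g w) := by
    intro w hw
    rw [← mul_div_mul_left (1 + starRingEnd ℂ ζ * g w) _ hs0]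
    simp
    congr 1 <;> ring
  set gh := fun w =>
      (g w * (!![s, -s; s * starRingEnd ℂ ζ, s * starRingEnd ℂ ζ] : Matrix (Fin 2) (Fin 2) ℂ) 1 1 -
        (!![s, -s; s * starRingEnd ℂ ζ, s * starRingEnd ℂ ζ] : Matrix (Fin 2) (Fin 2) ℂ) 0 1) /
      ((!![s, -s; s * starRingEnd ℂ ζ, s * starRingEnd ℂ ζ] : Matrix (Fin 2) (Fin 2) ℂ) 0 0 -
        g w * (!![s, -s; s * starRingEnd ℂ ζ, s * starRingEnd ℂ ζ] : Matrix (Fin 2) (Fin 2) ℂ) 1 0)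
    with hgh
  replace hg' : ∀ w ∈ halfPlane a,
    gh w = (1 + starRingEnd ℂ ζ * g w) / (1 - starRingEnd ℂ ζ * g w) := hg'
  have hre : ∀ w ∈ halfPlane a, 0 < (gh w).re := fun w hw => by
    rw [hg' w hw]; exact re_cayley_pos (hu w hw)
  have hH : ∀ w ∈ halfPlane a, ∀ i j, H (Complex.exp w) i j =
      -((F w * !![s, -s; s * starRingEnd ℂ ζ, s * starRingEnd ℂ ζ]) i 0 *
          starRingEnd ℂ ((F w * !![s, -s; s * starRingEnd ℂ ζ, s * starRingEnd ℂ ζ]) j 1) +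
        (F w * !![s, -s; s * starRingEnd ℂ ζ, s * starRingEnd ℂ ζ]) i 1 *
          starRingEnd ℂ ((F w * !![s, -s; s * starRingEnd ℂ ζ, s * starRingEnd ℂ ζ]) j 0)) := by
    intro w hw i j
    rw [hF.projection_apply hw]
    simp only [Matrix.mul_apply, Fin.sum_univ_two]
    simp
    linear_combination (-2 * F w i 0 * starRingEnd ℂ (F w j 0) +
      2 * starRingEnd ℂ ζ * ζ * F w i 1 * starRingEnd ℂ (F w j 1)) * hss +
      F w i 1 * starRingEnd ℂ (F w j 1) * hζζ
  set t := starRingEnd ℂ β * ζ with ht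
  -- The fixed-point equation says exactly that `α - conj β · ζ` is real. Its square is the
  -- multiplier of the affine map.
  have hx : ((α - t).re : ℂ) = α - t := by
    rw [← Complex.conj_eq_iff_re]
    rw [ht]
    simp only [map_sub, map_mul, Complex.conj_conj]
    linear_combination starRingEnd ℂ ζ * hfix -
      (starRingEnd ℂ β * ζ + starRingEnd ℂ α - α) * hζζ
  set x : ℝ := (α - t).re with hxdef
  have hαx : α = x + t := by rw [hx]; ring
  have hβt : β = starRingEnd ℂ t * ζ := by
    rw [ht]; simp only [map_mul, Complex.conj_conj]; linear_combination -β * hζζ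
  have htt := Complex.re_add_im t
  have htt' : starRingEnd ℂ t = t.re - t.im * Complex.I := by
    apply Complex.ext <;> simp
  have hx1C : (x : ℂ) * (x + 2 * t.re) = 1 := by
    have h1 := mul_conj_eq hαβ
    rw [hαx, hβt] at h1
    simp only [map_add, map_mul, Complex.conj_conj, Complex.conj_ofReal] at h1
    have h2 : (2 * t.re : ℂ) = t + starRingEnd ℂ t := by rw [htt']; nth_rewrite 2 [← htt]; ring
    rw [h2]
    linear_combination h1 + t * starRingEnd ℂ t * hζζ
  have hx1 : x * (x + 2 * t.re) = 1 := by exact_mod_cast hx1C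
  have hx0 : x ≠ 0 := left_ne_zero_of_mul_eq_one hx1
  have htrans : ∀ w ∈ halfPlane a, gh (w + 2 * Real.pi * Complex.I) =
      (x ^ 2 : ℝ) * gh w + Complex.I * (2 * x * t.im : ℝ) := by
    intro w hw
    rw [hg' w hw, hg' _ (add_period_mem hw)]
    have hX := hm w hw
    have h1 := hne w hw
    have h2 := hne _ (add_period_mem hw)
    set X := g (w + 2 * Real.pi * Complex.I)
    have hD : α - g w * starRingEnd ℂ β ≠ 0 := one_sub_ne_zero hαβ (hF.norm_lt w hw).le
    have hα' : starRingEnd ℂ α = x + starRingEnd ℂ t := by rw [hαx]; simp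
    have hβ' : starRingEnd ℂ β = t * starRingEnd ℂ ζ := by rw [ht]; linear_combination -starRingEnd ℂ β * hζζ
    have htre : (2 * t.re : ℂ) = t + starRingEnd ℂ t := by rw [htt']; nth_rewrite 2 [← htt]; ring
    have htim : (2 * t.im * Complex.I : ℂ) = t - starRingEnd ℂ t := by
      rw [htt']; nth_rewrite 2 [← htt]; ring
    have e1 : (1 + starRingEnd ℂ ζ * X) * (α - g w * starRingEnd ℂ β) =
        x * (1 + starRingEnd ℂ ζ * g w) +
          2 * t.im * Complex.I * (1 - starRingEnd ℂ ζ * g w) := by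
      linear_combination starRingEnd ℂ ζ * hX + hαx - g w * hβ' + starRingEnd ℂ ζ * g w * hα' -
        starRingEnd ℂ ζ * hβt - starRingEnd ℂ t * hζζ - (1 - starRingEnd ℂ ζ * g w) * htim
    have e2 : (1 - starRingEnd ℂ ζ * X) * (α - g w * starRingEnd ℂ β) =
        (x + 2 * t.re) * (1 - starRingEnd ℂ ζ * g w) := by
      linear_combination -starRingEnd ℂ ζ * hX + hαx - g w * hβ' - starRingEnd ℂ ζ * g w * hα' +
        starRingEnd ℂ ζ * hβt + starRingEnd ℂ t * hζζ - (1 - starRingEnd ℂ ζ * g w) * htre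
    rw [div_eq_iff h2]
    apply mul_right_cancel₀ hD
    push_cast
    rw [e1, mul_assoc (_ + _), e2]
    field_simp
    linear_combination (-x * (1 + starRingEnd ℂ ζ * g w) -
      2 * t.im * Complex.I * (1 - starRingEnd ℂ ζ * g w)) * hx1C
  -- Multiplier `1` leaves the identity, treated as a trivial rotation, or a translation. Any other
  -- multiplier becomes a pure dilation after an imaginary shift moves its fixed point to `0`, which
  -- Schwarz-Pick rules out.
  by_cases hs1 : x ^ 2 = 1
  · rw [hs1] at htrans
    by_cases hb : 2 * x * t.im = 0
    · refine hF.endsAt_of_elliptic hc hG (l := 1) (by simp) fun w hw => ?_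
      have h1 := htrans w hw
      rw [hb, hg' w hw, hg' _ (add_period_mem hw)] at h1
      simp only [Complex.ofReal_one, one_mul, Complex.ofReal_zero, mul_zero, add_zero] at h1
      rw [div_eq_div_iff (hne _ (add_period_mem hw)) (hne w hw)] at h1
      rw [one_mul]
      apply mul_left_cancel₀ (show starRingEnd ℂ ζ ≠ 0 by simpa using hζ0)
      linear_combination h1 / 2
    · exact hF'.endsAt_of_translation hH hre hb fun w hw => by simpa using htrans w hw
  · exfalso
    have hs2 : ((x ^ 2 - 1 : ℝ) : ℂ) ≠ 0 := by exact_mod_cast sub_ne_zero.mpr hs1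
    refine hs1 (eq_one_of_multiplicative_of_re_pos (a := a) (s := x ^ 2)
      (u := fun w => gh w + Complex.I * (2 * x * t.im / (x ^ 2 - 1) : ℝ)) (by positivity)
      (hF'.diff_secondary.add_const _) (fun w hw => by
        simpa only [Complex.add_re, Complex.I_mul_re, Complex.ofReal_im, neg_zero, add_zero]
          using hre w hw) fun w hw => ?_)
    rw [htrans w hw]
    push_cast at hs2 ⊢
    field_simp
    ring

/-- If `G' = 0` throughout, `g' P² = G'` makes `g` constant and a disk automorphism sends it to `0`;
otherwise the fixed point of the monodromy decides. -/
theorem endsAt (hF : UnitaryFrame a F g G H ρ) (hc : IsCompleteDensity (Real.exp a) ρ) :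
    EndsAt H G := by
  by_cases hG : ∃ w ∈ halfPlane a, logDerivative G w ≠ 0
  · obtain ⟨α, β, hαβ, hm⟩ := hF.exists_monodromy
    obtain ⟨ζ, hζ, hfix⟩ := exists_norm_le_one_fixed α β
    rcases hζ.lt_or_eq with h | h
    · exact hF.endsAt_of_fixed_interior hc hG hαβ hm h hfix
    · exact hF.endsAt_of_fixed_boundary hc hG hαβ hm h hfix
  · push Not at hG
    have hg' : ∀ w ∈ halfPlane a, deriv g w = 0 := fun w hw => by
      have := hF.deriv_secondary_mul hw
      rw [hG w hw] at this
      exact (mul_eq_zero.mp this).resolve_right (pow_ne_zero _ (hF.potential_ne_zero hw))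
    obtain ⟨ζ, hζ⟩ := (isOpen_halfPlane a).exists_is_const_of_deriv_eq_zero
      (convex_halfPlane a).isPreconnected hF.diff_secondary hg'
    have hζ1 : ‖ζ‖ < 1 := by
      have hw : ((a - 1 : ℝ) : ℂ) ∈ halfPlane a := by simp [halfPlane]
      rw [← hζ _ hw]; exact hF.norm_lt _ hw
    obtain ⟨s, hs, hsζ⟩ := exists_norm_sq_sub_eq_one hζ1
    refine (hF.mul_unitary hsζ).endsAt_of_eq_zero hc fun w hw => ?_
    simp [hζ w hw]

end UnitaryFrame

/-! ### The induced metric in terms of a null lift -/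

theorem lorentz_apply (x y : Mink) :
    lorentz x y = -(x 0 * y 0) + x 1 * y 1 + x 2 * y 2 + x 3 * y 3 := by
  simp [lorentz, Matrix.toBilin'_apply', Matrix.mulVec_diagonal, dotProduct, Fin.sum_univ_four]

theorem lorentz_self_eq_det (x : Mink) :
    (lorentz x x : ℂ) = -(toHerm x 0 0 * toHerm x 1 1 - toHerm x 0 1 * toHerm x 1 0) := by
  rw [lorentz_apply]
  simp [toHerm]
  linear_combination (x 2 : ℂ) ^ 2 * Complex.I_sq

theorem hasDerivAt_toHerm {c : ℝ → Mink} {c' : Mink} {t : ℝ} (hc : HasDerivAt c c' t)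
    (i j : Fin 2) : HasDerivAt (fun s => toHerm (c s) i j) (toHerm c' i j) t := by
  have h := fun k => (hasDerivAt_pi.mp hc k).ofReal_comp
  fin_cases i <;> fin_cases j
  · exact (h 0).add (h 3)
  · exact (h 1).add ((h 2).const_mul _)
  · exact (h 1).sub ((h 2).const_mul _)
  · exact (h 0).sub (h 3)

/-- The differential of `F e₃ F*` is a Hermitian matrix `x y* + y x*`, whose determinant is `-|det
(x, y)|²`, while the Lorentz square is minus the determinant. The hypothesis `hl` extracts `1 -
|l|²` from `det (x, y)`. -/
theorem firstForm_self_eq {f : ℂ → Mink} {F : ℂ → Matrix (Fin 2) (Fin 2) ℂ} {w l : ℂ}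
    {d : Fin 2 → ℂ} (hf : DifferentiableAt ℝ f (Complex.exp w))
    (hF : ∀ᶠ x in 𝓝 w, toHerm (f (Complex.exp x)) = F x * e3 * (F x)ᴴ)
    (h0 : ∀ i, HasDerivAt (fun x => F x i 0) (d i) w)
    (h1 : ∀ i, HasDerivAt (fun x => F x i 1) (-l * d i) w)
    (hl : F w 1 1 * d 0 - F w 0 1 * d 1 = l * (F w 0 0 * d 1 - F w 1 0 * d 0)) (u : ℂ) :
    firstForm f (Complex.exp w) u u =
      (‖u‖ * ((1 - ‖l‖ ^ 2) * ‖F w 0 0 * d 1 - F w 1 0 * d 0‖ / ‖Complex.exp w‖)) ^ 2 := by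
  set z := Complex.exp w with hz
  have hz0 : z ≠ 0 := Complex.exp_ne_zero w
  set v := u / z with hv
  have huv : u = v * z := by rw [hv, div_mul_cancel₀ _ hz0]
  set Y := fderiv ℝ f z u with hY
  have hline : HasDerivAt (fun t : ℝ => w + t * v) v 0 := by
    simpa using ((hasDerivAt_id (0 : ℂ)).comp_ofReal.mul_const v).const_add w
  have hw0 : w + ((0 : ℝ) : ℂ) * v = w := by simp
  have hcurve : HasDerivAt (fun t : ℝ => f (Complex.exp (w + t * v))) Y 0 := by
    have h2 : HasDerivAt (fun t : ℝ => Complex.exp (w + t * v)) u 0 := by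
      have := hline.cexp
      rwa [hw0, ← hz, mul_comm, ← huv] at this
    have h3 : HasFDerivAt f (fderiv ℝ f z) (Complex.exp (w + ((0 : ℝ) : ℂ) * v)) := by
      rw [hw0]; exact hf.hasFDerivAt
    exact h3.comp_hasDerivAt 0 h2
  have hcomp : ∀ {k : ℂ → ℂ} {k' : ℂ}, HasDerivAt k k' w →
      HasDerivAt (fun t : ℝ => k (w + t * v)) (k' * v) 0 := by
    intro k k' hk
    rw [← hw0] at hk
    exact hk.comp 0 hline
  have hconj : ∀ {k : ℝ → ℂ} {k' : ℂ}, HasDerivAt k k' 0 →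
      HasDerivAt (fun t => starRingEnd ℂ (k t)) (starRingEnd ℂ k') 0 := fun hk =>
    Complex.conjCLE.hasFDerivAt.comp_hasDerivAt 0 hk
  have hent : ∀ i j, toHerm Y i j =
      d i * v * starRingEnd ℂ (F w j 0 + starRingEnd ℂ l * F w j 1) +
        (F w i 0 + starRingEnd ℂ l * F w i 1) * starRingEnd ℂ (d j * v) := by
    intro i j
    have e1 := hasDerivAt_toHerm hcurve i j
    have e2 := ((hcomp (h0 i)).fun_mul (hconj (hcomp (h0 j)))).fun_sub
      ((hcomp (h1 i)).fun_mul (hconj (hcomp (h1 j))))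
    have e3' : (fun t : ℝ => toHerm (f (Complex.exp (w + t * v))) i j) =ᶠ[𝓝 0]
        fun t : ℝ => F (w + t * v) i 0 * starRingEnd ℂ (F (w + t * v) j 0) -
          F (w + t * v) i 1 * starRingEnd ℂ (F (w + t * v) j 1) := by
      have hc := hline.continuousAt
      rw [ContinuousAt, hw0] at hc
      filter_upwards [hc.eventually hF] with t ht
      rw [ht]
      simp [Matrix.mul_apply, Fin.sum_univ_two, e3, Matrix.conjTranspose_apply, sub_eq_add_neg]
    rw [e1.unique (e2.congr_of_eventuallyEq e3')]
    simp
    ring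
  have hfin : (firstForm f z u u : ℂ) =
      ((‖u‖ * ((1 - ‖l‖ ^ 2) * ‖F w 0 0 * d 1 - F w 1 0 * d 0‖ / ‖z‖)) ^ 2 : ℝ) := by
    have e1 : firstForm f z u u = lorentz Y Y := rfl
    rw [e1, lorentz_self_eq_det, hent, hent, hent, hent]
    have e2 : (F w 0 0 * d 1 - F w 1 0 * d 0) * (1 - l * starRingEnd ℂ l) =
        d 1 * (F w 0 0 + starRingEnd ℂ l * F w 0 1) - d 0 * (F w 1 0 + starRingEnd ℂ l * F w 1 1) := by
      linear_combination starRingEnd ℂ l * hl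
    have e3' := congrArg (starRingEnd ℂ) e2
    have e4 : ‖u‖ = ‖v‖ * ‖z‖ := by rw [huv, norm_mul]
    have hzn : ‖z‖ ≠ 0 := norm_ne_zero_iff.mpr hz0
    have e5 : ‖u‖ * ((1 - ‖l‖ ^ 2) * ‖F w 0 0 * d 1 - F w 1 0 * d 0‖ / ‖z‖) =
        ‖v‖ * ((1 - ‖l‖ ^ 2) * ‖F w 0 0 * d 1 - F w 1 0 * d 0‖) := by
      rw [e4]; field_simp
    rw [e5]
    push_cast
    rw [mul_pow, mul_pow, ← Complex.mul_conj', ← Complex.mul_conj' (F w 0 0 * d 1 - F w 1 0 * d 0),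
      ← Complex.mul_conj' l]
    simp only [map_add, map_sub, map_mul, map_one, Complex.conj_conj] at e3' ⊢
    linear_combination -(v * starRingEnd ℂ v) * (starRingEnd ℂ (d 1) *
      (starRingEnd ℂ (F w 0 0) + l * starRingEnd ℂ (F w 0 1)) - starRingEnd ℂ (d 0) *
      (starRingEnd ℂ (F w 1 0) + l * starRingEnd ℂ (F w 1 1))) * e2 -
      v * starRingEnd ℂ v * ((F w 0 0 * d 1 - F w 1 0 * d 0) * (1 - l * starRingEnd ℂ l)) * e3'
  exact_mod_cast hfin

/-! ### Convergence to the future ideal boundary -/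

/-- The density of the induced metric, which is conformal for a map with a null lift. -/
def density (f : ℂ → Mink) (z : ℂ) : ℝ := √(firstForm f z 1 1)

/-- A null lift, over a punctured disk, of `f` whose secondary Gauss map has modulus less than one
and whose hyperbolic Gauss map is the quotient `p / q`. -/
structure DiskLift (a : ℝ) (f : ℂ → Mink) (F : ℂ → Matrix (Fin 2) (Fin 2) ℂ) (g p q : ℂ → ℂ) :
    Prop where
  diff : ∀ i j, DifferentiableOn ℂ (fun w => F w i j) (halfPlane a)
  diff_secondary : DifferentiableOn ℂ g (halfPlane a)
  det_eq : ∀ w ∈ halfPlane a, F w 0 0 * F w 1 1 - F w 0 1 * F w 1 0 = 1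
  deriv_col : ∀ w ∈ halfPlane a, ∀ i,
    deriv (fun x => F x i 1) w = -g w * deriv (fun x => F x i 0) w
  deriv_row : ∀ w ∈ halfPlane a, ∀ j,
    deriv (fun x => F x 0 j) w * q (Complex.exp w) = deriv (fun x => F x 1 j) w * p (Complex.exp w)
  matDeriv_ne : ∀ w ∈ halfPlane a, matDeriv F w ≠ 0
  norm_lt : ∀ w ∈ halfPlane a, ‖g w‖ < 1
  projection : ∀ w ∈ halfPlane a, toHerm (f (Complex.exp w)) = F w * e3 * (F w)ᴴ

/-- With `q(0) ≠ 0` the quotient `G = p / q` is holomorphic at the puncture. Then `F₂₁'` cannot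
vanish, since the row and column relations would make all of `dF` vanish. -/
theorem DiskLift.exists_unitaryFrame {a : ℝ} {f : ℂ → Mink} {F : ℂ → Matrix (Fin 2) (Fin 2) ℂ}
    {g p q : ℂ → ℂ} (hL : DiskLift a f F g p q) (hp : AnalyticAt ℂ p 0) (hq : AnalyticAt ℂ q 0)
    (hq0 : q 0 ≠ 0) (hf : ∀ z ∈ puncturedBall (Real.exp a), DifferentiableAt ℝ f z) :
    ∃ b ≤ a, UnitaryFrame b F g (fun z => p z / q z) (fun z => toHerm (f z)) (density f) := by
  have hev : ∀ᶠ z in 𝓝 (0 : ℂ), AnalyticAt ℂ p z ∧ AnalyticAt ℂ q z ∧ q z ≠ 0 :=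
    hp.eventually_analyticAt.and (hq.eventually_analyticAt.and (hq.continuousAt.eventually_ne hq0))
  obtain ⟨b, hba, hb⟩ := exists_halfPlane_of_eventually (hev.filter_mono nhdsWithin_le_nhds) a
  have hm := halfPlane_mono hba
  have hball : ∀ z ∈ Metric.ball (0 : ℂ) (Real.exp b),
      AnalyticAt ℂ p z ∧ AnalyticAt ℂ q z ∧ q z ≠ 0 := by
    intro z hz
    by_cases hz0 : z = 0
    · rw [hz0]; exact hev.self_of_nhds
    · rw [← Complex.exp_log hz0]
      exact hb _ (log_mem_halfPlane hz0 (by simpa using hz))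
  have hrow : ∀ w ∈ halfPlane b, ∀ j, deriv (fun x => F x 0 j) w =
      p (Complex.exp w) / q (Complex.exp w) * deriv (fun x => F x 1 j) w := by
    intro w hw j
    have h1 := hL.deriv_row w (hm hw) j
    have h2 := (hb w hw).2.2
    field_simp
    linear_combination h1
  have hN : NullFrame b F g (fun z => p z / q z) :=
    { diff := fun i j => (hL.diff i j).mono hm
      diff_secondary := hL.diff_secondary.mono hm
      diff_hyperbolic := fun z hz => ((hball z hz).1.differentiableAt.div
        (hball z hz).2.1.differentiableAt (hball z hz).2.2).differentiableWithinAt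
      det_eq := fun w hw => hL.det_eq w (hm hw)
      deriv_col := fun w hw => hL.deriv_col w (hm hw)
      deriv_row := hrow
      deriv_ne := by
        intro w hw h0
        apply hL.matDeriv_ne w (hm hw)
        have h1 := hL.deriv_col w (hm hw) 1
        rw [h0, mul_zero] at h1
        have h2 := hrow w hw 0
        rw [h0, mul_zero] at h2
        have h3 := hrow w hw 1
        rw [h1, mul_zero] at h3
        ext i j
        fin_cases i <;> fin_cases j
        · exact h2
        · exact h3
        · exact h0
        · exact h1 }
  refine ⟨b, hba, hN, fun w hw => hL.norm_lt w (hm hw), fun w hw => hL.projection w (hm hw), ?_⟩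
  intro w hw
  have hw' := hm hw
  have hl : F w 1 1 * deriv (fun x => F x 0 0) w - F w 0 1 * deriv (fun x => F x 1 0) w =
      g w * (F w 0 0 * deriv (fun x => F x 1 0) w - F w 1 0 * deriv (fun x => F x 0 0) w) := by
    have h2 := hN.potential_col hw
    rw [hN.form_eq hw, hrow w hw 0]
    linear_combination -deriv (fun x => F x 1 0) w * h2
  have h1 := firstForm_self_eq (l := g w) (d := fun i => deriv (fun x => F x i 0) w)
    (hf (Complex.exp w) ⟨by simp, mem_halfPlane_iff_norm_exp.mp hw'⟩)
    (by filter_upwards [(isOpen_halfPlane a).mem_nhds hw'] with x hx using hL.projection x hx)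
    (fun i => hN.hasDerivAt hw i 0)
    (fun i => by rw [← hN.deriv_col w hw i]; exact hN.hasDerivAt hw i 1)
    hl 1
  have h3 : 0 < 1 - ‖g w‖ ^ 2 := by nlinarith [norm_nonneg (g w), hL.norm_lt w hw']
  have h4 : ‖Complex.exp w‖ ≠ 0 := by simp
  rw [density, h1, Real.sqrt_sq (by positivity), norm_one, one_mul, div_mul_cancel₀ _ h4]

/-! ### Limits of directions and of rays -/

theorem tendsto_normalize {ι E : Type*} [NormedAddCommGroup E] [NormedSpace ℝ E] {l : Filter ι}
    {f : ι → E} {s : ι → ℝ} {v : E} (hs : ∀ᶠ x in l, 0 < s x) (hv : v ≠ 0)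
    (h : Tendsto (fun x => (s x)⁻¹ • f x) l (𝓝 v)) :
    Tendsto (fun x => ‖f x‖⁻¹ • f x) l (𝓝 (‖v‖⁻¹ • v)) := by
  refine ((h.norm.inv₀ (norm_ne_zero_iff.mpr hv)).smul h).congr' ?_
  filter_upwards [hs] with x hx
  rw [norm_smul, norm_inv, Real.norm_of_nonneg hx.le, smul_smul]
  congr 1
  field_simp

/-- The directions of `f` converge to a future directed lightlike direction. -/
def TendsToFuture (f : ℂ → Mink) (l : Filter ℂ) : Prop :=
  ∃ v : Mink, lorentz v v = 0 ∧ 0 < v 0 ∧ Tendsto (fun z => ‖f z‖⁻¹ • f z) l (𝓝 (‖v‖⁻¹ • v))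

theorem exists_futureBoundary_iff {f : ℂ → Mink} {l : Filter ℂ} :
    (∃ P ∈ futureBoundary, ConvergesToRay f l P) ↔ TendsToFuture f l := by
  constructor
  · rintro ⟨_, ⟨v, hv, hvv, hv0, rfl⟩, v', hv', hP, hlim⟩
    rw [← (sameRay_iff_inv_norm_smul_eq_of_ne hv hv').mp ((ray_eq_iff hv hv').mp hP)] at hlim
    exact ⟨v, hvv, hv0, hlim⟩
  · rintro ⟨v, hvv, hv0, hlim⟩
    have hv : v ≠ 0 := fun h => by simp [h] at hv0
    exact ⟨rayOfNeZero ℝ v hv, ⟨v, hv, hvv, hv0, rfl⟩, v, hv, rfl, hlim⟩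

theorem exists_pastBoundary_iff {f : ℂ → Mink} {l : Filter ℂ} :
    (∃ P ∈ pastBoundary, ConvergesToRay f l P) ↔ TendsToFuture (fun z => -f z) l := by
  constructor
  · rintro ⟨_, ⟨v, hv, hvv, hv0, rfl⟩, v', hv', hP, hlim⟩
    rw [← (sameRay_iff_inv_norm_smul_eq_of_ne hv hv').mp ((ray_eq_iff hv hv').mp hP)] at hlim
    exact ⟨-v, by simpa using hvv, by simpa using hv0, by simpa using hlim.neg⟩
  · rintro ⟨v, hvv, hv0, hlim⟩
    have hv : -v ≠ 0 := fun h => by simp [neg_eq_zero.mp h] at hv0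
    exact ⟨rayOfNeZero ℝ (-v) hv, ⟨-v, hv, by simpa using hvv, by simpa using hv0, rfl⟩, -v, hv,
      rfl, by simpa using hlim.neg⟩

theorem TendsToFuture.not_neg {f : ℂ → Mink} {l : Filter ℂ} [l.NeBot] (h : TendsToFuture f l) :
    ¬ TendsToFuture (fun z => -f z) l := by
  rintro ⟨v', -, hv'0, hlim'⟩
  obtain ⟨v, -, hv0, hlim⟩ := h
  have h1 := congrFun (tendsto_nhds_unique hlim'.neg (by simpa using hlim)) 0
  have hpos : ∀ u : Mink, 0 < u 0 → 0 < (‖u‖⁻¹ • u) 0 := fun u hu => by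
    have : u ≠ 0 := fun h => by simp [h] at hu
    have := norm_pos_iff.mpr this
    simp only [Pi.smul_apply, smul_eq_mul]
    positivity
  have h2 := hpos v hv0
  have h3 := hpos v' hv'0
  rw [Pi.neg_apply] at h1
  linarith

/-- Divide by `s = x₀ - x₃ = H₂₂`. The middle coordinates tend to the parts of `G(0)`, and `⟨x, x⟩ =
1` determines the limit of `(x₀ + x₃)/s`, as `1/s² → 0`. -/
theorem EndsAt.tendsToFuture {f : ℂ → Mink} {G : ℂ → ℂ} (h : EndsAt (fun z => toHerm (f z)) G)
    (hf : ∀ᶠ z in 𝓝[≠] 0, f z ∈ deSitter) : TendsToFuture f (𝓝[≠] 0) := by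
  obtain ⟨h1, h2⟩ := h
  set s : ℂ → ℝ := fun z => f z 0 - f z 3 with hs
  have h1' : Tendsto s (𝓝[≠] 0) atTop := by simpa [toHerm] using h1
  have e : ∀ z, toHerm (f z) 0 1 / toHerm (f z) 1 1 =
      ((f z 1 / s z : ℝ) : ℂ) + Complex.I * (f z 2 / s z : ℝ) := by
    intro z
    simp only [toHerm, hs, Matrix.of_apply, Matrix.cons_val', Matrix.cons_val_zero,
      Matrix.cons_val_one]
    push_cast
    ring
  simp only [e] at h2
  have hx1 : Tendsto (fun z => f z 1 / s z) (𝓝[≠] 0) (𝓝 (G 0).re) := by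
    have := (Complex.continuous_re.tendsto _).comp h2
    simpa only [Function.comp_def, Complex.add_re, Complex.I_mul_re, Complex.ofReal_im,
      Complex.ofReal_re, neg_zero, add_zero] using this
  have hx2 : Tendsto (fun z => f z 2 / s z) (𝓝[≠] 0) (𝓝 (G 0).im) := by
    have := (Complex.continuous_im.tendsto _).comp h2
    simpa only [Function.comp_def, Complex.add_im, Complex.I_mul_im, Complex.ofReal_im,
      Complex.ofReal_re, zero_add] using this
  have hspos : ∀ᶠ z in 𝓝[≠] 0, 0 < s z := h1'.eventually_gt_atTop 0
  have hinv : Tendsto (fun z => (s z)⁻¹) (𝓝[≠] 0) (𝓝 0) := h1'.inv_tendsto_atTop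
  set N : ℝ := (G 0).re ^ 2 + (G 0).im ^ 2 with hN
  have hx03 : Tendsto (fun z => (f z 0 + f z 3) / s z) (𝓝[≠] 0) (𝓝 N) := by
    have h3 := ((hx1.pow 2).add (hx2.pow 2)).sub (hinv.pow 2)
    rw [zero_pow two_ne_zero, sub_zero] at h3
    refine h3.congr' ?_
    filter_upwards [hspos, hf] with z hz hfz
    have h4 : lorentz (f z) (f z) = 1 := hfz
    rw [lorentz_apply] at h4
    have h5 := hz.ne'
    field_simp
    simp only [hs]
    linear_combination h4
  -- The null vector over `G(0)`, scaled so that `v₀ - v₃ = 1`.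
  set v : Mink := ![(N + 1) / 2, (G 0).re, (G 0).im, (N - 1) / 2] with hv
  have hv0 : 0 < v 0 := by simp [hv]; positivity
  have hvne : v ≠ 0 := by
    intro h0
    rw [h0] at hv0
    simp at hv0
  refine ⟨v, ?_, hv0, tendsto_normalize hspos hvne ?_⟩
  · rw [lorentz_apply]
    simp [hv, hN]
    ring
  · rw [tendsto_pi_nhds]
    have h0 : Tendsto (fun z => (f z 0 + f z 3) / s z / 2 + 1 / 2) (𝓝[≠] 0)
        (𝓝 (N / 2 + 1 / 2)) := (hx03.div_const 2).add_const _
    have h3 : Tendsto (fun z => (f z 0 + f z 3) / s z / 2 - 1 / 2) (𝓝[≠] 0)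
        (𝓝 (N / 2 - 1 / 2)) := (hx03.div_const 2).sub_const _
    intro i
    simp only [Pi.smul_apply, smul_eq_mul, inv_mul_eq_div]
    fin_cases i
    · rw [show v _ = N / 2 + 1 / 2 by simp [hv]; ring]
      refine h0.congr' ?_
      filter_upwards [hspos] with z hz
      have := hz.ne'
      field_simp
      simp [hs]
      ring
    · exact hx1
    · exact hx2
    · rw [show v _ = N / 2 - 1 / 2 by simp [hv]; ring]
      refine h3.congr' ?_
      filter_upwards [hspos] with z hz
      have := hz.ne'
      field_simp
      simp [hs]
      ring

/-! ### Removing a pole of the hyperbolic Gauss map -/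

/-- The rotation of the light cone which acts by `z ↦ -1 / z` on the sphere of its rays. -/
def halfTurn : Mink ≃L[ℝ] Mink :=
  ContinuousLinearEquiv.piCongrRight ![ContinuousLinearEquiv.refl ℝ ℝ, ContinuousLinearEquiv.neg ℝ,
    ContinuousLinearEquiv.refl ℝ ℝ, ContinuousLinearEquiv.neg ℝ]

theorem halfTurn_apply (x : Mink) : halfTurn x = ![x 0, -x 1, x 2, -x 3] := by
  ext i
  fin_cases i <;> simp [halfTurn]

theorem lorentz_halfTurn (x y : Mink) : lorentz (halfTurn x) (halfTurn y) = lorentz x y := by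
  simp [lorentz_apply, halfTurn_apply]

theorem norm_halfTurn (x : Mink) : ‖halfTurn x‖ = ‖x‖ := by
  simp [Pi.norm_def, halfTurn_apply, Fin.univ_succ]

theorem halfTurn_halfTurn (x : Mink) : halfTurn (halfTurn x) = x := by
  ext i
  fin_cases i <;> simp [halfTurn_apply]

theorem firstForm_halfTurn (f : ℂ → Mink) (z : ℂ) :
    firstForm (fun x => halfTurn (f x)) z = firstForm f z := by
  have h : fderiv ℝ (fun x => halfTurn (f x)) z = (halfTurn : Mink →L[ℝ] Mink) ∘L fderiv ℝ f z :=
    halfTurn.comp_fderiv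
  ext
  simp [firstForm, h, lorentz_halfTurn]

/-- The matrix by which `halfTurn` acts on Hermitian matrices. -/
def quarterTurn : Matrix (Fin 2) (Fin 2) ℂ := !![0, 1; -1, 0]

theorem toHerm_halfTurn (x : Mink) :
    toHerm (halfTurn x) = quarterTurn * toHerm x * quarterTurnᴴ := by
  ext i j
  fin_cases i <;> fin_cases j <;>
    simp [quarterTurn, toHerm, halfTurn_apply, Matrix.mul_apply, Fin.sum_univ_two, Matrix.conjTranspose_apply] <;>
    ring

theorem TendsToFuture.of_halfTurn {f : ℂ → Mink} {l : Filter ℂ}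
    (h : TendsToFuture (fun z => halfTurn (f z)) l) : TendsToFuture f l := by
  obtain ⟨v, hvv, hv0, hlim⟩ := h
  refine ⟨halfTurn v, by rw [lorentz_halfTurn, hvv], by simpa [halfTurn_apply] using hv0, ?_⟩
  have := (halfTurn.continuous.tendsto _).comp hlim
  simpa [Function.comp_def, norm_halfTurn, halfTurn_halfTurn] using this

/-- Left multiplication of `F` replaces `G = p / q` by `-q / p` and keeps `g`, so a pole of `G` at
the puncture becomes a zero. -/
theorem DiskLift.halfTurn {a : ℝ} {f : ℂ → Mink} {F : ℂ → Matrix (Fin 2) (Fin 2) ℂ}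
    {g p q : ℂ → ℂ} (hL : DiskLift a f F g p q) :
    DiskLift a (fun z => halfTurn (f z)) (fun w => quarterTurn * F w) g (fun z => -q z) p := by
  have e0 : ∀ w j, (quarterTurn * F w) 0 j = F w 1 j := fun w j => by
    simp [quarterTurn, Matrix.mul_apply, Fin.sum_univ_two]
  have e1 : ∀ w j, (quarterTurn * F w) 1 j = -F w 0 j := fun w j => by
    simp [quarterTurn, Matrix.mul_apply, Fin.sum_univ_two]
  have d1 : ∀ w j, deriv (fun x => (quarterTurn * F x) 1 j) w =
      -deriv (fun x => F x 0 j) w := fun w j => by simp only [e1, deriv.fun_neg]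
  refine ⟨fun i j => ?_, hL.diff_secondary, fun w hw => ?_, fun w hw i => ?_, fun w hw j => ?_,
    fun w hw h => hL.matDeriv_ne w hw ?_, hL.norm_lt, fun w hw => ?_⟩
  · fin_cases i
    · simpa only [Fin.zero_eta, e0] using hL.diff 1 j
    · simpa only [Fin.mk_one, e1] using (hL.diff 0 j).fun_neg
  · simp only [e0, e1]
    linear_combination hL.det_eq w hw
  · fin_cases i
    · simpa only [Fin.zero_eta, e0] using hL.deriv_col w hw 1
    · simp only [Fin.mk_one, d1, hL.deriv_col w hw 0]; ring
  · simp only [d1, e0]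
    linear_combination -hL.deriv_row w hw j
  · ext i j
    fin_cases i
    · have := congrFun (congrFun h 1) j
      simp only [matDeriv, Matrix.of_apply, d1] at this
      simpa [matDeriv] using this
    · have := congrFun (congrFun h 0) j
      simp only [matDeriv, Matrix.of_apply, e0] at this
      simpa [matDeriv] using this
  · rw [toHerm_halfTurn, hL.projection w hw, Matrix.conjTranspose_mul]
    simp only [Matrix.mul_assoc]

theorem IsCompleteDensity.congr {r : ℝ} {ρ σ : ℂ → ℝ} (h : IsCompleteDensity r ρ)
    (he : ∀ z ∈ puncturedBall r, ρ z = σ z) : IsCompleteDensity r σ := by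
  intro γ h1 h2 h3
  rw [← h γ h1 h2 h3]
  refine setLIntegral_congr_fun measurableSet_Ioo fun t ht => ?_
  simp only [he _ (h2 (Ioo_subset_Ico_self ht))]

theorem DiskLift.tendsToFuture {a : ℝ} {f : ℂ → Mink} {F : ℂ → Matrix (Fin 2) (Fin 2) ℂ}
    {g p q : ℂ → ℂ} (hL : DiskLift a f F g p q) (hp : AnalyticAt ℂ p 0) (hq : AnalyticAt ℂ q 0)
    (hpq : p 0 ≠ 0 ∨ q 0 ≠ 0) (hf : ∀ z ∈ puncturedBall (Real.exp a), DifferentiableAt ℝ f z)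
    (hdS : ∀ᶠ z in 𝓝[≠] 0, f z ∈ deSitter)
    (hc : IsCompleteDensity (Real.exp a) (density f)) : TendsToFuture f (𝓝[≠] 0) := by
  rcases hpq with h | h
  · obtain ⟨b, hba, hU⟩ := hL.halfTurn.exists_unitaryFrame hq.neg hp h fun z hz =>
      CMCFace.halfTurn.differentiableAt.comp z (hf z hz)
    refine TendsToFuture.of_halfTurn ((hU.endsAt ?_).tendsToFuture ?_)
    · refine (hc.congr fun z hz => ?_).mono (Real.exp_le_exp.mpr hba)
      rw [density, density, firstForm_halfTurn]
    · filter_upwards [hdS] with z hz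
      rw [deSitter, mem_ofPred_eq, lorentz_halfTurn]
      exact hz
  · obtain ⟨b, hba, hU⟩ := hL.exists_unitaryFrame hp hq h hf
    exact (hU.endsAt (hc.mono (Real.exp_le_exp.mpr hba))).tendsToFuture hdS

/-! ### The secondary Gauss map near a complete end -/

theorem extAbs_lt_one_iff {g : ℂ → ℂ} {w : ℂ} :
    extAbs g w < 1 ↔ 0 ≤ meromorphicOrderAt g w ∧ ‖g w‖ < 1 := by
  rw [extAbs]
  split_ifs with h
  · simp [h]
  · rw [ENNReal.ofReal_lt_one, and_iff_right (not_lt.mp h)]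

theorem one_lt_extAbs_iff {g : ℂ → ℂ} {w : ℂ} :
    1 < extAbs g w ↔ meromorphicOrderAt g w < 0 ∨ 0 ≤ meromorphicOrderAt g w ∧ 1 < ‖g w‖ := by
  rw [extAbs]
  split_ifs with h
  · simp [h]
  · rw [ENNReal.one_lt_ofReal, and_iff_right (not_lt.mp h), or_iff_right h]

theorem isOpen_extAbs_lt_one {g : ℂ → ℂ} {a : ℝ} (hg : MeromorphicNFOn g (halfPlane a)) :
    IsOpen {w ∈ halfPlane a | extAbs g w < 1} := by
  refine isOpen_iff_mem_nhds.mpr fun w ⟨hw, hw1⟩ => ?_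
  rw [extAbs_lt_one_iff] at hw1
  have han := (hg hw).meromorphicOrderAt_nonneg_iff_analyticAt.mp hw1.1
  filter_upwards [(isOpen_halfPlane a).mem_nhds hw, han.eventually_analyticAt,
    han.continuousAt.norm.eventually (gt_mem_nhds hw1.2)] with x hx hxa hx1
  exact ⟨hx, extAbs_lt_one_iff.mpr ⟨hxa.meromorphicOrderAt_nonneg, hx1⟩⟩

/-- At a pole `|g|` tends to infinity, so it exceeds `1` on a whole neighbourhood. -/
theorem isOpen_one_lt_extAbs {g : ℂ → ℂ} {a : ℝ} (hg : MeromorphicNFOn g (halfPlane a)) :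
    IsOpen {w ∈ halfPlane a | 1 < extAbs g w} := by
  refine isOpen_iff_mem_nhds.mpr fun w ⟨hw, hw1⟩ => ?_
  rcases one_lt_extAbs_iff.mp hw1 with h | h
  · have h1 : ∀ᶠ x in 𝓝[≠] w, 1 < ‖g x‖ :=
      (tendsto_norm_cobounded_atTop.comp
        (tendsto_cobounded_of_meromorphicOrderAt_neg h)).eventually_gt_atTop 1
    have h2 := eventually_nhdsWithin_iff.mp (h1.and (hg hw).meromorphicAt.eventually_analyticAt)
    filter_upwards [(isOpen_halfPlane a).mem_nhds hw, h2] with x hx hx2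
    by_cases hxw : x = w
    · rw [hxw]; exact ⟨hw, hw1⟩
    · exact ⟨hx, one_lt_extAbs_iff.mpr
        (Or.inr ⟨(hx2 hxw).2.meromorphicOrderAt_nonneg, (hx2 hxw).1⟩)⟩
  · have han := (hg hw).meromorphicOrderAt_nonneg_iff_analyticAt.mp h.1
    filter_upwards [(isOpen_halfPlane a).mem_nhds hw, han.eventually_analyticAt,
      han.continuousAt.norm.eventually (lt_mem_nhds h.2)] with x hx hxa hx1
    exact ⟨hx, one_lt_extAbs_iff.mpr (Or.inr ⟨hxa.meromorphicOrderAt_nonneg, hx1⟩)⟩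

theorem extAbs_lt_one_or_one_lt {g : ℂ → ℂ} {a : ℝ} (hg : MeromorphicNFOn g (halfPlane a))
    (h : ∀ w ∈ halfPlane a, extAbs g w ≠ 1) :
    (∀ w ∈ halfPlane a, extAbs g w < 1) ∨ ∀ w ∈ halfPlane a, 1 < extAbs g w := by
  rcases (convex_halfPlane a).isPreconnected.subset_or_subset (isOpen_extAbs_lt_one hg)
    (isOpen_one_lt_extAbs hg) (Set.disjoint_left.mpr fun w h1 h2 => lt_asymm h1.2 h2.2)
    (fun w hw => (lt_or_gt_of_ne (h w hw)).imp (fun h => ⟨hw, h⟩) fun h => ⟨hw, h⟩) with h1 | h1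
  · exact Or.inl fun w hw => (h1 hw).2
  · exact Or.inr fun w hw => (h1 hw).2

/-! ### From null lifts to disk lifts -/

section Lift

variable {f : ℂ → Mink} {F : ℂ → Matrix (Fin 2) (Fin 2) ℂ} {g om p q : ℂ → ℂ} {a : ℝ} {w : ℂ}

theorem IsNullLift.hasDerivAt (hL : IsNullLift f F g om) (hw : w ∈ halfPlane 0) (i j : Fin 2) :
    HasDerivAt (fun x => F x i j) (deriv (fun x => F x i j) w) w :=
  ((hL.holomorphic i j).differentiableAt ((isOpen_halfPlane 0).mem_nhds hw)).hasDerivAt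

theorem IsNullLift.deriv_eq (hL : IsNullLift f F g om) (hw : w ∈ halfPlane 0)
    (hg : 0 ≤ meromorphicOrderAt g w) (i : Fin 2) :
    deriv (fun x => F x i 0) w = om w * (g w * F w i 0 + F w i 1) ∧
      deriv (fun x => F x i 1) w = -g w * deriv (fun x => F x i 0) w := by
  have h1 : matDeriv F w = F w * (om w • !![g w, -(g w) ^ 2; 1, -(g w)]) := by
    rw [← hL.ode w hw hg, Matrix.mul_nonsing_inv_cancel_left]
    rw [hL.det_eq_one w hw]; exact isUnit_one
  have h2 : ∀ j, deriv (fun x => F x i j) w =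
      (F w * (om w • !![g w, -(g w) ^ 2; 1, -(g w)])) i j := fun j => by rw [← h1]; rfl
  rw [h2, h2]
  simp [Matrix.mul_apply, Fin.sum_univ_two]
  constructor <;> ring

/-- The induced metric has the factor `(1 - |g|²)²`, which vanishes where `|g| = 1`. -/
theorem IsNullLift.extAbs_ne_one (hL : IsNullLift f F g om) (hw : w ∈ halfPlane 0)
    (hf : DifferentiableAt ℝ f (Complex.exp w)) (hpos : 0 < firstForm f (Complex.exp w) 1 1) :
    extAbs g w ≠ 1 := by
  intro h
  rw [extAbs] at h
  split_ifs at h with h0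
  · exact ENNReal.top_ne_one h
  rw [ENNReal.ofReal_eq_one] at h
  have hd := hL.deriv_eq hw (not_lt.mp h0)
  have h1 := firstForm_self_eq (l := g w) (d := fun i => deriv (fun x => F x i 0) w) hf
    (by filter_upwards [(isOpen_halfPlane 0).mem_nhds hw] with x hx using hL.projection x hx)
    (fun i => hL.hasDerivAt hw i 0)
    (fun i => by rw [← (hd i).2]; exact hL.hasDerivAt hw i 1)
    (by rw [(hd 0).1, (hd 1).1]; ring) 1
  rw [h1, h] at hpos
  simp at hpos

theorem IsNullLift.diskLift (hL : IsNullLift f F g om) (ha : a ≤ 0)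
    (hg : ∀ w ∈ halfPlane a, extAbs g w < 1)
    (hrow : ∀ w ∈ halfPlane a, ∀ j, matDeriv F w 0 j * q (Complex.exp w) =
      matDeriv F w 1 j * p (Complex.exp w)) : DiskLift a f F g p q where
  diff i j := (hL.holomorphic i j).mono (halfPlane_mono ha)
  diff_secondary w hw := ((hL.meromorphic (halfPlane_mono ha hw)).meromorphicOrderAt_nonneg_iff_analyticAt.mp
    (extAbs_lt_one_iff.mp (hg w hw)).1).differentiableAt.differentiableWithinAt
  det_eq w hw := by rw [← Matrix.det_fin_two, hL.det_eq_one w (halfPlane_mono ha hw)]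
  deriv_col w hw i := (hL.deriv_eq (halfPlane_mono ha hw) (extAbs_lt_one_iff.mp (hg w hw)).1 i).2
  deriv_row := hrow
  matDeriv_ne w hw := hL.immersion w (halfPlane_mono ha hw)
  norm_lt w hw := (extAbs_lt_one_iff.mp (hg w hw)).2
  projection w hw := hL.projection w (halfPlane_mono ha hw)

theorem toHerm_neg (x : Mink) : toHerm (-x) = -toHerm x := by
  ext i j
  fin_cases i <;> fin_cases j <;> simp [toHerm] <;> ring

/-- A matrix which exchanges the columns up to the factor `i`. -/
def columnSwap : Matrix (Fin 2) (Fin 2) ℂ := !![0, Complex.I; Complex.I, 0]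

theorem columnSwap_mul : columnSwap * e3 * columnSwapᴴ = -e3 := by
  ext i j
  fin_cases i <;> fin_cases j <;>
    simp [columnSwap, e3, Matrix.mul_apply, Fin.sum_univ_two, Matrix.conjTranspose_apply]

/-- Exchanging the columns turns `e₃` into `-e₃`, hence `f` into `-f`, and inverts `g`; the factor
`i` keeps the determinant equal to `1`. -/
theorem IsNullLift.diskLift_neg (hL : IsNullLift f F g om) (ha : a ≤ 0)
    (hg : ∀ w ∈ halfPlane a, 1 < extAbs g w)
    (hrow : ∀ w ∈ halfPlane a, ∀ j, matDeriv F w 0 j * q (Complex.exp w) =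
      matDeriv F w 1 j * p (Complex.exp w)) :
    DiskLift a (fun z => -f z) (fun w => F w * columnSwap) g⁻¹ p q := by
  have hm := halfPlane_mono ha
  have e0 : ∀ w i, (F w * columnSwap) i 0 = F w i 1 * Complex.I := fun w i => by
    simp [columnSwap, Matrix.mul_apply, Fin.sum_univ_two]
  have e1 : ∀ w i, (F w * columnSwap) i 1 = F w i 0 * Complex.I := fun w i => by
    simp [columnSwap, Matrix.mul_apply, Fin.sum_univ_two]
  have d0 : ∀ w i, deriv (fun x => (F x * columnSwap) i 0) w =
      deriv (fun x => F x i 1) w * Complex.I := fun w i => by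
    simp only [e0, deriv_mul_const_field]
  have d1 : ∀ w i, deriv (fun x => (F x * columnSwap) i 1) w =
      deriv (fun x => F x i 0) w * Complex.I := fun w i => by
    simp only [e1, deriv_mul_const_field]
  -- The normal form gives `g` the value `0` at its poles, so `g⁻¹` also has the value `0` there,
  -- which is the correct value of `1/g`.
  have hpole : ∀ w ∈ halfPlane a, meromorphicOrderAt g w < 0 → g w = 0 := fun w hw h => by
    rcases meromorphicNFAt_iff_analyticAt_or.mp (hL.meromorphic (hm hw)) with h1 | h1
    · exact absurd h1.meromorphicOrderAt_nonneg (not_le.mpr h)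
    · exact h1.2.2
  have han : ∀ w ∈ halfPlane a, AnalyticAt ℂ g⁻¹ w := by
    intro w hw
    rcases one_lt_extAbs_iff.mp (hg w hw) with h | h
    · refine (meromorphicNFAt_inv.mpr
        (hL.meromorphic (hm hw))).meromorphicOrderAt_nonneg_iff_analyticAt.mp ?_
      rw [meromorphicOrderAt_inv]
      obtain ⟨n, hn⟩ := WithTop.ne_top_iff_exists.mp (h.trans_le le_top).ne
      rw [← hn] at h ⊢
      have h1 : n < 0 := by exact_mod_cast h
      change (0 : WithTop ℤ) ≤ ((-n : ℤ) : WithTop ℤ)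
      exact_mod_cast (by omega : 0 ≤ -n)
    · refine ((hL.meromorphic (hm hw)).meromorphicOrderAt_nonneg_iff_analyticAt.mp h.1).inv ?_
      intro h0
      rw [h0, norm_zero] at h
      linarith [h.2]
  have hcol : ∀ w ∈ halfPlane a, 0 ≤ meromorphicOrderAt g w → ∀ i,
      deriv (fun x => F x i 0) w = -g⁻¹ w * deriv (fun x => F x i 1) w := by
    intro w hw h0 i
    have h1 := (one_lt_extAbs_iff.mp (hg w hw)).resolve_left (not_lt.mpr h0)
    have h2 : g w ≠ 0 := fun h => by
      rw [h, norm_zero] at h1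
      linarith [h1.2]
    rw [(hL.deriv_eq (hm hw) h0 i).2, Pi.inv_apply]
    field_simp
  refine ⟨fun i j => ?_, fun w hw => (han w hw).differentiableAt.differentiableWithinAt,
    fun w hw => ?_, fun w hw i => ?_, fun w hw j => ?_, fun w hw h => hL.immersion w (hm hw) ?_,
    fun w hw => ?_, fun w hw => ?_⟩
  · fin_cases j
    · simpa only [Fin.zero_eta, e0] using ((hL.holomorphic i 1).mono hm).mul_const _
    · simpa only [Fin.mk_one, e1] using ((hL.holomorphic i 0).mono hm).mul_const _
  · have h1 := hL.det_eq_one w (hm hw)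
    rw [Matrix.det_fin_two] at h1
    rw [e0, e1, e0, e1]
    linear_combination h1 - (F w 0 0 * F w 1 1 - F w 0 1 * F w 1 0) * Complex.I_sq
  · rw [d0, d1, ← mul_assoc]
    congr 1
    -- At a pole of `g` the column relation is obtained as a limit from nearby points.
    have hdc : ∀ j, ContinuousAt (deriv fun x => F x i j) w := fun j =>
      (((hL.holomorphic i j).analyticAt ((isOpen_halfPlane 0).mem_nhds (hm hw))).deriv).continuousAt
    have h1 := (hdc 0).tendsto.mono_left (nhdsWithin_le_nhds (s := {w}ᶜ))
    have h2 := ((han w hw).continuousAt.neg.mul (hdc 1)).tendsto.mono_left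
      (nhdsWithin_le_nhds (s := {w}ᶜ))
    refine tendsto_nhds_unique h1 (h2.congr' ?_)
    filter_upwards [(hL.meromorphic (hm hw)).meromorphicAt.eventually_analyticAt,
      mem_nhdsWithin_of_mem_nhds ((isOpen_halfPlane a).mem_nhds hw)] with x hx hxa
    exact (hcol x hxa hx.meromorphicOrderAt_nonneg i).symm
  · fin_cases j
    · simp only [Fin.zero_eta, d0]
      have h1 := hrow w hw 1
      simp only [matDeriv, Matrix.of_apply] at h1
      linear_combination Complex.I * h1
    · simp only [Fin.mk_one, d1]
      have h1 := hrow w hw 0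
      simp only [matDeriv, Matrix.of_apply] at h1
      linear_combination Complex.I * h1
  · ext i j
    fin_cases j
    · have := congrFun (congrFun h i) 1
      simp only [matDeriv, Matrix.of_apply, d1] at this
      simpa [matDeriv] using this
    · have := congrFun (congrFun h i) 0
      simp only [matDeriv, Matrix.of_apply, d0] at this
      simpa [matDeriv] using this
  · rw [Pi.inv_apply, norm_inv]
    rcases one_lt_extAbs_iff.mp (hg w hw) with h | h
    · rw [hpole w hw h]; simp
    · exact inv_lt_one_of_one_lt₀ h.2
  · rw [toHerm_neg, hL.projection w (hm hw), Matrix.conjTranspose_mul]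
    calc -(F w * e3 * (F w)ᴴ) = F w * (columnSwap * e3 * columnSwapᴴ) * (F w)ᴴ := by
          rw [columnSwap_mul]; simp
      _ = _ := by simp only [Matrix.mul_assoc]

theorem DiskLift.mono (hL : DiskLift a f F g p q) {b : ℝ} (h : b ≤ a) : DiskLift b f F g p q where
  diff i j := (hL.diff i j).mono (halfPlane_mono h)
  diff_secondary := hL.diff_secondary.mono (halfPlane_mono h)
  det_eq w hw := hL.det_eq w (halfPlane_mono h hw)
  deriv_col w hw := hL.deriv_col w (halfPlane_mono h hw)
  deriv_row w hw := hL.deriv_row w (halfPlane_mono h hw)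
  matDeriv_ne w hw := hL.matDeriv_ne w (halfPlane_mono h hw)
  norm_lt w hw := hL.norm_lt w (halfPlane_mono h hw)
  projection w hw := hL.projection w (halfPlane_mono h hw)

/-- The metric is conformal, so path lengths depend only on `density f`. -/
theorem DiskLift.firstForm_self (hL : DiskLift a f F g p q)
    (hf : ∀ z ∈ puncturedBall (Real.exp a), DifferentiableAt ℝ f z) {z : ℂ}
    (hz : z ∈ puncturedBall (Real.exp a)) (u : ℂ) :
    firstForm f z u u = ‖u‖ ^ 2 * firstForm f z 1 1 := by
  have hw := log_mem_halfPlane (norm_pos_iff.mp hz.1) hz.2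
  have hexp := Complex.exp_log (norm_pos_iff.mp hz.1)
  have hd : ∀ i j, HasDerivAt (fun x => F x i j) (deriv (fun x => F x i j) (Complex.log z))
      (Complex.log z) := fun i j =>
    ((hL.diff i j).differentiableAt ((isOpen_halfPlane a).mem_nhds hw)).hasDerivAt
  have hdet : F (Complex.log z) 1 1 * deriv (fun x => F x 0 0) (Complex.log z) -
        F (Complex.log z) 0 1 * deriv (fun x => F x 1 0) (Complex.log z) =
      g (Complex.log z) * (F (Complex.log z) 0 0 * deriv (fun x => F x 1 0) (Complex.log z) -
        F (Complex.log z) 1 0 * deriv (fun x => F x 0 0) (Complex.log z)) := by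
    have h1 := ((hd 0 0).fun_mul (hd 1 1)).fun_sub ((hd 0 1).fun_mul (hd 1 0))
    have h2 := h1.unique ((hasDerivAt_const _ (1 : ℂ)).congr_of_eventuallyEq (by
      filter_upwards [(isOpen_halfPlane a).mem_nhds hw] with x hx using hL.det_eq x hx))
    rw [hL.deriv_col _ hw, hL.deriv_col _ hw] at h2
    linear_combination h2
  have h3 := fun u => firstForm_self_eq (l := g (Complex.log z))
    (d := fun i => deriv (fun x => F x i 0) (Complex.log z)) (by rw [hexp]; exact hf z hz)
    (by filter_upwards [(isOpen_halfPlane a).mem_nhds hw] with x hx using hL.projection x hx)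
    (fun i => hd i 0) (fun i => by rw [← hL.deriv_col _ hw i]; exact hd i 1) hdet u
  rw [hexp] at h3
  rw [h3, h3, norm_one]
  ring

theorem firstForm_neg (f : ℂ → Mink) : firstForm (fun z => -f z) = firstForm f := by
  ext z
  simp [firstForm]

theorem IsCompleteEnd.neg (h : IsCompleteEnd f) : IsCompleteEnd fun z => -f z := by
  simpa only [IsCompleteEnd, firstForm_neg] using h

theorem exists_le_exp_le {r : ℝ} (hr : 0 < r) (a : ℝ) : ∃ b ≤ a, Real.exp b ≤ r :=
  ⟨min a (Real.log r), min_le_left _ _,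
    (Real.exp_le_exp.mpr (min_le_right _ _)).trans_eq (Real.exp_log hr)⟩

theorem puncturedBall_subset_puncturedDisk (ha : a ≤ 0) :
    puncturedBall (Real.exp a) ⊆ puncturedDisk := fun _ hz =>
  ⟨hz.1, hz.2.trans_le (Real.exp_le_one_iff.mpr ha)⟩

/-- On a disk so small that `T` vanishes, the complete metric is the induced one, and completeness
becomes that of the conformal density. -/
theorem DiskLift.tendsToFuture_of_isCompleteEnd (hL : DiskLift a f F g p q) (ha : a ≤ 0)
    (hp : AnalyticAt ℂ p 0) (hq : AnalyticAt ℂ q 0) (hpq : p 0 ≠ 0 ∨ q 0 ≠ 0)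
    (hf : ∀ z ∈ puncturedDisk, DifferentiableAt ℝ f z) (hdS : MapsTo f puncturedDisk deSitter)
    (hc : IsCompleteEnd f) : TendsToFuture f (𝓝[≠] 0) := by
  obtain ⟨T, ⟨r, hr, hT⟩, -, hpath⟩ := hc
  obtain ⟨b, hba, hbr⟩ := exists_le_exp_le hr a
  have hsub := puncturedBall_subset_puncturedDisk (hba.trans ha)
  have hf' : ∀ z ∈ puncturedBall (Real.exp b), DifferentiableAt ℝ f z := fun z hz => hf z (hsub hz)
  refine (hL.mono hba).tendsToFuture hp hq hpq hf' ?_ fun γ h1 h2 h3 => ?_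
  · filter_upwards [puncturedBall_mem_nhdsNE (Real.exp_pos b)] with z hz using hdS (hsub hz)
  · rw [← hpath γ h1 (h2.mono_right hsub) h3, pathLength]
    refine setLIntegral_congr_fun measurableSet_Ioo fun t ht => ?_
    have hz := h2 (Ioo_subset_Ico_self ht)
    rw [hT _ hz.1 (hz.2.trans_le hbr), zero_add, (hL.mono hba).firstForm_self hf' hz,
      Real.sqrt_mul (sq_nonneg _), Real.sqrt_sq (norm_nonneg _), mul_comm, density]

theorem exists_radius_iff {P : ℂ → Prop} :
    (∃ r : ℝ, 0 < r ∧ ∀ w ∈ leftHalfPlane, ‖Complex.exp w‖ < r → P w) ↔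
      ∃ a ≤ 0, ∀ w ∈ halfPlane a, P w := by
  constructor
  · rintro ⟨r, hr, h⟩
    obtain ⟨b, hb, hbr⟩ := exists_le_exp_le hr 0
    exact ⟨b, hb, fun w hw => h w (halfPlane_mono hb hw)
      ((mem_halfPlane_iff_norm_exp.mp hw).trans_le hbr)⟩
  · rintro ⟨a, -, h⟩
    exact ⟨Real.exp a, Real.exp_pos a, fun w _ hw => h w (mem_halfPlane_iff_norm_exp.mpr hw)⟩

/-- Where `T` vanishes, `ds²` itself is Riemannian, so `|g| ≠ 1`, and connectedness of the
half-plane selects one side. -/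
theorem exists_extAbs_lt_one_or_one_lt (hf : ∀ z ∈ puncturedDisk, DifferentiableAt ℝ f z)
    (hc : IsCompleteEnd f) (hL : IsNullLift f F g om) :
    (∃ a ≤ 0, ∀ w ∈ halfPlane a, extAbs g w < 1) ∨ ∃ a ≤ 0, ∀ w ∈ halfPlane a, 1 < extAbs g w := by
  obtain ⟨T, ⟨r, hr, hT⟩, hmetric, -⟩ := hc
  obtain ⟨a, ha, har⟩ := exists_le_exp_le hr 0
  have hm := halfPlane_mono ha
  refine (extAbs_lt_one_or_one_lt (a := a) (fun w hw => hL.meromorphic (hm hw))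
    fun w hw => ?_).imp (fun h => ⟨a, ha, h⟩) fun h => ⟨a, ha, h⟩
  have hz : Complex.exp w ∈ puncturedBall (Real.exp a) :=
    ⟨by simp, mem_halfPlane_iff_norm_exp.mp hw⟩
  have hz' := puncturedBall_subset_puncturedDisk ha hz
  refine hL.extAbs_ne_one (hm hw) (hf _ hz') ?_
  have := hmetric.pos _ hz' 1 one_ne_zero
  rwa [hT _ hz.1 (hz.2.trans_le har), zero_add] at this

end Lift

end CMCFace

end

/-! ### The two equivalences -/

theorem mainTheorem8 (f : ℂ → CMCFace.Mink) (F : ℂ → Matrix (Fin 2) (Fin 2) ℂ) (g om : ℂ → ℂ)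
    (hf : CMCFace.IsCMCOneFace CMCFace.puncturedDisk f)
    (hcomplete : CMCFace.IsCompleteEnd f)
    (hlift : CMCFace.IsNullLift f F g om)
    (hregular : CMCFace.IsRegularEnd F) :
    ((∃ P ∈ CMCFace.futureBoundary, CMCFace.ConvergesToRay f (𝓝[≠] 0) P) ↔
      ∃ r : ℝ, 0 < r ∧ ∀ w ∈ CMCFace.leftHalfPlane, ‖Complex.exp w‖ < r → CMCFace.extAbs g w < 1) ∧
    ((∃ P ∈ CMCFace.pastBoundary, CMCFace.ConvergesToRay f (𝓝[≠] 0) P) ↔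
      ∃ r : ℝ, 0 < r ∧ ∀ w ∈ CMCFace.leftHalfPlane, ‖Complex.exp w‖ < r → 1 < CMCFace.extAbs g w) := by
  rw [CMCFace.exists_futureBoundary_iff, CMCFace.exists_pastBoundary_iff,
    CMCFace.exists_radius_iff, CMCFace.exists_radius_iff]
  have hopen : IsOpen CMCFace.puncturedDisk :=
    (isOpen_lt continuous_const continuous_norm).inter (isOpen_lt continuous_norm continuous_const)
  have hd : ∀ z ∈ CMCFace.puncturedDisk, DifferentiableAt ℝ f z := fun z hz =>
    (hf.smooth.contDiffAt (hopen.mem_nhds hz)).differentiableAt (by simp)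
  obtain ⟨p, q, hp, hq, hpq, hrow⟩ := hregular
  obtain ⟨c, -, hrow⟩ := CMCFace.exists_radius_iff.mp hrow
  have hfut : (∃ a ≤ 0, ∀ w ∈ CMCFace.halfPlane a, CMCFace.extAbs g w < 1) →
      CMCFace.TendsToFuture f (𝓝[≠] 0) := by
    rintro ⟨a, ha, h⟩
    have hb := (min_le_left a c).trans ha
    exact (hlift.diskLift hb (fun w hw => h w (CMCFace.halfPlane_mono (min_le_left a c) hw))
      fun w hw => hrow w (CMCFace.halfPlane_mono (min_le_right a c) hw)).tendsToFuture_of_isCompleteEnd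
        hb hp hq hpq hd hf.mapsTo hcomplete
  have hpast : (∃ a ≤ 0, ∀ w ∈ CMCFace.halfPlane a, 1 < CMCFace.extAbs g w) →
      CMCFace.TendsToFuture (fun z => -f z) (𝓝[≠] 0) := by
    rintro ⟨a, ha, h⟩
    have hb := (min_le_left a c).trans ha
    refine (hlift.diskLift_neg hb (fun w hw => h w (CMCFace.halfPlane_mono (min_le_left a c) hw))
      fun w hw => hrow w (CMCFace.halfPlane_mono (min_le_right a c) hw)).tendsToFuture_of_isCompleteEnd
        hb hp hq hpq (fun z hz => (hd z hz).fun_neg) (fun z hz => ?_) hcomplete.neg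
    have h1 : CMCFace.lorentz (f z) (f z) = 1 := hf.mapsTo hz
    show CMCFace.lorentz (-f z) (-f z) = 1
    simpa using h1
  -- The converse implications follow by exclusion: the wrong alternative for `|g|` would give
  -- convergence to the opposite boundary as well.
  have hor := CMCFace.exists_extAbs_lt_one_or_one_lt hd hcomplete hlift
  exact ⟨⟨fun h => hor.resolve_right fun h' => h.not_neg (hpast h'), hfut⟩,
    ⟨fun h => hor.resolve_left fun h' => (hfut h').not_neg h, hpast⟩⟩
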